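/- **Notation.** Let $\tilde\phi(\theta)=\Gamma(\tfrac34+\tfrac{\theta}{2\pi i})\Gamma(-\tfrac{\theta}{2\pi i})$, $\tau(z)=1/(\tilde\phi(z)\tilde\phi(-z))$, $\tilde b(\theta)=\frac{\theta}{\theta-i\pi/2}$, $\tilde c(\theta)=\frac{-i\pi/2}{\theta-i\pi/2}$ and $\tilde S(\theta)_{AB}^{DC}=\tilde b(\theta)\delta_A^C\delta_B^D+\tilde c(\theta)\delta_A^D\delta_B^C$. For rapidities $\theta_1,\dots,\theta_n$ and a reference colour $r$, $\tilde C^{B}(\theta,z)_{A}^{A'}=\sum_{h}\prod_{i=1}^n\tilde S(\theta_i-z)_{A_ih_i}^{h_{i-1}A_i'}$ (with $h_n=r$, $h_0=B$) is an element of the monodromy matrix, and $\tilde\Phi^{\underline B}(\underline\theta,\underline z)=\Omega\,\tilde C^{B_m}(\underline\theta,z_m)\cdots\tilde C^{B_1}(\underline\theta,z_1)$, where $\Omega$ is the co-vector with all colours equal to $r$. Put $h(\underline\theta,\underline z)=\prod_{i,j}\tilde\phi(\theta_i-z_j)\prod_{i<j}\tau(z_i-z_j)$. The contour $\mathcal C_{\underline\theta}$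 consists of a horizontal line, run through from left to right, passing between the points $\theta_i-2\pi i$ and the points $\theta_i-\tfrac12\pi i$, and of a small clockwise circle around each $\theta_i$. For four particles of colours $A_i\in\{1,2,3,4\}$ the $SU(4)$ form factor of the pseudo-potential (numbers of weight flips $n_1=2,n_2=1,n_3=0$) is $$F^{SU(4),J}_{\underline A}(\underline\theta)=K_{\underline A}(\underline\theta)\prod_{1\le i<j\le4}F^{SU(4)}(\theta_{ij}),\qquad K_{\underline A}(\underline\theta)=\int_{\mathcal C_{\underline\theta}}\!dz_1\int_{\mathcal C_{\underline\theta}}\!dz_2\;h(\underline\theta,\underline z)\,p^J(\underline\theta,\underline z)\sum_{\underline B}K^{(1)}_{\underline B}(\underline z)\tilde\Phi^{\underline B}_{\underline A}(\underline\theta,\underline z),$$ $$p^J=N\,\frac{e^{\frac12(\sum\theta_i-z_1-z_2)}}{\sum_i e^{\theta_i}},\qquad K^{(1)}_{\underline B}(\underline z)=\int_{\mathcal C_{\underline z}}dy\,\tilde\phi(z_1-y)\tilde\phi(z_2-y)\,\tilde\Phi^{(1)\,3}_{\ \ \underline B}(\underline z,y),$$ where $B_j\in\{2,3,4\}$, $\tilde\Phi$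 has reference colour $1$, $\tilde\Phi^{(1)}$ is the analogous co-vector for the colours $2,3,4$ with reference colour $2$, $N$ is a normalization constant, and, with the Barnes function $G$ and $x=\theta/(2\pi i)$, $$F^{SU(4)}(\theta)=\frac{G(x)G(1-x)}{G(\frac34+x)G(\frac74-x)}.$$ The $O(6)$ vector states $\alpha=1,2,3,\bar3,\bar2,\bar1$ are the bound states $(12),(13),(14),(23),(24),(34)$ of two $SU(4)$ particles, with fusion intertwiner $\Gamma^{(RS)}_{AB}=i\Gamma(\tfrac34)(2/\pi)^{1/4}(\delta_A^R\delta_B^S-\delta_A^S\delta_B^R)$. The bound state formula for $n=4$ is $$\sum_{\alpha_1,\alpha_2}F_{\alpha_1\alpha_2}(\omega_1,\omega_2)\,\Gamma^{\alpha_1}_{A_1A_2}\Gamma^{\alpha_2}_{A_3A_4}=\tfrac12\operatorname*{Res}_{\theta_{12}=\frac12 i\pi}\ \operatorname*{Res}_{\theta_{34}=\frac12 i\pi}F^{SU(4),J}_{\underline A}(\underline\theta),\qquad \omega_1=\tfrac12(\theta_1+\theta_2),\ \omega_2=\tfrac12(\theta_3+\theta_4).$$ By definition, the two-particle $O(6)$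 form factors $F^{J^{\alpha\beta}}_{\alpha_1\alpha_2}$ of the pseudo-potential $J^{\alpha\beta}$ form an antisymmetric $O(6)$ tensor in $\alpha,\beta$ (that is, antisymmetric in $\alpha,\beta$ and equivariant under the group $O(6)$ in the complex basis, with invariant form $\mathbf C_{\alpha\beta}=\delta_{\alpha\bar\beta}$), whose highest weight component $J^{12}$ is given by the bound state formula. Finally, let $$F^{O(6)}(\theta)=\frac{G(x)G(1-x)}{G(\frac12+x)G(\frac32-x)}\,\frac{G(\frac14+x)G(\frac54-x)}{G(\frac34+x)G(\frac74-x)},\qquad F_-^{\min}(\theta)=\frac{\Gamma(\frac34)^2\,F^{O(6)}(\theta)}{F^{O(6)}(i\pi)\,\Gamma(\frac54-x)\Gamma(\frac14+x)},$$ $$F_-(\theta)=\frac{F_-^{\min}(\theta)}{\sinh\frac12(\theta-\frac12i\pi)\,\sinh\frac12(\theta+\frac12i\pi)} .$$ Space-time has metric $(+,-)$, $\epsilon^{01}=1$, $p^\mu=m(\cosh\theta,\sinh\theta)$, $\langle0|\mathcal O(x)|\theta_1,\theta_2\rangle=e^{-ix(p_1+p_2)}F^{\mathcal O}(\theta_1,\theta_2)$;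 $\gamma^0=\begin{pmatrix}0&1\\1&0\end{pmatrix}$, $\gamma^1=\begin{pmatrix}0&1\\-1&0\end{pmatrix}$, $u(\theta)=m(e^{-\theta/2},e^{\theta/2})^{T}$, $v(\theta)=im(e^{-\theta/2},-e^{\theta/2})^{T}$ (so $\bar uu=2m^2=-\bar vv$), and $\bar v=v^\dagger\gamma^0$ for real $\theta$, continued analytically to complex $\theta$. **Proposition.** (a) Let the two integration lines be horizontal lines $\operatorname{Im}z=\ell_1$ and $\operatorname{Im}y=\ell_2$ with $\ell_1+\frac\pi2<\operatorname{Im}\theta_i<\ell_2+2\pi$ for all $i$ and $\ell_2+\frac\pi2<\ell_1$. If $\theta_i\ne\theta_j$ and $\theta_i-\theta_j\neq\frac12i\pi$ for $i\neq j$, then all contour integrals in the definition of $K_{\underline A}(\underline\theta)$ exist. (b) For every mass $m>0$ there is a constant $N\neq0$, independent of the rapidities, of the indices and of the choice of the integration lines, such that the following holds for all $\theta_1\ne\theta_2$ with $|\operatorname{Im}\theta_{12}|<\frac\pi2$, in particular for all distinct real rapidities. The iterated residues in the bound state formula exist, the bound state formula is solvable and, together with $O(6)$ covariance, determines the form factors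 $F^{J^{\alpha\beta}}_{\alpha_1\alpha_2}$ uniquely, and $$F^{J^{\alpha\beta}}_{\alpha_1\alpha_2}(\theta_1,\theta_2)=im\left(\delta^\alpha_{\alpha_1}\delta^\beta_{\alpha_2}-\delta^\beta_{\alpha_1}\delta^\alpha_{\alpha_2}\right)\frac{1}{\cosh\frac12\theta_{12}}\,F_-(\theta_{12}).$$ The current $J_\mu^{\alpha\beta}(x)=\epsilon_{\mu\nu}\partial^\nu J^{\alpha\beta}(x)$ then has the form factor $$F^{J_\mu^{\alpha\beta}}_{\alpha_1\alpha_2}(\theta_1,\theta_2)=i\left(\delta^\alpha_{\alpha_1}\delta^\beta_{\alpha_2}-\delta^\beta_{\alpha_1}\delta^\alpha_{\alpha_2}\right)\bar v(\theta_1)\gamma_\mu u(\theta_2)\,F_-(\theta_{12}).$$ -/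

import Mathlib

open Complex Filter Topology MeasureTheory
open scoped Matrix

noncomputable section

namespace GrossNeveu

/-! ### Contour integrals and residues -/

/-- `ρ` is the residue of `f` at the isolated singularity `a`. -/
def HasResidueAt (f : ℂ → ℂ) (a ρ : ℂ) : Prop :=
  (∀ᶠ z in 𝓝[≠] a, DifferentiableAt ℂ f z) ∧
    ∀ᶠ r in 𝓝[>] (0 : ℝ), (∮ z in C(a, r), f z) = 2 * Real.pi * I * ρ

/-- The counterclockwise integral over a sufficiently small circle around `a`. -/
def smallCircleIntegral (f : ℂ → ℂ) (a : ℂ) : ℂ :=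
  limUnder (𝓝[>] (0 : ℝ)) fun r => ∮ z in C(a, r), f z

/-- The integral over the contour that consists of the line `Im z = ℓ`, run through from left to
right, and of a small clockwise circle around each of the points `a i`. -/
def contourIntegral {n : ℕ} (ℓ : ℝ) (a : Fin n → ℂ) (f : ℂ → ℂ) : ℂ :=
  (∫ x : ℝ, f (x + ℓ * I)) - ∑ i, smallCircleIntegral f (a i)

/-- The integral over that contour exists: it converges absolutely on the line, and the points
encircled are isolated singularities (or regular points) of the integrand. -/
def ContourConverges {n : ℕ} (ℓ : ℝ) (a : Fin n → ℂ) (f : ℂ → ℂ) : Prop :=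
  Integrable (fun x : ℝ => f (x + ℓ * I)) ∧ ∀ i, ∃ ρ, HasResidueAt f (a i) ρ

/-! ### Special functions -/

/-- The Barnes G-function, by its Weierstrass product
`G(1+w) = (2π)^(w/2) exp(-(w+w²(1+γ))/2) ∏_{k≥1} (1+w/k)^k exp(w²/(2k)-w)`. -/
def barnesG (z : ℂ) : ℂ :=
  let w := z - 1
  (2 * Real.pi : ℂ) ^ (w / 2) * exp (-(w + w ^ 2 * (1 + Real.eulerMascheroniConstant)) / 2) *
    ∏' k : ℕ, (1 + w / (k + 1)) ^ (k + 1) * exp (w ^ 2 / (2 * (k + 1)) - w)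

/-- The variable `θ / (2πi)`. -/
def xvar (θ : ℂ) : ℂ := θ / (2 * Real.pi * I)

/-- `φ̃(θ) = Γ(3/4 + θ/(2πi)) Γ(-θ/(2πi))`. -/
def phiT (θ : ℂ) : ℂ := Gamma (3 / 4 + xvar θ) * Gamma (-xvar θ)

def tau (z : ℂ) : ℂ := 1 / (phiT (-z) * phiT z)

/-- The amplitudes `b̃`, `c̃` of the S-matrix `S̃ = b̃ 1 + c̃ P`, which is normalised to `1` on the
highest weight state. -/
def bT (θ : ℂ) : ℂ := θ / (θ - Real.pi * I / 2)

def cT (θ : ℂ) : ℂ := -(Real.pi * I / 2) / (θ - Real.pi * I / 2)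

/-- The minimal form factor function of `SU(4)` for the highest weight amplitude. -/
def FSU4 (θ : ℂ) : ℂ :=
  let x := xvar θ
  barnesG x * barnesG (1 - x) / (barnesG (3 / 4 + x) * barnesG (7 / 4 - x))

/-- The minimal form factor function `F^{O(6)} = c cosh((iπ-θ)/2) F_+^min` of `O(6)`. -/
def FO6 (θ : ℂ) : ℂ :=
  let x := xvar θ
  barnesG x * barnesG (1 - x) / (barnesG (1 / 2 + x) * barnesG (3 / 2 - x)) *
    (barnesG (1 / 4 + x) * barnesG (5 / 4 - x) / (barnesG (3 / 4 + x) * barnesG (7 / 4 - x)))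

/-- The minimal `O(6)` form factor in the antisymmetric channel.  It is given by
`F_+^min = Γ(5/4-x) Γ(1/4+x) / (Γ(3/4)² cosh((iπ-θ)/2)) F_-^min` and
`F^{O(6)} = c cosh((iπ-θ)/2) F_+^min`; the value `c = F^{O(6)}(iπ)` is the normalisation
`F_±^min(iπ) = 1`. -/
def FminusMin (θ : ℂ) : ℂ :=
  FO6 θ * Gamma (3 / 4) ^ 2 /
    (FO6 (Real.pi * I) * Gamma (5 / 4 - xvar θ) * Gamma (1 / 4 + xvar θ))

/-- The full `O(6)` two-particle form factor function in the antisymmetric channel. -/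
def Fminus (θ : ℂ) : ℂ :=
  1 / (sinh ((θ - Real.pi * I / 2) / 2) * sinh ((θ + Real.pi * I / 2) / 2)) * FminusMin θ

/-! ### The nested off-shell Bethe ansatz -/

/-- `S̃_{AB}^{DC}(θ) = b̃(θ) δ_A^C δ_B^D + c̃(θ) δ_A^D δ_B^C`. -/
def STilde {q : ℕ} (θ : ℂ) (A B D C : Fin q) : ℂ :=
  (if A = C ∧ B = D then bT θ else 0) + (if A = D ∧ B = C then cT θ else 0)

/-- Matrix elements of the monodromy matrix: a horizontal line of rapidity `z` comes in from the
right with colour `r`, crosses the vertical lines `θ_n, …, θ_1` and leaves on the left with colour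
`l`; the colours of the vertical lines are `A` below and `C` above. -/
def monodromy {q : ℕ} : {n : ℕ} → (Fin n → ℂ) → ℂ → (Fin n → Fin q) → (Fin n → Fin q) →
    Fin q → Fin q → ℂ
  | 0, _, _, _, _, l, r => if l = r then 1 else 0
  | _ + 1, θ, z, A, C, l, r =>
      ∑ k : Fin q, STilde (θ 0 - z) (A 0) k l (C 0) *
        monodromy (Fin.tail θ) z (Fin.tail A) (Fin.tail C) k r

/-- The basic Bethe ansatz co-vector `Φ̃_A^B(θ, z)`, i.e. the component `A` of
`Ω C̃^{B_m}(θ, z_m) ⋯ C̃^{B_1}(θ, z_1)`.  The reference colour is `0`, and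
`C̃^B` is the element of the monodromy matrix with `0` on the right and `B` on the left. -/
def bethe {q n : ℕ} [NeZero q] (θ : Fin n → ℂ) :
    {m : ℕ} → (Fin m → ℂ) → (Fin m → Fin q) → (Fin n → Fin q) → ℂ
  | 0, _, _, A => if A = 0 then 1 else 0
  | _ + 1, z, B, A =>
      ∑ A' : Fin n → Fin q, monodromy θ (z 0) A A' (B 0) 0 *
        bethe θ (Fin.tail z) (Fin.tail B) A'

/-- `h(θ, z) = ∏_{i,j} φ̃(θ_i - z_j) ∏_{i<j} τ(z_i - z_j)`. -/
def hfun {n m : ℕ} (θ : Fin n → ℂ) (z : Fin m → ℂ) : ℂ :=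
  (∏ i, ∏ j, phiT (θ i - z j)) * ∏ i, ∏ j ∈ Finset.univ.filter (fun j => i < j), tau (z i - z j)

/-- The p-function of the pseudo-potential; `z` and `z'` are the integration variables of the first
and of the third level of the nesting. -/
def pJ {n n₁ n₃ : ℕ} (θ : Fin n → ℂ) (z : Fin n₁ → ℂ) (z' : Fin n₃ → ℂ) : ℂ :=
  exp (((∑ i, θ i) - (∑ i, z i) - ∑ i, z' i) / 2) / ∑ i, exp (θ i)

/-- Last level (`SU(2)`, no weight flip): the reference co-vector. -/
def K2 (C : Fin 1 → Fin 2) : ℂ := if C = 0 then 1 else 0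

/-- The integrand of the second level (`SU(3)`, one weight flip). The colours `2, 3, 4` are
represented by `0, 1, 2 : Fin 3`; the colours of the next level are their successors. -/
def K1Integrand (B : Fin 2 → Fin 3) (z : Fin 2 → ℂ) (y : ℂ) : ℂ :=
  hfun z ![y] * ∑ C : Fin 1 → Fin 2, K2 C * bethe z ![y] (fun i => (C i).succ) B

def K1 (ℓ₂ : ℝ) (B : Fin 2 → Fin 3) (z : Fin 2 → ℂ) : ℂ :=
  contourIntegral ℓ₂ z (K1Integrand B z)

/-- The Bethe state `Ψ̃_A(θ, z)` of the first level. The colours `1, 2, 3, 4` are represented by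
`0, 1, 2, 3 : Fin 4`. -/
def betheState (ℓ₂ : ℝ) (A : Fin 4 → Fin 4) (θ : Fin 4 → ℂ) (z : Fin 2 → ℂ) : ℂ :=
  ∑ B : Fin 2 → Fin 3, K1 ℓ₂ B z * bethe θ z (fun i => (B i).succ) A

/-- The integrand of the first level (`SU(4)`, two weight flips). -/
def KIntegrand (ℓ₂ : ℝ) (A : Fin 4 → Fin 4) (θ : Fin 4 → ℂ) (z : Fin 2 → ℂ) : ℂ :=
  hfun θ z * pJ θ z (Fin.elim0 : Fin 0 → ℂ) * betheState ℓ₂ A θ z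

/-- The K-function of the pseudo-potential for four particles. The integration line of the first
level is `Im z = ℓ₁`, that of the second level is `Im y = ℓ₂`. -/
def KSU4 (ℓ₁ ℓ₂ : ℝ) (A : Fin 4 → Fin 4) (θ : Fin 4 → ℂ) : ℂ :=
  contourIntegral ℓ₁ θ fun z₁ => contourIntegral ℓ₁ θ fun z₂ => KIntegrand ℓ₂ A θ ![z₁, z₂]

/-- The four-particle `SU(4)` form factor `K_A(θ) ∏_{i<j} F(θ_ij)` of the pseudo-potential. -/
def formFactorSU4 (ℓ₁ ℓ₂ : ℝ) (A : Fin 4 → Fin 4) (θ : Fin 4 → ℂ) : ℂ :=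
  KSU4 ℓ₁ ℓ₂ A θ *
    ∏ i, ∏ j ∈ Finset.univ.filter (fun j => i < j), FSU4 (θ i - θ j)

/-- The line `Im z = ℓ₁` passes between the points `θ_i - 2πi` and `θ_i - πi/2`, and the line
`Im y = ℓ₂` passes between the points `z - 2πi` and `z - πi/2` for all `z` on the contour of the
first level. -/
def AdmissibleLines (ℓ₁ ℓ₂ : ℝ) (θ : Fin 4 → ℂ) : Prop :=
  (∀ i, ℓ₁ + Real.pi / 2 < (θ i).im) ∧ ℓ₂ + Real.pi / 2 < ℓ₁ ∧
    ∀ i, (θ i).im < ℓ₂ + 2 * Real.pi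

/-- All three integrations that define the K-function exist. -/
def KConverges (ℓ₁ ℓ₂ : ℝ) (A : Fin 4 → Fin 4) (θ : Fin 4 → ℂ) : Prop :=
  (∀ (B : Fin 2 → Fin 3) (z : Fin 2 → ℂ), z 0 ≠ z 1 →
    z 0 - z 1 ≠ Real.pi * I / 2 → z 1 - z 0 ≠ Real.pi * I / 2 →
    (∀ i, ℓ₂ + Real.pi / 2 < (z i).im ∧ (z i).im < ℓ₂ + 2 * Real.pi) →
      ContourConverges ℓ₂ z (K1Integrand B z)) ∧
  (∀ x : ℝ, ContourConverges ℓ₁ θ fun z₂ => KIntegrand ℓ₂ A θ ![x + ℓ₁ * I, z₂]) ∧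
  (∀ i, ∀ᶠ z₁ in 𝓝[≠] (θ i), ContourConverges ℓ₁ θ fun z₂ => KIntegrand ℓ₂ A θ ![z₁, z₂]) ∧
  ContourConverges ℓ₁ θ fun z₁ => contourIntegral ℓ₁ θ fun z₂ => KIntegrand ℓ₂ A θ ![z₁, z₂]

/-! ### Bound states and `O(6)` -/

/-- The pairs `(RS)` that belong to the `O(6)` vector states. The states `1, 2, 3, 3̄, 2̄, 1̄` are
represented by `0, …, 5 : Fin 6`. -/
def boundPair : Fin 6 → Fin 4 × Fin 4 :=
  ![(0, 1), (0, 2), (0, 3), (1, 2), (1, 3), (2, 3)]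

/-- The fusion intertwiner `Γ_{AB}^α`. -/
def fusion (A B : Fin 4) (α : Fin 6) : ℂ :=
  I * Gamma (3 / 4) * (2 / Real.pi : ℂ) ^ (1 / 4 : ℂ) *
    ((if A = (boundPair α).1 ∧ B = (boundPair α).2 then 1 else 0) -
      (if A = (boundPair α).2 ∧ B = (boundPair α).1 then 1 else 0))

/-- The rapidities `θ_1, …, θ_4` with `θ_(12) = ω₁`, `θ_12 = s`, `θ_(34) = ω₂`, `θ_34 = t`. -/
def pairRapidities (ω₁ ω₂ s t : ℂ) : Fin 4 → ℂ :=
  ![ω₁ + s / 2, ω₁ - s / 2, ω₂ + t / 2, ω₂ - t / 2]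

/-- `ρ = Res_{θ_12 = iπ/2} Res_{θ_34 = iπ/2} f(θ)` at the bound state rapidities `ω₁`, `ω₂`. -/
def HasBoundStateResidue (f : (Fin 4 → ℂ) → ℂ) (ω₁ ω₂ ρ : ℂ) : Prop :=
  ∃ R : ℂ → ℂ,
    (∀ᶠ s in 𝓝[≠] (Real.pi * I / 2 : ℂ),
      HasResidueAt (fun t => f (pairRapidities ω₁ ω₂ s t)) (Real.pi * I / 2) (R s)) ∧
    HasResidueAt R (Real.pi * I / 2) ρ

/-- The bound state rapidities under consideration: they are distinct, and the contours that define
the K-function can be drawn with straight lines. This contains all distinct real rapidities. -/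
def rapidityDomain : Set (ℂ × ℂ) := {ω | ω.1 ≠ ω.2 ∧ |(ω.1 - ω.2).im| < Real.pi / 2}

/-- The bound state formula for `n = 4`: the two-particle function `F` is obtained from the
four-particle function `f` by `∑ F_{α₁α₂} Γ^{α₁}_{A₁A₂} Γ^{α₂}_{A₃A₄} = 2⁻¹ Res Res f_A`, for every
admissible choice of the integration lines. -/
def BoundStateFormula (f : ℝ → ℝ → (Fin 4 → Fin 4) → (Fin 4 → ℂ) → ℂ)
    (F : Fin 6 → Fin 6 → ℂ → ℂ → ℂ) : Prop :=
  ∀ ω₁ ω₂ : ℂ, (ω₁, ω₂) ∈ rapidityDomain → ∀ ℓ₁ ℓ₂ : ℝ,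
    AdmissibleLines ℓ₁ ℓ₂ (pairRapidities ω₁ ω₂ (Real.pi * I / 2) (Real.pi * I / 2)) →
    ∀ A : Fin 4 → Fin 4, ∃ ρ : ℂ, HasBoundStateResidue (f ℓ₁ ℓ₂ A) ω₁ ω₂ ρ ∧
      ∑ α₁, ∑ α₂, F α₁ α₂ ω₁ ω₂ * (fusion (A 0) (A 1) α₁ * fusion (A 2) (A 3) α₂) = 2⁻¹ * ρ

/-- The charge conjugation matrix `C_{αβ} = δ_{α β̄}` of `O(6)` in the complex basis. -/
def chargeConj : Matrix (Fin 6) (Fin 6) ℂ := Matrix.of fun α β => if α = β.rev then 1 else 0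

/-- `U` belongs to the (compact, real) group `O(6)`, written in the complex basis. -/
def IsO6 (U : Matrix (Fin 6) (Fin 6) ℂ) : Prop :=
  U ∈ Matrix.unitaryGroup (Fin 6) ℂ ∧ Uᵀ * chargeConj * U = chargeConj

/-- The two-particle functions `T^{αβ}_{α₁α₂}(θ₁, θ₂)` are those of operators that transform as an
antisymmetric `O(6)` tensor with the indices `α`, `β`. -/
def IsAntisymmetricTensor (T : Fin 6 → Fin 6 → Fin 6 → Fin 6 → ℂ → ℂ → ℂ) : Prop :=
  ∀ θ₁ θ₂ : ℂ, (θ₁, θ₂) ∈ rapidityDomain → ∀ α β α₁ α₂ : Fin 6,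
    T β α α₁ α₂ θ₁ θ₂ = -T α β α₁ α₂ θ₁ θ₂ ∧
    ∀ U : Matrix (Fin 6) (Fin 6) ℂ, IsO6 U →
      ∑ γ₁, ∑ γ₂, T α β γ₁ γ₂ θ₁ θ₂ * (U γ₁ α₁ * U γ₂ α₂) =
        ∑ γ, ∑ δ, U α γ * U β δ * T γ δ α₁ α₂ θ₁ θ₂

/-- `T` is the family of two-particle `O(6)` form factors of the pseudo-potential `J^{αβ}`: an
antisymmetric tensor whose highest weight component `J^{12}` is given by the bound state formula
applied to the `SU(4)` form factor with the p-function `N p^J`. -/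
def IsPseudoPotentialFormFactor (N : ℂ)
    (T : Fin 6 → Fin 6 → Fin 6 → Fin 6 → ℂ → ℂ → ℂ) : Prop :=
  IsAntisymmetricTensor T ∧
    BoundStateFormula (fun ℓ₁ ℓ₂ A θ => N * formFactorSU4 ℓ₁ ℓ₂ A θ) (T 0 1)

/-! ### Space-time: metric `(+,-)`, `ε^{01} = 1 = -ε_{01}` -/

def metric (μ : Fin 2) : ℝ := ![1, -1] μ

def epsLower : Matrix (Fin 2) (Fin 2) ℂ := !![0, -1; 1, 0]

/-- The momentum `p^μ = m (cosh θ, sinh θ)`. -/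
def momentum (m : ℝ) (θ : ℂ) (μ : Fin 2) : ℂ := ![m * cosh θ, m * sinh θ] μ

/-- The matrix element `⟨0|O(x)|θ₁, θ₂⟩ = e^{-ix(p₁+p₂)} F` of an operator with form factor `F`. -/
def matrixElement (m : ℝ) (θ₁ θ₂ F : ℂ) (x : Fin 2 → ℝ) : ℂ :=
  exp (-I * ∑ μ, metric μ * x μ * (momentum m θ₁ μ + momentum m θ₂ μ)) * F

/-- `ε_{μν} ∂^ν f`. -/
def epsGrad (μ : Fin 2) (f : (Fin 2 → ℝ) → ℂ) (x : Fin 2 → ℝ) : ℂ :=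
  ∑ ν, epsLower μ ν * (metric ν * lineDeriv ℝ f x (Pi.single ν 1))

/-- `γ^0` and `γ^1`. -/
def gammaUpper : Fin 2 → Matrix (Fin 2) (Fin 2) ℂ := ![!![0, 1; 1, 0], !![0, 1; -1, 0]]

/-- `γ_μ`. -/
def gammaLower (μ : Fin 2) : Matrix (Fin 2) (Fin 2) ℂ := (metric μ : ℂ) • gammaUpper μ

/-- The spinors: solutions of `(p̸ - m) u = 0` and `(p̸ + m) v = 0`, normalised to
`ū u = 2m² = -v̄ v`. -/
def spinorU (m : ℝ) (θ : ℂ) : Fin 2 → ℂ := (m : ℂ) • ![exp (-θ / 2), exp (θ / 2)]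

def spinorV (m : ℝ) (θ : ℂ) : Fin 2 → ℂ := (m * I : ℂ) • ![exp (-θ / 2), -exp (θ / 2)]

/-- The Dirac adjoint `v̄ = v† γ^0`, continued analytically from real `θ`. -/
def spinorVbar (m : ℝ) (θ : ℂ) : Fin 2 → ℂ :=
  star (spinorV m (starRingEnd ℂ θ)) ᵥ* gammaUpper 0

/-- `v̄(θ₁) γ_μ u(θ₂)`. -/
def spinorCurrent (m : ℝ) (μ : Fin 2) (θ₁ θ₂ : ℂ) : ℂ :=
  (spinorVbar m θ₁ ᵥ* gammaLower μ) ⬝ᵥ spinorU m θ₂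

/-- `δ_{α₁}^α δ_{α₂}^β - δ_{α₁}^β δ_{α₂}^α`. -/
def antisymDelta (α β α₁ α₂ : Fin 6) : ℂ :=
  (if α₁ = α ∧ α₂ = β then 1 else 0) - (if α₁ = β ∧ α₂ = α then 1 else 0)

end GrossNeveu

end

noncomputable section

namespace GrossNeveu

/-! The nested integral factorises into one-dimensional integrals, and the bound state residue can
be read off without evaluating any of these.

On the second level, moving the contour to straight lines makes the first lemma of Barnes
(`barnes_first_lemma`) applicable. Only two colour configurations survive, with opposite values
(`K1_one_zero`, `K1_zero_one`), so the first level needs the Bethe co-vector only in antisymmetrised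
form. By `doubleMonodromy_sub` that form is, up to a rational factor, an antisymmetrised product of
one-magnon wave functions. The reflection formula merges this factor, `K1Value`, τ and the
exponential of the p-function into a multiple of e^{-z₁} - e^{-z₂} (`tau_mul_K1Value`). The
integrand thus becomes a sum of products of functions of one variable, and the double integral a sum
of 2×2 determinants of contour integrals of `orbital` (`KSU4_eq`). Existence of the integrals
follows from the exponential decay of φ̃.

A pole at the bound state arises only where the singularity of b̃ or c̃ at z = θ 0 - iπ/2 (or θ 2 -
iπ/2) meets the encircled point θ 1 (or θ 3). Each contour integral is therefore a regular part plus
two explicit simple poles (`PairRegular.contourIntegral_orbital`). Each pole part has rank one in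
the site and the exponent, so its determinant with itself vanishes and the iterated residue is the
mixed determinant of the two pole coefficients. Its colour dependence is the antisymmetrised product
of two fusion intertwiners (`pairSign_eq`). Its rapidity dependence is a product of Gamma and Barnes
functions, which `barnesG_add_one` and the reflection formula convert into F₋ / cosh
(`crossed_product`, `Fminus_eq`). The remaining constant fixes N.

For uniqueness, residues are unique and the fusion intertwiners are linearly independent, so the
component J^{12} is determined. An antisymmetric tensor annihilated by the (0,1) rows of all O(6)
matrices vanishes (`antisymmetric_eq_zero`), which determines the other components. The current
follows because a derivative of the matrix element produces -i(p₁ + p₂), and by a spinor identity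
(`spinorCurrent_eq`). -/

/-! ### The Barnes G-function -/

/-- The factors of the Weierstrass product of the Barnes G-function. -/
def barnesFactor (k : ℕ) (w : ℂ) : ℂ :=
  (1 + w / (k + 1)) ^ (k + 1) * exp (w ^ 2 / (2 * (k + 1)) - w)

def barnesProd (w : ℂ) : ℂ := ∏' k : ℕ, barnesFactor k w

theorem barnesG_eq (z : ℂ) : barnesG z = (2 * Real.pi : ℂ) ^ ((z - 1) / 2) *
    exp (-((z - 1) + (z - 1) ^ 2 * (1 + Real.eulerMascheroniConstant)) / 2) *
      barnesProd (z - 1) := rfl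

/-- With z = w/(k+1), the factor is exp((k+1)(log(1+z) - z + z²/2)): the exponential in the product
removes the first two Taylor terms of the logarithm. The cubic remainder leaves a summable bound.
The threshold 2R³ ≤ k ensures both ‖z‖ ≤ 1/2 and that the exponent has norm at most 1. -/
theorem norm_barnesFactor_sub_one_le {R : ℝ} (hR : 1 ≤ R) {k : ℕ} (hk : 2 * R ^ 3 ≤ k) {w : ℂ}
    (hw : ‖w‖ ≤ R) : ‖barnesFactor k w - 1‖ ≤ 2 * R ^ 3 / ((k : ℝ) + 1) ^ 2 := by
  have hR3 : R ≤ R ^ 3 := le_self_pow₀ hR (by norm_num)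
  have hn : (0 : ℝ) < (k : ℝ) + 1 := by positivity
  have hnC : ((k : ℂ) + 1) ≠ 0 := by exact_mod_cast hn.ne'
  set z : ℂ := w / (k + 1) with hz
  have hnorm : ‖((k : ℂ) + 1)‖ = (k : ℝ) + 1 := by
    rw [show ((k : ℂ) + 1) = (((k : ℝ) + 1 : ℝ) : ℂ) by push_cast; rfl, Complex.norm_real,
      Real.norm_of_nonneg hn.le]
  have hzn : ‖z‖ ≤ R / (k + 1) := by
    rw [hz, norm_div, hnorm]; gcongr
  have hz2 : ‖z‖ ≤ 1 / 2 := by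
    refine hzn.trans ?_
    rw [div_le_iff₀ hn]; linarith
  set δ : ℂ := (k + 1) * (log (1 + z) - logTaylor 3 z) with hδ
  have h1z : 1 + z ≠ 0 := by
    intro h
    have : z = -1 := by linear_combination h
    rw [this] at hz2; norm_num at hz2
  have hlt : logTaylor 3 z = z - z ^ 2 / 2 := by
    simp [logTaylor, Finset.sum_range_succ]; ring
  have hexp : barnesFactor k w = exp δ := by
    have hwz : w = (k + 1) * z := by rw [hz]; field_simp
    rw [hδ, hlt, mul_sub, Complex.exp_sub, show ((k : ℂ) + 1) * log (1 + z)
      = ((k + 1 : ℕ) : ℂ) * log (1 + z) by push_cast; rfl, Complex.exp_nat_mul, exp_log h1z,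
      div_eq_mul_inv, ← Complex.exp_neg, barnesFactor, ← hz]
    congr 2
    rw [hwz]; field_simp; ring
  have hδn : ‖δ‖ ≤ R ^ 3 / ((k : ℝ) + 1) ^ 2 := by
    rw [hδ, norm_mul, hnorm]
    have h := norm_log_sub_logTaylor_le 2 (z := z) (by linarith)
    have h2 : (1 - ‖z‖)⁻¹ ≤ 2 := by
      rw [inv_le_comm₀ (by linarith) (by norm_num)]; linarith
    have h3 : ‖log (1 + z) - logTaylor 3 z‖ ≤ (R / (k + 1)) ^ 3 := by
      refine h.trans ?_
      norm_num
      have h0 : 0 ≤ (1 - ‖z‖)⁻¹ := by rw [inv_nonneg]; linarith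
      calc ‖z‖ ^ 3 * (1 - ‖z‖)⁻¹ / 3 ≤ (R / (k + 1)) ^ 3 * 2 / 3 := by gcongr
        _ ≤ (R / (k + 1)) ^ 3 := by
          have : 0 ≤ (R / ((k : ℝ) + 1)) ^ 3 := by positivity
          linarith
    calc ((k : ℝ) + 1) * ‖log (1 + z) - logTaylor 3 z‖ ≤ (k + 1) * (R / (k + 1)) ^ 3 := by gcongr
      _ = R ^ 3 / ((k : ℝ) + 1) ^ 2 := by field_simp
  have hδ1 : ‖δ‖ ≤ 1 := by
    refine hδn.trans ?_
    rw [div_le_one (by positivity)]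
    nlinarith
  rw [hexp]
  refine (Complex.norm_exp_sub_one_le hδ1).trans ?_
  rw [mul_div_assoc]; gcongr

theorem summable_barnesBound (R : ℝ) : Summable fun k : ℕ => 2 * R ^ 3 / ((k : ℝ) + 1) ^ 2 := by
  have := (summable_nat_add_iff 1).2 (Real.summable_one_div_nat_pow.2 (one_lt_two))
  refine (this.mul_left (2 * R ^ 3)).congr fun k => ?_
  push_cast; ring

theorem differentiable_barnesFactor (k : ℕ) : Differentiable ℂ (barnesFactor k) := by
  unfold barnesFactor; fun_prop

theorem eventually_norm_barnesFactor_sub_one_le {R : ℝ} (hR : 1 ≤ R) :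
    ∀ᶠ k : ℕ in atTop, ∀ w ∈ Metric.ball (0 : ℂ) R,
      ‖barnesFactor k w - 1‖ ≤ 2 * R ^ 3 / ((k : ℝ) + 1) ^ 2 := by
  filter_upwards [tendsto_natCast_atTop_atTop.eventually_ge_atTop (2 * R ^ 3)] with k hk w hw
  exact norm_barnesFactor_sub_one_le hR hk (mem_ball_zero_iff.1 hw).le

theorem summable_barnesFactor_sub_one (w : ℂ) : Summable fun k => ‖barnesFactor k w - 1‖ := by
  have hR : 1 ≤ ‖w‖ + 1 := by linarith [norm_nonneg w]
  refine Summable.of_norm_bounded_eventually_nat (summable_barnesBound (‖w‖ + 1)) ?_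
  filter_upwards [eventually_norm_barnesFactor_sub_one_le hR] with k hk
  simpa using hk w (by simp)

/-- The bound on the factors is uniform on a ball of radius ‖w‖ + 1, so the partial products
converge locally uniformly there and the limit is holomorphic. -/
theorem differentiable_barnesProd : Differentiable ℂ barnesProd := by
  intro w
  have hR : 1 ≤ ‖w‖ + 1 := by linarith [norm_nonneg w]
  have h := Summable.hasProdLocallyUniformlyOn_nat_one_add (f := fun k w => barnesFactor k w - 1)
    Metric.isOpen_ball (summable_barnesBound (‖w‖ + 1))
    (eventually_norm_barnesFactor_sub_one_le hR)
    (fun k => ((differentiable_barnesFactor k).continuous.sub continuous_const).continuousOn)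
  simp only [add_sub_cancel] at h
  rw [hasProdLocallyUniformlyOn_iff_tendstoLocallyUniformlyOn] at h
  refine (h.differentiableOn (Eventually.of_forall fun s => ?_) Metric.isOpen_ball).differentiableAt
    (Metric.isOpen_ball.mem_nhds (by simp))
  exact (Differentiable.fun_finsetProd fun k _ => differentiable_barnesFactor k).differentiableOn

theorem barnesProd_tendsto (w : ℂ) :
    Tendsto (fun N => ∏ k ∈ Finset.range N, barnesFactor k w) atTop (𝓝 (barnesProd w)) := by
  have h := multipliable_one_add_of_summable (summable_barnesFactor_sub_one w)
  simp only [add_sub_cancel] at h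
  exact h.hasProd.tendsto_prod_nat

theorem barnesProd_ne_zero {w : ℂ} (hw : ∀ k : ℕ, w ≠ -(k + 1)) : barnesProd w ≠ 0 := by
  have h := tprod_one_add_ne_zero_of_summable (f := fun k => barnesFactor k w - 1) ?_
    (summable_barnesFactor_sub_one w)
  · simp only [add_sub_cancel] at h
    exact h
  · intro k
    rw [add_sub_cancel, barnesFactor]
    refine mul_ne_zero (pow_ne_zero _ fun h => hw k ?_) (Complex.exp_ne_zero _)
    have hnC : ((k : ℂ) + 1) ≠ 0 := by exact_mod_cast k.succ_ne_zero
    field_simp at h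
    linear_combination h

theorem differentiable_barnesG : Differentiable ℂ barnesG := by
  have h2 : (2 * Real.pi : ℂ) ≠ 0 := by exact_mod_cast Real.two_pi_pos.ne'
  have h : barnesG = fun z => (2 * Real.pi : ℂ) ^ ((z - 1) / 2) *
    exp (-((z - 1) + (z - 1) ^ 2 * (1 + Real.eulerMascheroniConstant)) / 2) *
      barnesProd (z - 1) := rfl
  rw [h]
  have hp : Differentiable ℂ fun z : ℂ => barnesProd (z - 1) :=
    differentiable_barnesProd.comp (differentiable_id.sub_const 1)
  have hq : Differentiable ℂ fun z : ℂ => (2 * Real.pi : ℂ) ^ ((z - 1) / 2) := by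
    intro z
    exact DifferentiableAt.const_cpow (by fun_prop) (Or.inl h2)
  exact (hq.mul (by fun_prop)).mul hp

theorem barnesG_ne_zero {z : ℂ} (hz : ∀ k : ℕ, z ≠ -k) : barnesG z ≠ 0 := by
  have h2 : (2 * Real.pi : ℂ) ≠ 0 := by exact_mod_cast Real.two_pi_pos.ne'
  rw [barnesG_eq]
  refine mul_ne_zero (mul_ne_zero ?_ (Complex.exp_ne_zero _)) (barnesProd_ne_zero fun k hk =>
    hz k (by linear_combination hk))
  rw [Ne, Complex.cpow_eq_zero_iff]
  exact fun h => h2 h.1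

/-- The quotient of the factors at w and w - 1 is ((k+1+w)/(k+w))^(k+1) times exp((w-1/2)/(k+1) -
1). The powers telescope, and the exponents sum to a harmonic number. -/
theorem barnesFactor_prod_shift (w : ℂ) (N : ℕ) :
    (∏ k ∈ Finset.range N, barnesFactor k w) * ∏ j ∈ Finset.range N, (w + j) =
      (∏ k ∈ Finset.range N, barnesFactor k (w - 1)) * ((N + w) ^ N *
        exp ((w - 1 / 2) * (harmonic N : ℂ) - N)) := by
  induction N with
  | zero => simp
  | succ N ih =>
    have hn : ((N : ℂ) + 1) ≠ 0 := by exact_mod_cast N.succ_ne_zero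
    rw [Finset.prod_range_succ, Finset.prod_range_succ, Finset.prod_range_succ,
      mul_mul_mul_comm, ih, barnesFactor, barnesFactor, harmonic_succ]
    have e1 : (1 + w / ((N : ℂ) + 1)) = (N + 1 + w) / (N + 1) := by field_simp
    have e2 : (1 + (w - 1) / ((N : ℂ) + 1)) = (N + w) / (N + 1) := by field_simp; ring
    rw [e1, e2, div_pow, div_pow]
    push_cast
    have e3 : exp ((w - 1 / 2) * ((harmonic N : ℂ) + ((N : ℂ) + 1)⁻¹) - (N + 1)) *
        exp ((w - 1) ^ 2 / (2 * (N + 1)) - (w - 1)) =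
        exp ((w - 1 / 2) * (harmonic N : ℂ) - N) * exp (w ^ 2 / (2 * (N + 1)) - w) := by
      rw [← Complex.exp_add, ← Complex.exp_add]
      congr 1
      field_simp; ring
    have e4 := congrArg (fun t => t * ((∏ k ∈ Finset.range N, barnesFactor k (w - 1)) *
      (N + w) ^ (N + 1) * (N + 1 + w) ^ (N + 1) / ((N : ℂ) + 1) ^ (N + 1))) e3
    have e5 : ((N : ℂ) + w) ^ (N + 1) = (N + w) ^ N * (w + N) := by ring
    calc _ = exp ((w - 1 / 2) * (harmonic N : ℂ) - N) * exp (w ^ 2 / (2 * (N + 1)) - w) *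
          ((∏ k ∈ Finset.range N, barnesFactor k (w - 1)) *
      (N + w) ^ (N + 1) * (N + 1 + w) ^ (N + 1) / ((N : ℂ) + 1) ^ (N + 1)) := by rw [e5]; ring
      _ = _ := by rw [← e4]; ring

/-- Three limits meet here: (1 + w/N)^N → e^w, Stirling's formula for N!, and H_N - log N → γ. All
powers of N cancel between them. The exponent is N + 1 because the last factor of Euler's product
for Γ contributes one more N + w. -/
theorem barnes_shift_factor_tendsto (w : ℂ) :
    Tendsto (fun N : ℕ => ((N : ℂ) + w) ^ (N + 1) * exp ((w - 1 / 2) * (harmonic N : ℂ) - N) /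
        ((N : ℂ) ^ w * (N.factorial : ℂ))) atTop
      (𝓝 (exp w * (1 / ((√2 * √Real.pi : ℝ) : ℂ)) *
        exp ((w - 1 / 2) * Real.eulerMascheroniConstant))) := by
  have h1 : Tendsto (fun N : ℕ => (1 + w / N) ^ N * (1 + w / N)) atTop (𝓝 (exp w * (1 + 0))) := by
    refine (Complex.tendsto_one_add_div_pow_exp w).mul (tendsto_const_nhds.add ?_)
    have := (tendsto_inv_atTop_nhds_zero_nat (𝕜 := ℂ)).const_mul w
    simpa [div_eq_mul_inv] using this
  have h2 : Tendsto (fun N : ℕ => 1 / ((√2 * Stirling.stirlingSeq N : ℝ) : ℂ)) atTop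
      (𝓝 (1 / ((√2 * √Real.pi : ℝ) : ℂ))) := by
    refine Tendsto.div tendsto_const_nhds ?_ ?_
    · exact (Complex.continuous_ofReal.tendsto _).comp
        (Stirling.tendsto_stirlingSeq_sqrt_pi.const_mul _)
    · have : 0 < √2 * √Real.pi := by positivity
      exact_mod_cast this.ne'
  have h3 : Tendsto (fun N : ℕ => exp ((w - 1 / 2) * ((harmonic N - Real.log N : ℝ) : ℂ))) atTop
      (𝓝 (exp ((w - 1 / 2) * Real.eulerMascheroniConstant))) := by
    refine (Complex.continuous_exp.tendsto _).comp (Tendsto.const_mul _ ?_)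
    exact (Complex.continuous_ofReal.tendsto _).comp Real.tendsto_harmonic_sub_log
  have := (h1.mul h2).mul h3
  rw [add_zero, mul_one] at this
  refine this.congr' ?_
  filter_upwards [eventually_gt_atTop 0] with N hN
  have hNR : (0 : ℝ) < N := by exact_mod_cast hN
  have hNC : (N : ℂ) ≠ 0 := by exact_mod_cast hN.ne'
  have hf : (N.factorial : ℝ) ≠ 0 := by positivity
  have hfC : (N.factorial : ℂ) ≠ 0 := by exact_mod_cast N.factorial_ne_zero
  -- Writing √N as exp(log N / 2) allows all powers of N to be collected in a single exponential.
  have hst : 1 / (√2 * Stirling.stirlingSeq N) =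
      Real.exp (Real.log N / 2) * N ^ N * Real.exp (-N) / N.factorial := by
    have hs : Real.exp (Real.log N / 2) = √N := by
      rw [Real.sqrt_eq_rpow, Real.rpow_def_of_pos hNR]; congr 1; ring
    rw [hs, Stirling.stirlingSeq, Real.sqrt_mul (by norm_num), div_pow, ← Real.exp_nat_mul, mul_one,
      Real.exp_neg]
    have : 0 < √(N : ℝ) := by positivity
    field_simp
  have e1 : (1 + w / (N : ℂ)) = (N + w) / N := by field_simp
  rw [show (1 : ℂ) / ((√2 * Stirling.stirlingSeq N : ℝ) : ℂ) =
    ((1 / (√2 * Stirling.stirlingSeq N) : ℝ) : ℂ) by push_cast; rfl, hst, e1,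
    Complex.cpow_def_of_ne_zero hNC, div_pow]
  push_cast
  have e2 : exp ((w - 1 / 2) * ((harmonic N : ℂ) - log (N : ℂ))) * exp (log (N : ℂ) / 2) *
      exp (-(N : ℂ)) * exp (log (N : ℂ) * w) =
      exp ((w - 1 / 2) * (harmonic N : ℂ) - N) * N := by
    refine Eq.trans ?_ (congrArg (fun t => exp ((w - 1 / 2) * (harmonic N : ℂ) - N) * t)
      (Complex.exp_log hNC))
    simp only [← Complex.exp_add]; congr 1; ring
  have e3 := Complex.exp_ne_zero (log (N : ℂ) * w)
  generalize exp ((w - 1 / 2) * ((harmonic N : ℂ) - log (N : ℂ))) = a at *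
  generalize exp (log (N : ℂ) / 2) = b at *
  generalize exp (-(N : ℂ)) = c at *
  generalize exp (log (N : ℂ) * w) = d at *
  generalize exp ((w - 1 / 2) * (harmonic N : ℂ) - N) = e at *
  field_simp
  rw [pow_succ]
  linear_combination ((N : ℂ) + w) ^ N * (N + w) * e2

theorem barnesProd_shift {w : ℂ} (hw : ∀ k : ℕ, w ≠ -k) :
    barnesProd w = barnesProd (w - 1) * (Gamma w * (exp w * (1 / ((√2 * √Real.pi : ℝ) : ℂ)) *
        exp ((w - 1 / 2) * Real.eulerMascheroniConstant))) := by
  refine tendsto_nhds_unique (barnesProd_tendsto w) ?_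
  refine ((barnesProd_tendsto (w - 1)).mul
    ((Complex.GammaSeq_tendsto_Gamma w).mul (barnes_shift_factor_tendsto w))).congr' ?_
  filter_upwards [eventually_gt_atTop 0] with N hN
  have hNC : (N : ℂ) ≠ 0 := by exact_mod_cast hN.ne'
  have hfC : (N.factorial : ℂ) ≠ 0 := by exact_mod_cast N.factorial_ne_zero
  have hne : ∀ j : ℕ, w + j ≠ 0 := fun j h => hw j (by linear_combination h)
  have hP : ∏ j ∈ Finset.range N, (w + j) ≠ 0 := Finset.prod_ne_zero_iff.2 fun j _ => hne j
  have hpow : (N : ℂ) ^ w ≠ 0 := by rw [Ne, Complex.cpow_eq_zero_iff]; exact fun h => hNC h.1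
  have h := barnesFactor_prod_shift w N
  rw [← eq_div_iff hP] at h
  rw [h, Complex.GammaSeq, Finset.prod_range_succ]
  have hN' : (N : ℂ) + w ≠ 0 := by rw [add_comm]; exact hne N
  have hN'' := hne N
  field_simp
  ring

/-- The functional equation of the Barnes G-function. -/
theorem barnesG_add_one {z : ℂ} (hz : ∀ k : ℕ, z ≠ -k) : barnesG (z + 1) = Gamma z * barnesG z := by
  have h2 : (2 * Real.pi : ℂ) ≠ 0 := by exact_mod_cast Real.two_pi_pos.ne'
  rw [barnesG_eq, barnesG_eq, add_sub_cancel_right, barnesProd_shift hz]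
  have hs : (2 * Real.pi : ℂ) ^ (z / 2) =
      (2 * Real.pi : ℂ) ^ ((z - 1) / 2) * ((√2 * √Real.pi : ℝ) : ℂ) := by
    rw [show z / 2 = (z - 1) / 2 + 1 / 2 by ring, Complex.cpow_add _ _ h2]
    congr 1
    rw [← Real.sqrt_mul (by norm_num), Real.sqrt_eq_rpow, Complex.ofReal_cpow Real.two_pi_pos.le]
    push_cast; rfl
  have hs0 : ((√2 * √Real.pi : ℝ) : ℂ) ≠ 0 := by
    have : 0 < √2 * √Real.pi := by positivity
    exact_mod_cast this.ne'
  rw [hs]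
  have he : exp (-(z + z ^ 2 * (1 + Real.eulerMascheroniConstant)) / 2) * exp z *
      exp ((z - 1 / 2) * Real.eulerMascheroniConstant) =
      exp (-((z - 1) + (z - 1) ^ 2 * (1 + Real.eulerMascheroniConstant)) / 2) := by
    simp only [← Complex.exp_add]; congr 1; ring
  rw [← he]
  field_simp

/-! ### Bounds for the Gamma function -/

theorem norm_Gamma_le {w : ℂ} (hw : 0 < w.re) : ‖Gamma w‖ ≤ Real.Gamma w.re := by
  rw [Complex.Gamma_eq_integral hw, Real.Gamma_eq_integral hw, Complex.GammaIntegral]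
  refine (norm_integral_le_integral_norm _).trans_eq ?_
  refine setIntegral_congr_fun measurableSet_Ioi fun x (hx : 0 < x) => ?_
  simp only [norm_mul, Complex.norm_real, Real.norm_eq_abs, Real.abs_exp]
  rw [Complex.norm_cpow_eq_rpow_re_of_pos hx]
  simp

theorem exists_Gamma_bound {α β : ℝ} (hα : 0 < α) :
    ∃ C, 0 ≤ C ∧ ∀ w : ℂ, α ≤ w.re → w.re ≤ β → ‖Gamma w‖ ≤ C := by
  have hc : ContinuousOn Real.Gamma (Set.Icc α β) := fun x hx =>
    (Real.differentiableAt_Gamma fun m => by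
      have : (0 : ℝ) ≤ m := m.cast_nonneg
      have := hx.1
      intro h; linarith).continuousAt.continuousWithinAt
  obtain ⟨C, hC⟩ := isCompact_Icc.exists_bound_of_continuousOn hc
  refine ⟨|C|, abs_nonneg _, fun w h1 h2 => (norm_Gamma_le (hα.trans_le h1)).trans ?_⟩
  exact (le_abs_self _).trans ((hC _ ⟨h1, h2⟩).trans (le_abs_self _))

/-- Two steps of the functional equation give Γ(w) = Γ(w+2)/(w(w+1)), and Γ is bounded on the
shifted strip. Quadratic decay is all that integrability requires, so no form of Stirling's formula
is needed. -/
theorem exists_Gamma_decay {α β : ℝ} (hα : 0 < α) :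
    ∃ C, 0 ≤ C ∧ ∀ w : ℂ, α ≤ w.re → w.re ≤ β → ‖Gamma w‖ ≤ C / (1 + w.im ^ 2) := by
  obtain ⟨C, hC0, hC⟩ := exists_Gamma_bound (α := α + 2) (β := β + 2) (by linarith)
  refine ⟨C / min (α ^ 2) 1, by positivity, fun w h1 h2 => ?_⟩
  have hw0 : w ≠ 0 := by rintro rfl; simp at h1; linarith
  have hw1 : w + 1 ≠ 0 := by
    intro h
    have : (w + 1).re = 0 := by rw [h]; rfl
    simp at this; linarith
  have hm : 0 < min (α ^ 2) 1 := lt_min (by positivity) one_pos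
  have e : Gamma w = Gamma (w + 2) / (w * (w + 1)) := by
    rw [show w + 2 = (w + 1) + 1 by ring, Complex.Gamma_add_one _ hw1, Complex.Gamma_add_one _ hw0]
    field_simp
  have hn : ‖w‖ ≤ ‖w + 1‖ := by
    rw [Complex.norm_def, Complex.norm_def]
    apply Real.sqrt_le_sqrt
    simp only [Complex.normSq_apply, add_re, one_re, add_im, one_im]
    nlinarith
  have hl : min (α ^ 2) 1 * (1 + w.im ^ 2) ≤ ‖w‖ * ‖w + 1‖ := by
    calc min (α ^ 2) 1 * (1 + w.im ^ 2) ≤ α ^ 2 + w.im ^ 2 := by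
          nlinarith [min_le_left (α ^ 2) 1, min_le_right (α ^ 2) 1, sq_nonneg w.im]
      _ ≤ ‖w‖ ^ 2 := by
          rw [Complex.sq_norm, Complex.normSq_apply]; nlinarith
      _ ≤ ‖w‖ * ‖w + 1‖ := by rw [pow_two]; gcongr
  rw [e, norm_div, norm_mul, div_div]
  have := hC (w + 2) (by simpa using h1) (by simpa using h2)
  gcongr

/-! ### The first lemma of Barnes -/

/-- The integrand of the beta integral on the real line. -/
def logistic (a c : ℂ) (y : ℝ) : ℂ := (Real.sigmoid y : ℂ) ^ a * (Real.sigmoid (-y) : ℂ) ^ c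

theorem sigmoid_ne_zero (y : ℝ) : (Real.sigmoid y : ℂ) ≠ 0 := by
  exact_mod_cast (Real.sigmoid_pos y).ne'

/-- The sigmoid maps ℝ onto (0,1), and its derivative σ(1-σ) raises both exponents of the beta
integrand by one. -/
theorem logistic_eq_jacobian_mul (a c : ℂ) (y : ℝ) :
    |Real.sigmoid y * (1 - Real.sigmoid y)| • ((Real.sigmoid y : ℂ) ^ (a - 1) *
      (1 - (Real.sigmoid y : ℂ)) ^ (c - 1)) = logistic a c y := by
  have h1 := sigmoid_ne_zero y
  have h2 := sigmoid_ne_zero (-y)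
  rw [logistic, abs_of_pos (mul_pos (Real.sigmoid_pos y) (by linarith [Real.sigmoid_lt_one y])),
    Complex.real_smul]
  have e : (1 - (Real.sigmoid y : ℂ)) = (Real.sigmoid (-y) : ℂ) := by
    rw [Real.sigmoid_neg]; push_cast; rfl
  push_cast
  rw [e, Complex.cpow_sub _ _ h1, Complex.cpow_sub _ _ h2]
  simp only [Complex.cpow_one]
  field_simp

theorem continuous_logistic (a c : ℂ) : Continuous (logistic a c) := by
  have h : ∀ y, (Real.sigmoid y : ℂ) ∈ slitPlane := fun y =>
    Complex.ofReal_mem_slitPlane.2 (Real.sigmoid_pos y)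
  have hc : Continuous fun y : ℝ => (Real.sigmoid y : ℂ) :=
    Complex.continuous_ofReal.comp continuous_sigmoid
  have hc' : Continuous fun y : ℝ => (Real.sigmoid (-y) : ℂ) := hc.comp continuous_neg
  exact (hc.cpow continuous_const fun y => h y).mul (hc'.cpow continuous_const fun y => h _)

theorem integrable_logistic {a c : ℂ} (ha : 0 < a.re) (hc : 0 < c.re) :
    Integrable (logistic a c) := by
  have h := betaIntegral_convergent ha hc
  rw [intervalIntegrable_iff_integrableOn_Ioo_of_le zero_le_one, ← Real.range_sigmoid,
    ← Set.image_univ, integrableOn_image_iff_integrableOn_abs_deriv_smul MeasurableSet.univ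
      (fun x _ => (Real.hasDerivAt_sigmoid x).hasDerivWithinAt) Real.sigmoid_injective.injOn,
    integrableOn_univ] at h
  exact h.congr (Eventually.of_forall fun y => logistic_eq_jacobian_mul a c y)

theorem integral_logistic {a c : ℂ} (ha : 0 < a.re) (hc : 0 < c.re) :
    ∫ y, logistic a c y = Gamma a * Gamma c / Gamma (a + c) := by
  rw [← betaIntegral_eq_Gamma_mul_div a c ha hc, betaIntegral,
    intervalIntegral.integral_of_le zero_le_one, integral_Ioc_eq_integral_Ioo,
    ← Real.range_sigmoid, ← Set.image_univ,
    integral_image_eq_integral_abs_deriv_smul MeasurableSet.univ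
      (fun x _ => (Real.hasDerivAt_sigmoid x).hasDerivWithinAt) Real.sigmoid_injective.injOn,
    setIntegral_univ]
  exact integral_congr_ae (Eventually.of_forall fun y => (logistic_eq_jacobian_mul a c y).symm)

open scoped FourierTransform in
-- Since σ(-y) = σ(y) e^{-y}, the Fourier character e^{-2πity} only shifts the exponents to a - 2πit
-- and c + 2πit, and the integral is again a beta function.
theorem fourier_logistic {a c : ℂ} (ha : 0 < a.re) (hc : 0 < c.re) (t : ℝ) :
    𝓕 (logistic a c) t = Gamma (a - 2 * Real.pi * t * I) * Gamma (c + 2 * Real.pi * t * I) /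
      Gamma (a + c) := by
  have e : a + c = (a - 2 * Real.pi * t * I) + (c + 2 * Real.pi * t * I) := by ring
  rw [e, ← integral_logistic (by simpa using ha) (by simpa using hc), Real.fourier_eq']
  refine integral_congr_ae (Eventually.of_forall fun y => ?_)
  have h1 := sigmoid_ne_zero y
  have h2 := sigmoid_ne_zero (-y)
  simp only [logistic, smul_eq_mul]
  rw [Complex.cpow_sub _ _ h1, Complex.cpow_add _ _ h2]
  have hr : (Real.sigmoid (-y) : ℂ) = (Real.sigmoid y : ℂ) * exp (-(y : ℂ)) := by
    rw [← Real.sigmoid_mul_rexp_neg]; push_cast; rfl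
  have hl : log (Real.sigmoid (-y) : ℂ) = log (Real.sigmoid y : ℂ) - y := by
    rw [← Complex.ofReal_log (Real.sigmoid_pos _).le, ← Complex.ofReal_log (Real.sigmoid_pos _).le,
      ← Real.sigmoid_mul_rexp_neg, Real.log_mul (Real.sigmoid_pos _).ne' (Real.exp_ne_zero _),
      Real.log_exp]
    push_cast; ring
  have key : exp (((-2 * Real.pi * inner ℝ y t : ℝ) : ℂ) * I) *
      (Real.sigmoid y : ℂ) ^ (2 * Real.pi * t * I : ℂ) =
      (Real.sigmoid (-y) : ℂ) ^ (2 * Real.pi * t * I : ℂ) := by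
    rw [Complex.cpow_def_of_ne_zero h1, Complex.cpow_def_of_ne_zero h2, hl, ← Complex.exp_add]
    congr 1
    simp; ring
  rw [← key]
  have h3 : (Real.sigmoid y : ℂ) ^ (2 * Real.pi * t * I : ℂ) ≠ 0 := by
    rw [Ne, Complex.cpow_eq_zero_iff]; exact fun h => h1 h.1
  generalize (Real.sigmoid y : ℂ) ^ (2 * Real.pi * t * I : ℂ) = p at *
  field_simp

open scoped FourierTransform in
-- The decay of one Gamma factor suffices; the other is bounded by its value at the real part of its
-- argument.
theorem integrable_fourier_logistic {a c : ℂ} (ha : 0 < a.re) (hc : 0 < c.re) :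
    Integrable (𝓕 (logistic a c)) := by
  obtain ⟨C, hC0, hC⟩ := exists_Gamma_decay (α := a.re) (β := a.re) ha
  have hb : Integrable fun t : ℝ => C * (1 + (a.im - 2 * Real.pi * t) ^ 2)⁻¹ *
      Real.Gamma c.re * ‖Gamma (a + c)‖⁻¹ := by
    have h := ((integrable_inv_one_add_sq.comp_add_left a.im).comp_mul_left'
      (R := -(2 * Real.pi)) (by simp [Real.pi_ne_zero]))
    refine (((h.const_mul C).mul_const (Real.Gamma c.re)).mul_const (‖Gamma (a + c)‖⁻¹)).congr (Eventually.of_forall fun t => ?_)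
    simp only [neg_mul, sub_eq_add_neg]
  refine hb.mono' ?_ (Eventually.of_forall fun t => ?_)
  · exact (VectorFourier.fourierIntegral_continuous Real.continuous_fourierChar
      (L := innerₗ ℝ) continuous_inner (integrable_logistic ha hc)).aestronglyMeasurable
  · rw [fourier_logistic ha hc, norm_div, norm_mul, div_eq_mul_inv]
    have h1 := hC (a - 2 * Real.pi * t * I) (by simp) (by simp)
    have h2 := norm_Gamma_le (w := c + 2 * Real.pi * t * I) (by simpa using hc)
    simp only [add_re, sub_im, mul_re, mul_im, re_ofNat, ofReal_re, im_ofNat, ofReal_im, I_re, I_im,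
      mul_zero, mul_one, zero_mul, sub_zero, add_zero, sub_self] at h1 h2
    rw [div_eq_mul_inv] at h1
    gcongr

open scoped FourierTransform in
/-- The first lemma of Barnes, for a straight contour. -/
theorem barnes_first_lemma {a b c d : ℂ} (ha : 0 < a.re) (hb : 0 < b.re) (hc : 0 < c.re)
    (hd : 0 < d.re) :
    ∫ x : ℝ, Gamma (a + x * I) * Gamma (b + x * I) * Gamma (c - x * I) * Gamma (d - x * I) =
      2 * Real.pi * (Gamma (a + c) * Gamma (a + d) * Gamma (b + c) * Gamma (b + d) /
        Gamma (a + b + c + d)) := by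
  -- The Fourier transform is moved from one function to the other. Its square is the reflection y ↦
  -- -y, which turns the product on the right into one beta integrand with exponents a + d and b +
  -- c.
  have h1 : ∫ t, 𝓕 (logistic a c) t * 𝓕 (logistic b d) t =
      ∫ y, logistic a c y * 𝓕 (𝓕 (logistic b d)) y := by
    simpa using! (VectorFourier.integral_fourierIntegral_smul_eq_flip (L := innerₗ ℝ)
      Real.continuous_fourierChar continuous_inner (integrable_logistic ha hc)
      (integrable_fourier_logistic hb hd))
  have h2 : ∀ y, 𝓕 (𝓕 (logistic b d)) y = logistic b d (-y) := fun y => by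
    rw [← (continuous_logistic b d).fourierInv_fourier_eq (integrable_logistic hb hd)
      (integrable_fourier_logistic hb hd), Real.fourierInv_eq_fourier_neg, neg_neg,
      (continuous_logistic b d).fourierInv_fourier_eq (integrable_logistic hb hd)
      (integrable_fourier_logistic hb hd)]
  have h3 : ∀ y, logistic a c y * logistic b d (-y) = logistic (a + d) (b + c) y := fun y => by
    simp only [logistic, neg_neg]
    rw [Complex.cpow_add _ _ (sigmoid_ne_zero _), Complex.cpow_add _ _ (sigmoid_ne_zero _)]
    ring
  simp only [h2, h3] at h1
  rw [integral_logistic (by simp; linarith) (by simp; linarith)] at h1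
  have hac : Gamma (a + c) ≠ 0 := Complex.Gamma_ne_zero_of_re_pos (by simp; linarith)
  have hbd : Gamma (b + d) ≠ 0 := Complex.Gamma_ne_zero_of_re_pos (by simp; linarith)
  -- The substitution x = -2πt matches the frequency of the Fourier transform with the variable of
  -- the Barnes integral.
  have h4 := Measure.integral_comp_mul_left (fun x : ℝ => Gamma (a + x * I) * Gamma (b + x * I) *
    Gamma (c - x * I) * Gamma (d - x * I)) (-(2 * Real.pi))
  have h5 : ∀ t : ℝ, Gamma (a + (-(2 * Real.pi) * t : ℝ) * I) *
      Gamma (b + (-(2 * Real.pi) * t : ℝ) * I) * Gamma (c - (-(2 * Real.pi) * t : ℝ) * I) *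
      Gamma (d - (-(2 * Real.pi) * t : ℝ) * I) =
      Gamma (a + c) * Gamma (b + d) * (𝓕 (logistic a c) t * 𝓕 (logistic b d) t) := fun t => by
    rw [fourier_logistic ha hc, fourier_logistic hb hd]
    push_cast
    rw [show a + -(2 * Real.pi) * t * I = a - 2 * Real.pi * t * I by ring,
      show b + -(2 * Real.pi) * t * I = b - 2 * Real.pi * t * I by ring,
      show c - -(2 * Real.pi) * t * I = c + 2 * Real.pi * t * I by ring,
      show d - -(2 * Real.pi) * t * I = d + 2 * Real.pi * t * I by ring]
    field_simp
  simp only [h5] at h4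
  rw [integral_const_mul, h1, abs_inv, abs_neg, abs_of_pos Real.two_pi_pos, Complex.real_smul] at h4
  have hpi : (Real.pi : ℂ) ≠ 0 := by exact_mod_cast Real.pi_ne_zero
  push_cast at h4
  rw [eq_comm, inv_mul_eq_iff_eq_mul₀ (by simp)] at h4
  rw [h4, show a + b + c + d = a + d + (b + c) by ring]
  ring

/-! ### Residues and contour integrals -/

/-- On every small circle this is the Cauchy integral formula for g. All residues below are obtained
through this criterion, with the pole factored out explicitly. -/
theorem HasResidueAt.of_simplePole {f g : ℂ → ℂ} {a : ℂ} (hg : AnalyticAt ℂ g a)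
    (h : ∀ᶠ w in 𝓝[≠] a, f w = g w / (w - a)) : HasResidueAt f a (g a) := by
  obtain ⟨s, hs, hgs⟩ := Metric.eventually_nhds_iff_ball.1 hg.eventually_analyticAt
  rw [eventually_nhdsWithin_iff, Metric.eventually_nhds_iff_ball] at h
  obtain ⟨t, ht, hft⟩ := h
  constructor
  · rw [eventually_nhdsWithin_iff, Metric.eventually_nhds_iff_ball]
    refine ⟨min s t, lt_min hs ht, fun w hw hwa => ?_⟩
    have hd : DifferentiableAt ℂ (fun w => g w / (w - a)) w :=
      (hgs w (Metric.ball_subset_ball (min_le_left _ _) hw)).differentiableAt.div (by fun_prop)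
        (sub_ne_zero.2 hwa)
    refine hd.congr_of_eventuallyEq ?_
    filter_upwards [Metric.isOpen_ball.mem_nhds hw, isOpen_compl_singleton.mem_nhds hwa]
      with v hv hva
    exact hft v (Metric.ball_subset_ball (min_le_right _ _) hv) hva
  · filter_upwards [Ioo_mem_nhdsGT (lt_min hs ht)] with r hr
    have hsub : Metric.closedBall a r ⊆ Metric.ball a (min s t) :=
      Metric.closedBall_subset_ball hr.2
    have h1 : (∮ z in C(a, r), f z) = ∮ z in C(a, r), (z - a)⁻¹ • g z := by
      refine circleIntegral.integral_congr hr.1.le fun z hz => ?_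
      have hza : z ≠ a := by
        rintro rfl
        rw [mem_sphere_iff_norm, sub_self, norm_zero] at hz
        exact hr.1.ne hz
      rw [hft z (Metric.ball_subset_ball (min_le_right _ _)
        (hsub (Metric.sphere_subset_closedBall hz))) hza, smul_eq_mul, div_eq_inv_mul]
    have hd : DifferentiableOn ℂ g (Metric.closedBall a r) := fun z hz =>
      (hgs z (Metric.ball_subset_ball (min_le_left _ _)
        (hsub hz))).differentiableAt.differentiableWithinAt
    rw [h1, hd.circleIntegral_sub_inv_smul (Metric.mem_ball_self hr.1), smul_eq_mul]

theorem HasResidueAt.of_analyticAt {f g : ℂ → ℂ} {a : ℂ} (hg : AnalyticAt ℂ g a)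
    (h : ∀ᶠ w in 𝓝[≠] a, f w = g w) : HasResidueAt f a 0 := by
  have := HasResidueAt.of_simplePole (f := f) (g := fun w => (w - a) * g w) (a := a)
    (by fun_prop) ?_
  · simpa using this
  · filter_upwards [h, self_mem_nhdsWithin] with w hw hwa
    have : w - a ≠ 0 := sub_ne_zero.2 hwa
    rw [hw]; field_simp

theorem HasResidueAt.circleIntegrable {f : ℂ → ℂ} {a ρ : ℂ} (h : HasResidueAt f a ρ) :
    ∀ᶠ r in 𝓝[>] (0 : ℝ), CircleIntegrable f a r := by
  have h1 := h.1
  rw [eventually_nhdsWithin_iff, Metric.eventually_nhds_iff_ball] at h1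
  obtain ⟨t, ht, hft⟩ := h1
  filter_upwards [Ioo_mem_nhdsGT ht] with r hr
  refine ContinuousOn.circleIntegrable hr.1.le fun z hz => ?_
  refine (hft z (Metric.closedBall_subset_ball hr.2 (Metric.sphere_subset_closedBall hz))
    ?_).continuousAt.continuousWithinAt
  rintro rfl
  rw [mem_sphere_iff_norm, sub_self, norm_zero] at hz
  exact hr.1.ne hz

theorem HasResidueAt.add {f g : ℂ → ℂ} {a ρ σ : ℂ} (hf : HasResidueAt f a ρ)
    (hg : HasResidueAt g a σ) : HasResidueAt (fun z => f z + g z) a (ρ + σ) := by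
  refine ⟨?_, ?_⟩
  · filter_upwards [hf.1, hg.1] with z h1 h2 using h1.add h2
  · filter_upwards [hf.2, hg.2, hf.circleIntegrable, hg.circleIntegrable] with r h1 h2 h3 h4
    rw [circleIntegral.integral_add h3 h4, h1, h2]; ring

theorem HasResidueAt.const_mul {f : ℂ → ℂ} {a ρ : ℂ} (c : ℂ) (hf : HasResidueAt f a ρ) :
    HasResidueAt (fun z => c * f z) a (c * ρ) := by
  refine ⟨?_, ?_⟩
  · filter_upwards [hf.1] with z h1 using h1.const_mul c
  · filter_upwards [hf.2] with r h1
    rw [circleIntegral.integral_const_mul, h1]; ring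

theorem HasResidueAt.congr {f g : ℂ → ℂ} {a ρ : ℂ} (hf : HasResidueAt f a ρ)
    (h : ∀ᶠ z in 𝓝[≠] a, g z = f z) : HasResidueAt g a ρ := by
  rw [eventually_nhdsWithin_iff, Metric.eventually_nhds_iff_ball] at h
  obtain ⟨t, ht, hft⟩ := h
  refine ⟨?_, ?_⟩
  · have hb : ∀ᶠ z in 𝓝[≠] a, z ∈ Metric.ball a t :=
      nhdsWithin_le_nhds (Metric.ball_mem_nhds a ht)
    filter_upwards [hf.1, hb, self_mem_nhdsWithin] with z h1 h2 h3
    refine h1.congr_of_eventuallyEq ?_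
    filter_upwards [Metric.isOpen_ball.mem_nhds h2, isOpen_compl_singleton.mem_nhds h3]
      with v hv hva using hft v hv hva
  · filter_upwards [hf.2, Ioo_mem_nhdsGT ht] with r h1 hr
    rw [← h1]
    refine circleIntegral.integral_congr hr.1.le fun z hz => ?_
    refine hft z (Metric.closedBall_subset_ball hr.2 (Metric.sphere_subset_closedBall hz)) ?_
    rintro rfl
    rw [mem_sphere_iff_norm, sub_self, norm_zero] at hz
    exact hr.1.ne hz

theorem HasResidueAt.smallCircleIntegral_eq {f : ℂ → ℂ} {a ρ : ℂ} (hf : HasResidueAt f a ρ) :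
    smallCircleIntegral f a = 2 * Real.pi * I * ρ :=
  (tendsto_const_nhds.congr' (hf.2.mono fun _ h => h.symm)).limUnder_eq

theorem smallCircleIntegral_congr {f g : ℂ → ℂ} {a : ℂ}
    (h : ∀ᶠ r in 𝓝[>] (0 : ℝ), (∮ z in C(a, r), f z) = ∮ z in C(a, r), g z) :
    smallCircleIntegral f a = smallCircleIntegral g a := by
  unfold smallCircleIntegral limUnder
  rw [Filter.map_congr h]

/-! ### Linearity of the contour integral and its dependence on the integrand near the contour. -/

section Contour

variable {n : ℕ} {ℓ : ℝ} {a : Fin n → ℂ} {f g : ℂ → ℂ}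

theorem contourIntegral_eq {ρ : Fin n → ℂ} (h : ∀ i, HasResidueAt f (a i) (ρ i)) :
    contourIntegral ℓ a f = (∫ x : ℝ, f (x + ℓ * I)) - 2 * Real.pi * I * ∑ i, ρ i := by
  rw [contourIntegral, Finset.mul_sum]
  congr 1
  exact Finset.sum_congr rfl fun i _ => (h i).smallCircleIntegral_eq

theorem ContourConverges.add (hf : ContourConverges ℓ a f) (hg : ContourConverges ℓ a g) :
    ContourConverges ℓ a fun z => f z + g z :=
  ⟨hf.1.add hg.1, fun i => by
    obtain ⟨ρ, hρ⟩ := hf.2 i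
    obtain ⟨σ, hσ⟩ := hg.2 i
    exact ⟨_, hρ.add hσ⟩⟩

theorem ContourConverges.const_mul (c : ℂ) (hf : ContourConverges ℓ a f) :
    ContourConverges ℓ a fun z => c * f z :=
  ⟨hf.1.const_mul c, fun i => by
    obtain ⟨ρ, hρ⟩ := hf.2 i
    exact ⟨_, hρ.const_mul c⟩⟩

theorem contourIntegral_add (hf : ContourConverges ℓ a f) (hg : ContourConverges ℓ a g) :
    contourIntegral ℓ a (fun z => f z + g z) = contourIntegral ℓ a f + contourIntegral ℓ a g := by
  choose ρ hρ using hf.2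
  choose σ hσ using hg.2
  rw [contourIntegral_eq hρ, contourIntegral_eq hσ, contourIntegral_eq fun i => (hρ i).add (hσ i),
    integral_add hf.1 hg.1, Finset.sum_add_distrib]
  ring

theorem contourIntegral_const_mul (c : ℂ) (hf : ContourConverges ℓ a f) :
    contourIntegral ℓ a (fun z => c * f z) = c * contourIntegral ℓ a f := by
  choose ρ hρ using hf.2
  rw [contourIntegral_eq hρ, contourIntegral_eq fun i => (hρ i).const_mul c,
    integral_const_mul, ← Finset.mul_sum]
  ring

theorem ContourConverges.congr (hf : ContourConverges ℓ a f)
    (h1 : ∀ᵐ x : ℝ, g (x + ℓ * I) = f (x + ℓ * I)) (h2 : ∀ i, ∀ᶠ z in 𝓝[≠] a i, g z = f z) :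
    ContourConverges ℓ a g :=
  ⟨hf.1.congr (h1.mono fun _ h => h.symm), fun i => by
    obtain ⟨ρ, hρ⟩ := hf.2 i
    exact ⟨ρ, hρ.congr (h2 i)⟩⟩

theorem contourIntegral_congr (h1 : ∀ᵐ x : ℝ, g (x + ℓ * I) = f (x + ℓ * I))
    (h2 : ∀ i, ∀ᶠ z in 𝓝[≠] a i, g z = f z) :
    contourIntegral ℓ a g = contourIntegral ℓ a f := by
  rw [contourIntegral, contourIntegral, integral_congr_ae h1]
  congr 1
  refine Finset.sum_congr rfl fun i _ => smallCircleIntegral_congr ?_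
  have h := h2 i
  rw [eventually_nhdsWithin_iff, Metric.eventually_nhds_iff_ball] at h
  obtain ⟨t, ht, hft⟩ := h
  filter_upwards [Ioo_mem_nhdsGT ht] with r hr
  refine circleIntegral.integral_congr hr.1.le fun z hz => ?_
  refine hft z (Metric.closedBall_subset_ball hr.2 (Metric.sphere_subset_closedBall hz)) ?_
  rintro h
  rw [h, mem_sphere_iff_norm, sub_self, norm_zero] at hz
  exact hr.1.ne hz

end Contour

/-! ### Shifting the line of integration across a pole -/

/-- After division by R the arguments tend to i and -i, and log R cancels in the difference. -/
theorem tendsto_log_add_sub_log_sub {a b : ℝ} :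
    Tendsto (fun R : ℝ => log (a + R * I) - log (b - R * I)) atTop (𝓝 (Real.pi * I)) := by
  have h0 : ∀ c : ℝ, Tendsto (fun R : ℝ => (c : ℂ) / R) atTop (𝓝 0) := fun c => by
    have := (Complex.continuous_ofReal.tendsto _).comp
      ((tendsto_const_nhds (x := c)).div_atTop tendsto_id)
    simpa [Function.comp_def] using this
  have h1 : Tendsto (fun R : ℝ => log ((a : ℂ) / R + I)) atTop (𝓝 (log I)) := by
    have := (h0 a).add_const I
    rw [zero_add] at this
    exact (continuousAt_clog (by simp [mem_slitPlane_iff])).tendsto.comp this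
  have h2 : Tendsto (fun R : ℝ => log ((b : ℂ) / R - I)) atTop (𝓝 (log (-I))) := by
    have := (h0 b).sub_const I
    rw [zero_sub] at this
    exact (continuousAt_clog (by simp [mem_slitPlane_iff])).tendsto.comp this
  have h := h1.sub h2
  rw [log_I, log_neg_I, show (Real.pi / 2 * I : ℂ) - -(Real.pi / 2) * I = Real.pi * I by ring] at h
  refine h.congr' ?_
  filter_upwards [eventually_gt_atTop 0] with R hR
  have hRC : (R : ℂ) ≠ 0 := by exact_mod_cast hR.ne'
  have ha : (a : ℂ) / R + I ≠ 0 := fun h => by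
    have := congrArg Complex.im h
    simp [Complex.div_im] at this
  have hb : (b : ℂ) / R - I ≠ 0 := fun h => by
    have := congrArg Complex.im h
    simp [Complex.div_im] at this
  rw [show (a : ℂ) + R * I = R * (a / R + I) by field_simp,
    show (b : ℂ) - R * I = R * (b / R - I) by field_simp,
    log_ofReal_mul hR ha, log_ofReal_mul hR hb]
  ring

/-- The integrals are truncated symmetrically about Re z, because a single Cauchy kernel is not
absolutely integrable on a line. Multiplication by ±i moves both lines into the right half-plane,
where the principal logarithm provides an antiderivative. -/
theorem tendsto_integral_cauchyKernel_sub {ℓ ℓ' : ℝ} {z : ℂ} (h : ℓ < z.im) (h' : z.im < ℓ') :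
    Tendsto (fun R : ℝ => ∫ x in (z.re - R)..(z.re + R),
      (1 / ((x : ℂ) + ℓ * I - z) - 1 / ((x : ℂ) + ℓ' * I - z))) atTop (𝓝 (2 * Real.pi * I)) := by
  set a : ℝ := z.im - ℓ with ha
  set b : ℝ := ℓ' - z.im with hb
  have ha0 : 0 < a := by linarith
  have hb0 : 0 < b := by linarith
  set F : ℝ → ℂ := fun x => log (a + (x - z.re : ℝ) * I) - log (b - (x - z.re : ℝ) * I) with hF
  have hne1 : ∀ x : ℝ, (x : ℂ) + ℓ * I - z ≠ 0 := fun x hx => by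
    have := congrArg Complex.im hx; simp at this; linarith
  have hne2 : ∀ x : ℝ, (x : ℂ) + ℓ' * I - z ≠ 0 := fun x hx => by
    have := congrArg Complex.im hx; simp at this; linarith
  have hder : ∀ x : ℝ, HasDerivAt F (1 / ((x : ℂ) + ℓ * I - z) - 1 / ((x : ℂ) + ℓ' * I - z)) x := by
    intro x
    have hlin : HasDerivAt (fun x : ℝ => ((x - z.re : ℝ) : ℂ) * I) (1 * I) x :=
      ((((hasDerivAt_id x).sub_const z.re).ofReal_comp).mul_const I).congr_deriv (by simp)
    have h1 := (hlin.const_add (a : ℂ)).clog_real (by simp [mem_slitPlane_iff, ha0])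
    have h2 := (hlin.const_sub (b : ℂ)).clog_real (by simp [mem_slitPlane_iff, hb0])
    refine (h1.sub h2).congr_deriv ?_
    have e1 : (a : ℂ) + (x - z.re : ℝ) * I = I * ((x : ℂ) + ℓ * I - z) := by
      apply Complex.ext <;> simp [ha]
    have e2 : (b : ℂ) - (x - z.re : ℝ) * I = -I * ((x : ℂ) + ℓ' * I - z) := by
      apply Complex.ext <;> simp [hb]
    rw [e1, e2]
    have := hne1 x
    have := hne2 x
    field_simp
  have hint : ∀ R : ℝ, ∫ x in (z.re - R)..(z.re + R),
      (1 / ((x : ℂ) + ℓ * I - z) - 1 / ((x : ℂ) + ℓ' * I - z)) =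
      (log (a + R * I) - log (b - R * I)) + (log (b + R * I) - log (a - R * I)) := by
    intro R
    rw [intervalIntegral.integral_eq_sub_of_hasDerivAt (fun x _ => hder x)]
    · simp only [hF]
      push_cast
      ring_nf
    · refine Continuous.intervalIntegrable ?_ _ _
      exact (continuous_const.div (by fun_prop) hne1).sub (continuous_const.div (by fun_prop) hne2)
  simp only [hint]
  have := (tendsto_log_add_sub_log_sub (a := a) (b := b)).add
    (tendsto_log_add_sub_log_sub (a := b) (b := a))
  convert this using 2
  ring

theorem integrable_div_sub_of_line {g : ℂ → ℂ} {ℓ : ℝ} {z : ℂ} (hz : z.im ≠ ℓ)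
    (hg : Integrable fun x : ℝ => g (x + ℓ * I)) :
    Integrable fun x : ℝ => g (x + ℓ * I) / ((x : ℂ) + ℓ * I - z) := by
  have hne : ∀ x : ℝ, (x : ℂ) + ℓ * I - z ≠ 0 := fun x hx => by
    have := congrArg Complex.im hx
    simp at this
    exact hz (by linarith)
  simp only [div_eq_mul_inv]
  refine hg.mul_bdd (c := |ℓ - z.im|⁻¹) ?_ ?_
  · exact (Continuous.inv₀ (by fun_prop) hne).aestronglyMeasurable
  · refine Eventually.of_forall fun x => ?_
    rw [norm_inv]
    have h := Complex.abs_im_le_norm ((x : ℂ) + ℓ * I - z)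
    simp only [sub_im, add_im, ofReal_im, mul_im, ofReal_re, I_im, I_re, mul_one, mul_zero,
      add_zero, zero_add] at h
    have : 0 < |ℓ - z.im| := abs_pos.2 (sub_ne_zero.2 hz.symm)
    gcongr

/-- Shifting a line of integration across a simple pole. -/
theorem integral_line_shift {g : ℂ → ℂ} {ℓ ℓ' M : ℝ} {z : ℂ} (h : ℓ < z.im) (h' : z.im < ℓ')
    (hd : ∀ w : ℂ, ℓ ≤ w.im → w.im ≤ ℓ' → DifferentiableAt ℂ g w)
    (hM : ∀ w : ℂ, ℓ ≤ w.im → w.im ≤ ℓ' → ‖g w‖ ≤ M)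
    (hi : Integrable fun x : ℝ => g (x + ℓ * I)) (hi' : Integrable fun x : ℝ => g (x + ℓ' * I)) :
    (∫ x : ℝ, g (x + ℓ * I) / ((x : ℂ) + ℓ * I - z)) -
      ∫ x : ℝ, g (x + ℓ' * I) / ((x : ℂ) + ℓ' * I - z) = 2 * Real.pi * I * g z := by
  have hll : ℓ < ℓ' := h.trans h'
  -- Subtracting g(z)/(w - z) removes the pole, so Cauchy's theorem applies to the rectangle. The
  -- vertical sides are O(1/R) because g is bounded, and the subtracted kernel contributes the 2πi.
  set k : ℂ → ℂ := dslope g z with hk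
  have hkne : ∀ w, w ≠ z → k w = (g w - g z) / (w - z) := fun w hw => by
    rw [hk, dslope_of_ne _ hw, slope_def_field]
  have hne1 : ∀ x : ℝ, (x : ℂ) + ℓ * I - z ≠ 0 := fun x hx => by
    have := congrArg Complex.im hx; simp at this; linarith
  have hne2 : ∀ x : ℝ, (x : ℂ) + ℓ' * I - z ≠ 0 := fun x hx => by
    have := congrArg Complex.im hx; simp at this; linarith
  have hrect : ∀ R : ℝ, 0 < R →
      (∫ x : ℝ in (z.re - R)..(z.re + R), k (x + ℓ * I)) -
      (∫ x : ℝ in (z.re - R)..(z.re + R), k (x + ℓ' * I)) +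
      I • (∫ y : ℝ in ℓ..ℓ', k ((z.re + R : ℝ) + y * I)) -
      I • (∫ y : ℝ in ℓ..ℓ', k ((z.re - R : ℝ) + y * I)) = 0 := by
    intro R hR
    have := integral_boundary_rect_eq_zero_of_differentiableOn k
      (((z.re - R : ℝ) : ℂ) + ℓ * I) (((z.re + R : ℝ) : ℂ) + ℓ' * I) ?_
    · simpa using this
    · have hre : (((z.re - R : ℝ) : ℂ) + ℓ * I).re = z.re - R := by simp
      have hre' : (((z.re + R : ℝ) : ℂ) + ℓ' * I).re = z.re + R := by simp
      have him : (((z.re - R : ℝ) : ℂ) + ℓ * I).im = ℓ := by simp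
      have him' : (((z.re + R : ℝ) : ℂ) + ℓ' * I).im = ℓ' := by simp
      rw [hre, hre', him, him', Set.uIcc_of_le (by linarith), Set.uIcc_of_le hll.le, hk,
        Complex.differentiableOn_dslope]
      · intro w hw
        rw [mem_reProdIm] at hw
        exact (hd w hw.2.1 hw.2.2).differentiableWithinAt
      · rw [mem_nhds_iff]
        refine ⟨Set.Ioo (z.re - R) (z.re + R) ×ℂ Set.Ioo ℓ ℓ', ?_,
          isOpen_Ioo.reProdIm isOpen_Ioo, ?_⟩
        · intro w hw
          rw [mem_reProdIm] at hw ⊢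
          exact ⟨Set.Ioo_subset_Icc_self hw.1, Set.Ioo_subset_Icc_self hw.2⟩
        · rw [mem_reProdIm]
          exact ⟨⟨by linarith, by linarith⟩, h, h'⟩
  have hside : ∀ R : ℝ, 0 < R → ∀ s : ℝ, |s - z.re| = R →
      ‖∫ y : ℝ in ℓ..ℓ', k ((s : ℝ) + y * I)‖ ≤ (M + ‖g z‖) / R * |ℓ' - ℓ| := by
    intro R hR s hs
    refine intervalIntegral.norm_integral_le_of_norm_le_const fun y hy => ?_
    rw [Set.uIoc_of_le hll.le] at hy
    have hR2 : R ≤ ‖(s : ℂ) + y * I - z‖ := by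
      rw [← hs]
      have := Complex.abs_re_le_norm ((s : ℂ) + y * I - z)
      simpa using this
    have hsz : (s : ℂ) + y * I ≠ z := by
      intro h0
      rw [h0, sub_self, norm_zero] at hR2
      linarith
    rw [hkne _ hsz, norm_div]
    have h1 : ‖g ((s : ℂ) + y * I) - g z‖ ≤ M + ‖g z‖ := by
      refine (norm_sub_le _ _).trans ?_
      gcongr
      exact hM _ (by simpa using hy.1.le) (by simpa using hy.2)
    have h2 : 0 ≤ M + ‖g z‖ := (norm_nonneg _).trans h1
    gcongr
  have hlim0 : Tendsto (fun R : ℝ => (M + ‖g z‖) / R * |ℓ' - ℓ|) atTop (𝓝 0) := by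
    have := ((tendsto_const_nhds (x := M + ‖g z‖)).div_atTop tendsto_id).mul_const |ℓ' - ℓ|
    simpa using this
  have hside1 : Tendsto (fun R : ℝ => ∫ y : ℝ in ℓ..ℓ', k ((z.re + R : ℝ) + y * I)) atTop
      (𝓝 0) := by
    refine squeeze_zero_norm' ?_ hlim0
    filter_upwards [eventually_gt_atTop 0] with R hR
    exact hside R hR _ (by rw [add_sub_cancel_left, abs_of_pos hR])
  have hside2 : Tendsto (fun R : ℝ => ∫ y : ℝ in ℓ..ℓ', k ((z.re - R : ℝ) + y * I)) atTop
      (𝓝 0) := by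
    refine squeeze_zero_norm' ?_ hlim0
    filter_upwards [eventually_gt_atTop 0] with R hR
    exact hside R hR _ (by rw [sub_sub_cancel_left, abs_neg, abs_of_pos hR])
  have hI1 := integrable_div_sub_of_line h.ne' hi
  have hI2 := integrable_div_sub_of_line h'.ne hi'
  have hbot : Tendsto (fun R : ℝ => z.re - R) atTop atBot :=
    tendsto_atBot_add_const_left _ _ tendsto_neg_atTop_atBot
  have htop : Tendsto (fun R : ℝ => z.re + R) atTop atTop :=
    tendsto_atTop_add_const_left _ _ tendsto_id
  have hL1 := intervalIntegral_tendsto_integral hI1 hbot htop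
  have hL2 := intervalIntegral_tendsto_integral hI2 hbot htop
  have hT := (hL1.sub hL2).sub ((tendsto_integral_cauchyKernel_sub h h').const_mul (g z))
  have hZ : Tendsto (fun R : ℝ => I • (∫ y : ℝ in ℓ..ℓ', k ((z.re - R : ℝ) + y * I)) -
      I • (∫ y : ℝ in ℓ..ℓ', k ((z.re + R : ℝ) + y * I))) atTop (𝓝 0) := by
    have := (hside2.const_smul I).sub (hside1.const_smul I)
    simpa using this
  have hfin := tendsto_nhds_unique (hT.congr' ?_) hZ
  · linear_combination hfin
  filter_upwards [eventually_gt_atTop 0] with R hR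
  have hr := hrect R hR
  have c1 : Continuous fun x : ℝ => 1 / ((x : ℂ) + ℓ * I - z) :=
    continuous_const.div (by fun_prop) hne1
  have c2 : Continuous fun x : ℝ => 1 / ((x : ℂ) + ℓ' * I - z) :=
    continuous_const.div (by fun_prop) hne2
  have e1 : ∀ x : ℝ, k (x + ℓ * I) = g (x + ℓ * I) / ((x : ℂ) + ℓ * I - z) -
      g z * (1 / ((x : ℂ) + ℓ * I - z)) := fun x => by
    rw [hkne _ (sub_ne_zero.1 (hne1 x))]; ring
  have e2 : ∀ x : ℝ, k (x + ℓ' * I) = g (x + ℓ' * I) / ((x : ℂ) + ℓ' * I - z) -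
      g z * (1 / ((x : ℂ) + ℓ' * I - z)) := fun x => by
    rw [hkne _ (sub_ne_zero.1 (hne2 x))]; ring
  simp only [e1, e2] at hr
  rw [intervalIntegral.integral_sub hI1.intervalIntegrable
      ((c1.const_mul (g z)).intervalIntegrable _ _),
    intervalIntegral.integral_sub hI2.intervalIntegrable
      ((c2.const_mul (g z)).intervalIntegrable _ _),
    intervalIntegral.integral_const_mul, intervalIntegral.integral_const_mul] at hr
  rw [intervalIntegral.integral_sub (c1.intervalIntegrable _ _) (c2.intervalIntegrable _ _)]
  linear_combination hr

/-- Shifting a contour with two encircled poles to a straight line. -/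
theorem contourIntegral_pair_eq_line {g : ℂ → ℂ} {ℓ ℓ' M : ℝ} {z : Fin 2 → ℂ} (hz : z 0 ≠ z 1)
    (h : ∀ i, ℓ < (z i).im) (h' : ∀ i, (z i).im < ℓ')
    (hd : ∀ w : ℂ, ℓ ≤ w.im → w.im ≤ ℓ' → DifferentiableAt ℂ g w)
    (hM : ∀ w : ℂ, ℓ ≤ w.im → w.im ≤ ℓ' → ‖g w‖ ≤ M)
    (hi : Integrable fun x : ℝ => g (x + ℓ * I)) (hi' : Integrable fun x : ℝ => g (x + ℓ' * I))
    {f : ℂ → ℂ} (hf : ∀ w, w ≠ z 0 → w ≠ z 1 → f w = g w / ((w - z 0) * (w - z 1))) :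
    ContourConverges ℓ z f ∧ contourIntegral ℓ z f = ∫ x : ℝ, f (x + ℓ' * I) := by
  have ha : ∀ i, AnalyticAt ℂ g (z i) := fun i => by
    refine analyticAt_iff_eventually_differentiableAt.2 ?_
    have h1 := (Complex.continuous_im.tendsto (z i)).eventually (lt_mem_nhds (h i))
    have h2 := (Complex.continuous_im.tendsto (z i)).eventually (gt_mem_nhds (h' i))
    filter_upwards [h1, h2] with w hw1 hw2 using hd w hw1.le hw2.le
  have hz01 : z 0 - z 1 ≠ 0 := sub_ne_zero.2 hz
  have hz10 : z 1 - z 0 ≠ 0 := sub_ne_zero.2 hz.symm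
  have r0 : HasResidueAt f (z 0) (g (z 0) / (z 0 - z 1)) := by
    refine HasResidueAt.of_simplePole (g := fun w => g w / (w - z 1))
      ((ha 0).div (by fun_prop) hz01) ?_
    filter_upwards [self_mem_nhdsWithin, nhdsWithin_le_nhds (isOpen_compl_singleton.mem_nhds hz)]
      with w hw0 hw1
    rw [hf w hw0 hw1, div_div, mul_comm]
  have r1 : HasResidueAt f (z 1) (g (z 1) / (z 1 - z 0)) := by
    refine HasResidueAt.of_simplePole (g := fun w => g w / (w - z 0))
      ((ha 1).div (by fun_prop) hz10) ?_
    filter_upwards [self_mem_nhdsWithin,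
      nhdsWithin_le_nhds (isOpen_compl_singleton.mem_nhds hz.symm)] with w hw1 hw0
    rw [hf w hw0 hw1, div_div]
  -- Partial fractions reduce the two poles to two instances of the shift across a single pole.
  have hfe : ∀ m : ℝ, (∀ i, (z i).im ≠ m) → ∀ x : ℝ, (z 0 - z 1)⁻¹ *
      (g (x + m * I) / ((x : ℂ) + m * I - z 0) - g (x + m * I) / ((x : ℂ) + m * I - z 1)) =
        f (x + m * I) := by
    intro m hm x
    have hne : ∀ i, (x : ℂ) + m * I - z i ≠ 0 := fun i hx => by
      have := congrArg Complex.im hx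
      simp at this
      exact hm i (by linarith)
    have n0 := hne 0
    have n1 := hne 1
    rw [hf _ (sub_ne_zero.1 n0) (sub_ne_zero.1 n1)]
    field_simp
    ring
  have key : ∀ m : ℝ, (∀ i, (z i).im ≠ m) → Integrable (fun x : ℝ => g (x + m * I)) →
      ∫ x : ℝ, f (x + m * I) = (z 0 - z 1)⁻¹ *
        ((∫ x : ℝ, g (x + m * I) / ((x : ℂ) + m * I - z 0)) -
          ∫ x : ℝ, g (x + m * I) / ((x : ℂ) + m * I - z 1)) := by
    intro m hm hint
    rw [← integral_sub (integrable_div_sub_of_line (hm 0) hint)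
      (integrable_div_sub_of_line (hm 1) hint), ← integral_const_mul]
    exact integral_congr_ae (Eventually.of_forall fun x => (hfe m hm x).symm)
  have hr : ∀ i, HasResidueAt f (z i) ((![g (z 0) / (z 0 - z 1), g (z 1) / (z 1 - z 0)] :
      Fin 2 → ℂ) i) := fun i => by fin_cases i; exacts [r0, r1]
  refine ⟨⟨?_, fun i => ⟨_, hr i⟩⟩, ?_⟩
  · exact (((integrable_div_sub_of_line (h 0).ne' hi).sub
      (integrable_div_sub_of_line (h 1).ne' hi)).const_mul (z 0 - z 1)⁻¹).congr
        (Eventually.of_forall fun x => hfe ℓ (fun i => (h i).ne') x)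
  rw [contourIntegral_eq hr]
  have s0 := integral_line_shift (h 0) (h' 0) hd hM hi hi'
  have s1 := integral_line_shift (h 1) (h' 1) hd hM hi hi'
  rw [key ℓ (fun i => (h i).ne') hi, key ℓ' (fun i => (h' i).ne) hi', Fin.sum_univ_two]
  simp only [Matrix.cons_val_zero, Matrix.cons_val_one]
  rw [show z 1 - z 0 = -(z 0 - z 1) by ring, div_neg]
  linear_combination (z 0 - z 1)⁻¹ * (s0 - s1)

/-! ### The scaled variable -/

theorem xvar_add (a b : ℂ) : xvar (a + b) = xvar a + xvar b := add_div _ _ _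

theorem xvar_sub (a b : ℂ) : xvar (a - b) = xvar a - xvar b := sub_div _ _ _

theorem xvar_neg (a : ℂ) : xvar (-a) = -xvar a := neg_div _ _

theorem two_pi_I_ne_zero' : (2 * Real.pi * I : ℂ) ≠ 0 := Complex.two_pi_I_ne_zero

theorem mul_xvar (a : ℂ) : 2 * Real.pi * I * xvar a = a := mul_div_cancel₀ _ two_pi_I_ne_zero'

theorem xvar_pi_I_div_two : xvar (Real.pi * I / 2) = 1 / 4 := by
  have := Real.pi_ne_zero
  unfold xvar; field_simp; norm_num

theorem xvar_injective : Function.Injective xvar := fun a b h => by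
  rw [← mul_xvar a, h, mul_xvar]

theorem xvar_eq (w : ℂ) : xvar w = (w.im / (2 * Real.pi) : ℝ) + (-w.re / (2 * Real.pi) : ℝ) * I := by
  have := Real.pi_ne_zero
  rw [xvar]
  nth_rewrite 1 [← re_add_im w]
  push_cast
  field_simp
  ring_nf
  simp

/-- Horizontal lines in the rapidity plane become the vertical lines of the Barnes lemma, with 2π in
the rapidity corresponding to 1 in x and iπ/2 to 1/4. -/
theorem xvar_re (w : ℂ) : (xvar w).re = w.im / (2 * Real.pi) := by
  rw [xvar_eq, add_re, ofReal_re, re_ofReal_mul, I_re, mul_zero, add_zero]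

theorem xvar_im (w : ℂ) : (xvar w).im = -w.re / (2 * Real.pi) := by
  rw [xvar_eq, add_im, ofReal_im, im_ofReal_mul, I_im, mul_one, zero_add]

theorem differentiable_xvar : Differentiable ℂ xvar := by unfold xvar; fun_prop

theorem bT_eq (w : ℂ) : bT w = xvar w / (xvar w - 1 / 4) := by
  rw [bT, ← xvar_pi_I_div_two, ← xvar_sub]
  unfold xvar
  rw [div_div_div_cancel_right₀ two_pi_I_ne_zero']

theorem cT_eq (w : ℂ) : cT w = -(1 / 4) / (xvar w - 1 / 4) := by
  rw [cT, ← xvar_pi_I_div_two, ← xvar_sub]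
  unfold xvar
  rw [← neg_div (2 * Real.pi * I : ℂ), div_div_div_cancel_right₀ two_pi_I_ne_zero']

/-! ### Products of Gamma functions on horizontal lines -/

/-- The integrand of the Barnes lemma as a function of a rapidity. -/
def barnesIntegrand (a b c d : ℂ) (w : ℂ) : ℂ :=
  Gamma (a + xvar w) * Gamma (b + xvar w) * Gamma (c - xvar w) * Gamma (d - xvar w)

/-- The height of the line is absorbed into the four parameters as a real shift that cancels in all
the sums. One factor 2π comes from the Barnes lemma, the other from the Jacobian of the scaled
variable. -/
theorem integral_barnesIntegrand {a b c d : ℂ} {ℓ : ℝ} (ha : 0 < a.re + ℓ / (2 * Real.pi))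
    (hb : 0 < b.re + ℓ / (2 * Real.pi)) (hc : 0 < c.re - ℓ / (2 * Real.pi))
    (hd : 0 < d.re - ℓ / (2 * Real.pi)) :
    ∫ x : ℝ, barnesIntegrand a b c d (x + ℓ * I) = (2 * Real.pi) ^ 2 *
      (Gamma (a + c) * Gamma (a + d) * Gamma (b + c) * Gamma (b + d) /
        Gamma (a + b + c + d)) := by
  set s : ℂ := ((ℓ / (2 * Real.pi) : ℝ) : ℂ) with hs
  have h := barnes_first_lemma (a := a + s) (b := b + s) (c := c - s) (d := d - s)
    (by rwa [add_re, hs, ofReal_re]) (by rwa [add_re, hs, ofReal_re])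
    (by rwa [sub_re, hs, ofReal_re]) (by rwa [sub_re, hs, ofReal_re])
  have h4 := Measure.integral_comp_mul_left (fun x : ℝ => Gamma (a + s + x * I) *
    Gamma (b + s + x * I) * Gamma (c - s - x * I) * Gamma (d - s - x * I)) (-(2 * Real.pi)⁻¹)
  rw [h] at h4
  have h5 : ∀ x : ℝ, xvar (x + ℓ * I) = s + ((-(2 * Real.pi)⁻¹ * x : ℝ) : ℂ) * I := fun x => by
    rw [xvar_eq, hs]
    simp only [add_im, ofReal_im, mul_im, ofReal_re, I_im, mul_one, I_re, mul_zero, add_zero,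
      zero_add, add_re, mul_re, sub_zero]
    congr 2
    push_cast; ring
  have h6 : ∀ x : ℝ, barnesIntegrand a b c d (x + ℓ * I) =
      Gamma (a + s + (-(2 * Real.pi)⁻¹ * x : ℝ) * I) *
      Gamma (b + s + (-(2 * Real.pi)⁻¹ * x : ℝ) * I) *
      Gamma (c - s - (-(2 * Real.pi)⁻¹ * x : ℝ) * I) *
      Gamma (d - s - (-(2 * Real.pi)⁻¹ * x : ℝ) * I) := fun x => by
    rw [barnesIntegrand, h5]
    simp only [add_assoc, sub_sub]
  simp only [h6, h4]
  rw [abs_inv, abs_neg, abs_inv, inv_inv, abs_of_pos Real.two_pi_pos, Complex.real_smul,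
    show a + s + (c - s) = a + c by ring, show a + s + (d - s) = a + d by ring,
    show b + s + (c - s) = b + c by ring, show b + s + (d - s) = b + d by ring,
    show a + s + (b + s) + (c - s) + (d - s) = a + b + c + d by ring]
  push_cast
  ring

/-- The four Gamma factors share the work: the first supplies integrable decay, the quadratic decay
of the second absorbs the growth of the affine factor, and the last two need only be bounded. -/
theorem exists_barnesIntegrand_bound {a b c d : ℂ} {ℓ ℓ' : ℝ}
    (ha : 0 < a.re + ℓ / (2 * Real.pi)) (hb : 0 < b.re + ℓ / (2 * Real.pi))
    (hc : 0 < c.re - ℓ' / (2 * Real.pi)) (hd : 0 < d.re - ℓ' / (2 * Real.pi)) (α β : ℂ) :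
    ∃ M, 0 ≤ M ∧ ∀ w : ℂ, ℓ ≤ w.im → w.im ≤ ℓ' →
      ‖barnesIntegrand a b c d w * (α + β * xvar w)‖ ≤
        M / (1 + (a.im - w.re / (2 * Real.pi)) ^ 2) := by
  obtain ⟨A, hA0, hA⟩ := exists_Gamma_decay (β := a.re + ℓ' / (2 * Real.pi)) ha
  obtain ⟨B, hB0, hB⟩ := exists_Gamma_decay (β := b.re + ℓ' / (2 * Real.pi)) hb
  obtain ⟨C, hC0, hC⟩ := exists_Gamma_bound (β := c.re - ℓ / (2 * Real.pi)) hc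
  obtain ⟨D, hD0, hD⟩ := exists_Gamma_bound (β := d.re - ℓ / (2 * Real.pi)) hd
  set E : ℝ := ‖α - β * b‖ + ‖β‖ * (|b.re + ℓ' / (2 * Real.pi)| + 1) with hE
  have hE0 : 0 ≤ E := by positivity
  refine ⟨A * (B * E) * C * D, by positivity, fun w h1 h2 => ?_⟩
  have hl : ℓ / (2 * Real.pi) ≤ (xvar w).re := by
    rw [xvar_re]; have := Real.two_pi_pos; gcongr
  have hl' : (xvar w).re ≤ ℓ' / (2 * Real.pi) := by
    rw [xvar_re]; have := Real.two_pi_pos; gcongr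
  have gA := hA (a + xvar w) (by simpa using hl) (by simpa using hl')
  have gB := hB (b + xvar w) (by simpa using hl) (by simpa using hl')
  have gC := hC (c - xvar w) (by rw [sub_re]; linarith) (by rw [sub_re]; linarith)
  have gD := hD (d - xvar w) (by rw [sub_re]; linarith) (by rw [sub_re]; linarith)
  have e : (a + xvar w).im = a.im - w.re / (2 * Real.pi) := by simp [xvar_im]; ring
  rw [e] at gA
  have gB' : ‖Gamma (b + xvar w) * (α + β * xvar w)‖ ≤ B * E := by
    set t := (b + xvar w).im with ht
    have hre : |(b + xvar w).re| ≤ |b.re + ℓ' / (2 * Real.pi)| := by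
      have h0 : 0 < (b + xvar w).re := by simp; linarith
      have h3 : (b + xvar w).re ≤ b.re + ℓ' / (2 * Real.pi) := by simpa using hl'
      rw [abs_of_pos h0]; exact h3.trans (le_abs_self _)
    have hq : ‖α + β * xvar w‖ ≤ E * (1 + t ^ 2) := by
      have e2 : α + β * xvar w = (α - β * b) + β * (b + xvar w) := by ring
      rw [e2]
      refine (norm_add_le _ _).trans ?_
      rw [norm_mul]
      have h3 : ‖b + xvar w‖ ≤ |b.re + ℓ' / (2 * Real.pi)| + |t| :=
        (Complex.norm_le_abs_re_add_abs_im _).trans (by gcongr)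
      have h4 : |t| ≤ 1 + t ^ 2 := by
        rw [← sq_abs t]; nlinarith [abs_nonneg t, sq_nonneg (|t| - 1)]
      have h5 : 1 ≤ 1 + t ^ 2 := by nlinarith
      calc ‖α - β * b‖ + ‖β‖ * ‖b + xvar w‖
          ≤ ‖α - β * b‖ * (1 + t ^ 2) + ‖β‖ * (|b.re + ℓ' / (2 * Real.pi)| * (1 + t ^ 2) +
            (1 + t ^ 2)) := by
            refine add_le_add (le_mul_of_one_le_right (norm_nonneg _) h5) ?_
            refine mul_le_mul_of_nonneg_left (h3.trans ?_) (norm_nonneg _)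
            exact add_le_add (le_mul_of_one_le_right (abs_nonneg _) h5) h4
        _ = E * (1 + t ^ 2) := by rw [hE]; ring
    rw [norm_mul]
    calc _ ≤ B / (1 + t ^ 2) * (E * (1 + t ^ 2)) := by gcongr
      _ = B * E := by
        have : 1 + t ^ 2 ≠ 0 := by positivity
        field_simp
  rw [barnesIntegrand, show Gamma (a + xvar w) * Gamma (b + xvar w) * Gamma (c - xvar w) *
    Gamma (d - xvar w) * (α + β * xvar w) = Gamma (a + xvar w) *
      (Gamma (b + xvar w) * (α + β * xvar w)) * Gamma (c - xvar w) * Gamma (d - xvar w) by ring,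
    norm_mul, norm_mul, norm_mul]
  calc _ ≤ A / (1 + (a.im - w.re / (2 * Real.pi)) ^ 2) * (B * E) * C * D := by gcongr
    _ = _ := by ring

theorem differentiableAt_Gamma_of_re_pos {w : ℂ} (hw : 0 < w.re) : DifferentiableAt ℂ Gamma w :=
  differentiableAt_Gamma w fun m h => by
    have : (0 : ℝ) ≤ m := m.cast_nonneg
    rw [h] at hw; simp at hw; linarith

theorem differentiableAt_barnesIntegrand {a b c d w : ℂ}
    (ha : 0 < (a + xvar w).re) (hb : 0 < (b + xvar w).re) (hc : 0 < (c - xvar w).re)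
    (hd : 0 < (d - xvar w).re) : DifferentiableAt ℂ (barnesIntegrand a b c d) w := by
  have hx := differentiable_xvar w
  have h1 := (differentiableAt_Gamma_of_re_pos ha).comp w (hx.const_add a)
  have h2 := (differentiableAt_Gamma_of_re_pos hb).comp w (hx.const_add b)
  have h3 := (differentiableAt_Gamma_of_re_pos hc).comp w (hx.const_sub c)
  have h4 := (differentiableAt_Gamma_of_re_pos hd).comp w (hx.const_sub d)
  exact ((h1.mul h2).mul h3).mul h4

theorem integrable_barnesIntegrand {a b c d : ℂ} {ℓ : ℝ} (ha : 0 < a.re + ℓ / (2 * Real.pi))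
    (hb : 0 < b.re + ℓ / (2 * Real.pi)) (hc : 0 < c.re - ℓ / (2 * Real.pi))
    (hd : 0 < d.re - ℓ / (2 * Real.pi)) (α β : ℂ) :
    Integrable fun x : ℝ => barnesIntegrand a b c d (x + ℓ * I) *
      (α + β * xvar (x + ℓ * I)) := by
  obtain ⟨M, hM0, hM⟩ := exists_barnesIntegrand_bound ha hb hc hd α β
  have hb : Integrable fun x : ℝ => M * (1 + (a.im - x / (2 * Real.pi)) ^ 2)⁻¹ := by
    have h := ((integrable_inv_one_add_sq.comp_add_left a.im).comp_mul_left'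
      (R := -(2 * Real.pi)⁻¹) (by simp [Real.pi_ne_zero]))
    refine (h.const_mul M).congr (Eventually.of_forall fun t => ?_)
    have : a.im + -(2 * Real.pi)⁻¹ * t = a.im - t / (2 * Real.pi) := by ring
    simp only [this]
  refine hb.mono' ?_ (Eventually.of_forall fun x => ?_)
  · refine Continuous.aestronglyMeasurable (continuous_iff_continuousAt.2 fun x => ?_)
    have hre : (xvar (x + ℓ * I)).re = ℓ / (2 * Real.pi) := by simp [xvar_re]
    have hd1 : DifferentiableAt ℂ (barnesIntegrand a b c d) (x + ℓ * I) :=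
      differentiableAt_barnesIntegrand (by simpa [hre] using ha) (by simpa [hre] using ‹0 < b.re + _›)
        (by simpa [hre] using hc) (by simpa [hre] using hd)
    have hcl : ContinuousAt (fun x : ℝ => (x : ℂ) + ℓ * I) x := by fun_prop
    refine (ContinuousAt.comp (x := x) hd1.continuousAt hcl).mul ?_
    have := ContinuousAt.comp (x := x) (differentiable_xvar.continuous.continuousAt) hcl
    exact continuousAt_const.add (continuousAt_const.mul this)
  · have := hM (x + ℓ * I) (by simp) (by simp)
    simpa [div_eq_mul_inv] using this

/-! ### The second level of the nesting -/

theorem Gamma_one_add {u : ℂ} (hu : u ≠ 0) : Gamma (1 + u) = u * Gamma u := by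
  rw [add_comm, Complex.Gamma_add_one u hu]

/-- One flipped weight must sit at the first or at the second site. When it sits at the first, the
remaining line carries only reference colours, and its weight is b̃ + c̃ = 1. -/
theorem K1Integrand_eq (B : Fin 2 → Fin 3) (z : Fin 2 → ℂ) {y : ℂ}
    (hy : z 1 - y ≠ Real.pi * I / 2) :
    K1Integrand B z y = phiT (z 0 - y) * phiT (z 1 - y) *
      (if B 0 = 1 ∧ B 1 = 0 then cT (z 0 - y)
        else if B 0 = 0 ∧ B 1 = 1 then bT (z 0 - y) * cT (z 1 - y) else 0) := by
  have hbc : bT (z 1 - y) + cT (z 1 - y) = 1 := by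
    rw [bT, cT, ← add_div, ← sub_eq_add_neg, div_self (sub_ne_zero.2 hy)]
  obtain ⟨b0, hb0⟩ : ∃ b, B 0 = b := ⟨_, rfl⟩
  obtain ⟨b1, hb1⟩ : ∃ b, B 1 = b := ⟨_, rfl⟩
  have hB : B = ![b0, b1] := by ext i; fin_cases i <;> simp [hb0, hb1]
  have hsum : ∀ g : (Fin 2 → Fin 3) → ℂ, ∑ A' : Fin 2 → Fin 3, g A' * (if A' = 0 then 1 else 0) =
      g 0 := fun g => by simp
  have hh : hfun z ![y] = phiT (z 0 - y) * phiT (z 1 - y) := by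
    simp [hfun, Fin.prod_univ_two, Finset.filter_singleton]
  have hC : ∑ C : Fin 1 → Fin 2, K2 C * bethe z ![y] (fun i => (C i).succ) B =
      bethe z ![y] (fun _ => 1) B := by
    rw [Finset.sum_eq_single 0 (fun C _ hC => by rw [K2, if_neg hC, zero_mul]) (by simp)]
    simp [K2]
  rw [K1Integrand, hh, hC]
  congr 1
  simp only [bethe, hsum, hB]
  simp only [monodromy, Fin.tail, STilde, Fin.sum_univ_three]
  fin_cases b0 <;> fin_cases b1 <;> simp [hbc]

section SecondLevel

variable {ℓ : ℝ} {z : Fin 2 → ℂ}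

theorem phiT_mul_phiT_eq (w : ℂ) : phiT (z 0 - w) * phiT (z 1 - w) =
    barnesIntegrand (-xvar (z 0)) (-xvar (z 1)) (xvar (z 0) + 3 / 4) (xvar (z 1) + 3 / 4) w := by
  rw [phiT, phiT, barnesIntegrand, xvar_sub, xvar_sub,
    show 3 / 4 + (xvar (z 0) - xvar w) = xvar (z 0) + 3 / 4 - xvar w by ring,
    show 3 / 4 + (xvar (z 1) - xvar w) = xvar (z 1) + 3 / 4 - xvar w by ring,
    show -(xvar (z 0) - xvar w) = -xvar (z 0) + xvar w by ring,
    show -(xvar (z 1) - xvar w) = -xvar (z 1) + xvar w by ring]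
  ring

theorem xvar_re_bounds (hz : ∀ i, ℓ + Real.pi / 2 < (z i).im ∧ (z i).im < ℓ + 2 * Real.pi) (i) :
    ℓ / (2 * Real.pi) + 1 / 4 < (xvar (z i)).re ∧ (xvar (z i)).re < ℓ / (2 * Real.pi) + 1 := by
  have hpi := Real.two_pi_pos
  have e1 : ℓ / (2 * Real.pi) + 1 / 4 = (ℓ + Real.pi / 2) / (2 * Real.pi) := by field_simp; ring
  have e2 : ℓ / (2 * Real.pi) + 1 = (ℓ + 2 * Real.pi) / (2 * Real.pi) := by field_simp
  rw [xvar_re, e1, e2]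
  exact ⟨div_lt_div_of_pos_right (hz i).1 hpi, div_lt_div_of_pos_right (hz i).2 hpi⟩

/-- The contour of the second level can be replaced by a line for integrands without poles at
`z - iπ/2`. -/
theorem contourIntegral_phiT_mul_affine (h01 : z 0 ≠ z 1)
    (hz : ∀ i, ℓ + Real.pi / 2 < (z i).im ∧ (z i).im < ℓ + 2 * Real.pi) (α β : ℂ) :
    ContourConverges ℓ z (fun w => phiT (z 0 - w) * phiT (z 1 - w) * (α + β * xvar w)) ∧
    contourIntegral ℓ z (fun w => phiT (z 0 - w) * phiT (z 1 - w) * (α + β * xvar w)) =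
      ∫ x : ℝ, phiT (z 0 - (x + (ℓ + 2 * Real.pi : ℝ) * I)) *
        phiT (z 1 - (x + (ℓ + 2 * Real.pi : ℝ) * I)) *
          (α + β * xvar (x + (ℓ + 2 * Real.pi : ℝ) * I)) := by
  have hb := xvar_re_bounds hz
  have b0 := hb 0
  have b1 := hb 1
  have hpi := Real.two_pi_pos
  have hl' : (ℓ + 2 * Real.pi) / (2 * Real.pi) = ℓ / (2 * Real.pi) + 1 := by field_simp
  -- Replacing Γ(u) by Γ(1+u) = uΓ(u) in the first two factors cancels the encircled poles, leaving
  -- a numerator holomorphic in the closed strip. The line can rise by a full 2π before meeting z i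
  -- + 3πi/2, since Im z i > ℓ + π/2.
  set G := barnesIntegrand (1 - xvar (z 0)) (1 - xvar (z 1)) (xvar (z 0) + 3 / 4)
    (xvar (z 1) + 3 / 4) with hG
  have a1 : 0 < (1 - xvar (z 0)).re + ℓ / (2 * Real.pi) := by simp; linarith
  have a2 : 0 < (1 - xvar (z 1)).re + ℓ / (2 * Real.pi) := by simp; linarith
  have a3 : 0 < (xvar (z 0) + 3 / 4).re - (ℓ + 2 * Real.pi) / (2 * Real.pi) := by
    rw [hl', add_re]; norm_num; linarith
  have a4 : 0 < (xvar (z 1) + 3 / 4).re - (ℓ + 2 * Real.pi) / (2 * Real.pi) := by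
    rw [hl', add_re]; norm_num; linarith
  obtain ⟨M, hM0, hM⟩ := exists_barnesIntegrand_bound a1 a2 a3 a4 α β
  refine contourIntegral_pair_eq_line (ℓ' := ℓ + 2 * Real.pi)
    (g := fun w => (2 * Real.pi * I) ^ 2 * (G w * (α + β * xvar w)))
    (M := ‖(2 * Real.pi * I : ℂ) ^ 2‖ * M) h01
    (fun i => by linarith [(hz i).1, Real.pi_pos]) (fun i => (hz i).2) ?_ ?_ ?_ ?_ ?_
  · intro w h1 h2
    have hl1 : ℓ / (2 * Real.pi) ≤ (xvar w).re := by rw [xvar_re]; gcongr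
    have hl2 : (xvar w).re ≤ (ℓ + 2 * Real.pi) / (2 * Real.pi) := by rw [xvar_re]; gcongr
    have := differentiable_xvar w
    refine ((differentiableAt_barnesIntegrand ?_ ?_ ?_ ?_).mul ?_).const_mul _
    · rw [add_re]; linarith
    · rw [add_re]; linarith
    · rw [sub_re]; linarith
    · rw [sub_re]; linarith
    · exact (this.const_mul β).const_add α
  · intro w h1 h2
    rw [norm_mul]
    refine mul_le_mul_of_nonneg_left ((hM w h1 h2).trans ?_) (norm_nonneg _)
    exact div_le_self hM0 (by nlinarith [sq_nonneg ((1 - xvar (z 0)).im - w.re / (2 * Real.pi))])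
  · refine (integrable_barnesIntegrand a1 a2 ?_ ?_ α β).const_mul _
    · rw [hl'] at a3; linarith
    · rw [hl'] at a4; linarith
  · refine (integrable_barnesIntegrand ?_ ?_ a3 a4 α β).const_mul _
    · rw [hl']; linarith
    · rw [hl']; linarith
  · intro w h0 h1
    have n0 : w - z 0 ≠ 0 := sub_ne_zero.2 h0
    have n1 : w - z 1 ≠ 0 := sub_ne_zero.2 h1
    have u0 : -xvar (z 0) + xvar w ≠ 0 := fun h => h0 (xvar_injective (by linear_combination h))
    have u1 : -xvar (z 1) + xvar w ≠ 0 := fun h => h1 (xvar_injective (by linear_combination h))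
    have e0 : w - z 0 = 2 * Real.pi * I * (-xvar (z 0) + xvar w) := by
      rw [mul_add, mul_neg, mul_xvar, mul_xvar]; ring
    have e1 : w - z 1 = 2 * Real.pi * I * (-xvar (z 1) + xvar w) := by
      rw [mul_add, mul_neg, mul_xvar, mul_xvar]; ring
    rw [phiT_mul_phiT_eq, hG, barnesIntegrand, barnesIntegrand, eq_div_iff (mul_ne_zero n0 n1),
      show 1 - xvar (z 0) + xvar w = 1 + (-xvar (z 0) + xvar w) by ring,
      show 1 - xvar (z 1) + xvar w = 1 + (-xvar (z 1) + xvar w) by ring,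
      Gamma_one_add u0, Gamma_one_add u1, e0, e1]
    ring

/-- Integrands of the second level without poles at `z`. -/
theorem contourIntegral_barnesIntegrand {a b c d : ℂ} (ha : 0 < a.re + ℓ / (2 * Real.pi))
    (hb : 0 < b.re + ℓ / (2 * Real.pi)) (hc : 0 < c.re - ℓ / (2 * Real.pi))
    (hd : 0 < d.re - ℓ / (2 * Real.pi))
    (hz : ∀ i, AnalyticAt ℂ (barnesIntegrand a b c d) (z i)) :
    ContourConverges ℓ z (barnesIntegrand a b c d) ∧
      contourIntegral ℓ z (barnesIntegrand a b c d) = (2 * Real.pi) ^ 2 *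
      (Gamma (a + c) * Gamma (a + d) * Gamma (b + c) * Gamma (b + d) /
        Gamma (a + b + c + d)) := by
  have hr : ∀ i, HasResidueAt (barnesIntegrand a b c d) (z i) 0 := fun i =>
    HasResidueAt.of_analyticAt (hz i) (Eventually.of_forall fun _ => rfl)
  refine ⟨⟨?_, fun i => ⟨0, hr i⟩⟩, ?_⟩
  · have := integrable_barnesIntegrand ha hb hc hd 1 0
    simpa using this
  · rw [contourIntegral_eq hr, integral_barnesIntegrand ha hb hc hd]
    simp

theorem analyticAt_Gamma {w : ℂ} (hw : ∀ m : ℕ, w ≠ -m) : AnalyticAt ℂ Gamma w := by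
  have := (Complex.differentiable_one_div_Gamma.analyticAt w).inv
    (inv_ne_zero (Complex.Gamma_ne_zero hw))
  have e : (fun s => (Gamma s)⁻¹)⁻¹ = Gamma := by ext s; simp
  rwa [e] at this

theorem ne_neg_nat_of_re {w : ℂ} (h : -1 < w.re) (h0 : w ≠ 0) (m : ℕ) : w ≠ -m := by
  rintro rfl
  rcases Nat.eq_zero_or_pos m with rfl | hm
  · simp at h0
  · have : (1 : ℝ) ≤ m := by exact_mod_cast hm
    simp at h; linarith

theorem analyticAt_barnesIntegrand {a b c d w : ℂ} (ha : ∀ m : ℕ, a + xvar w ≠ -m)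
    (hb : ∀ m : ℕ, b + xvar w ≠ -m) (hc : ∀ m : ℕ, c - xvar w ≠ -m)
    (hd : ∀ m : ℕ, d - xvar w ≠ -m) : AnalyticAt ℂ (barnesIntegrand a b c d) w := by
  have hx := differentiable_xvar.analyticAt w
  exact ((((analyticAt_Gamma ha).comp_of_eq (analyticAt_const.add hx) rfl).mul
    ((analyticAt_Gamma hb).comp_of_eq (analyticAt_const.add hx) rfl)).mul
    ((analyticAt_Gamma hc).comp_of_eq (analyticAt_const.sub hx) rfl)).mul
    ((analyticAt_Gamma hd).comp_of_eq (analyticAt_const.sub hx) rfl)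

/-- A partial fraction decomposition separates the two kinds of singularities. The first term is
singular at z 0 - iπ/2 but regular at both encircled points, so its contour is just the line at ℓ.
The second is regular at z 0 - iπ/2, and its contour can be moved up by 2π. -/
theorem K1Integrand_one_zero {B : Fin 2 → Fin 3} (h0 : B 0 = 1) (h1 : B 1 = 0) {w : ℂ}
    (w0 : w ≠ z 0) (w1 : w ≠ z 1) (v0 : z 0 - w ≠ Real.pi * I / 2)
    (v1 : z 1 - w ≠ Real.pi * I / 2) (hζ : xvar (z 0 - z 1) - 1 / 4 ≠ 0) :
    K1Integrand B z w = (xvar (z 0 - z 1) - 1 / 4)⁻¹ *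
      (barnesIntegrand (1 - xvar (z 0)) (1 - xvar (z 1)) (xvar (z 0) - 1 / 4)
        (xvar (z 1) + 3 / 4) w +
      phiT (z 0 - w) * phiT (z 1 - w) * (-xvar (z 1) - 1 / 4 + 1 * xvar w)) := by
  have hu : -xvar (z 0) + xvar w ≠ 0 := fun h => w0 (xvar_injective (by linear_combination h))
  have hv : -xvar (z 1) + xvar w ≠ 0 := fun h => w1 (xvar_injective (by linear_combination h))
  have hu4 : xvar (z 0) - 1 / 4 - xvar w ≠ 0 := fun h => v0 (xvar_injective (by
    rw [xvar_sub, xvar_pi_I_div_two]; linear_combination h))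
  rw [K1Integrand_eq B z v1, if_pos ⟨h0, h1⟩, phiT_mul_phiT_eq, cT_eq]
  simp only [barnesIntegrand]
  rw [show 1 - xvar (z 0) + xvar w = 1 + (-xvar (z 0) + xvar w) by ring,
    show 1 - xvar (z 1) + xvar w = 1 + (-xvar (z 1) + xvar w) by ring,
    Gamma_one_add hu, Gamma_one_add hv,
    show xvar (z 0) + 3 / 4 - xvar w = (xvar (z 0) - 1 / 4 - xvar w) + 1 by ring,
    Complex.Gamma_add_one _ hu4, xvar_sub, xvar_sub]
  rw [xvar_sub] at hζ
  rw [eq_inv_mul_iff_mul_eq₀ hζ, show xvar (z 0) - xvar w - 1 / 4 = xvar (z 0) - 1 / 4 - xvar w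
    by ring]
  generalize Gamma (xvar (z 0) - 1 / 4 - xvar w) = g₁
  generalize Gamma (-xvar (z 0) + xvar w) = g₂
  generalize Gamma (-xvar (z 1) + xvar w) = g₃
  generalize Gamma (xvar (z 1) + 3 / 4 - xvar w) = g₄
  generalize hp : xvar (z 0) - 1 / 4 - xvar w = p at *
  rw [show xvar (z 0) = p + 1 / 4 + xvar w by linear_combination hp]
  field_simp
  ring

/-- From b + c = b' + c' = 1 one has b c' = 1 - b b' - c. The product b b' turns φ̃φ̃ into a Barnes
integrand without poles at the encircled points. -/
theorem K1Integrand_zero_one {B B' : Fin 2 → Fin 3} (h0 : B 0 = 0) (h1 : B 1 = 1) (h0' : B' 0 = 1)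
    (h1' : B' 1 = 0) {w : ℂ}
    (w0 : w ≠ z 0) (w1 : w ≠ z 1) (v0 : z 0 - w ≠ Real.pi * I / 2)
    (v1 : z 1 - w ≠ Real.pi * I / 2) :
    K1Integrand B z w = phiT (z 0 - w) * phiT (z 1 - w) * (1 + 0 * xvar w) +
      (-1 * barnesIntegrand (1 - xvar (z 0)) (1 - xvar (z 1)) (xvar (z 0) - 1 / 4)
        (xvar (z 1) - 1 / 4) w + -1 * K1Integrand B' z w) := by
  have hu : -xvar (z 0) + xvar w ≠ 0 := fun h => w0 (xvar_injective (by linear_combination h))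
  have hv : -xvar (z 1) + xvar w ≠ 0 := fun h => w1 (xvar_injective (by linear_combination h))
  have hu4 : xvar (z 0) - 1 / 4 - xvar w ≠ 0 := fun h => v0 (xvar_injective (by
    rw [xvar_sub, xvar_pi_I_div_two]; linear_combination h))
  have hv4 : xvar (z 1) - 1 / 4 - xvar w ≠ 0 := fun h => v1 (xvar_injective (by
    rw [xvar_sub, xvar_pi_I_div_two]; linear_combination h))
  rw [K1Integrand_eq B z v1, K1Integrand_eq B' z v1, if_neg (by simp [h0]), if_pos ⟨h0, h1⟩,
    if_pos ⟨h0', h1'⟩, phiT_mul_phiT_eq, cT_eq, cT_eq, bT_eq]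
  simp only [barnesIntegrand]
  rw [show 1 - xvar (z 0) + xvar w = 1 + (-xvar (z 0) + xvar w) by ring,
    show 1 - xvar (z 1) + xvar w = 1 + (-xvar (z 1) + xvar w) by ring,
    Gamma_one_add hu, Gamma_one_add hv,
    show xvar (z 0) + 3 / 4 - xvar w = (xvar (z 0) - 1 / 4 - xvar w) + 1 by ring,
    Complex.Gamma_add_one _ hu4,
    show xvar (z 1) + 3 / 4 - xvar w = (xvar (z 1) - 1 / 4 - xvar w) + 1 by ring,
    Complex.Gamma_add_one _ hv4, xvar_sub, xvar_sub,
    show xvar (z 0) - xvar w - 1 / 4 = xvar (z 0) - 1 / 4 - xvar w by ring,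
    show xvar (z 1) - xvar w - 1 / 4 = xvar (z 1) - 1 / 4 - xvar w by ring]
  generalize Gamma (xvar (z 0) - 1 / 4 - xvar w) = g₁
  generalize Gamma (-xvar (z 0) + xvar w) = g₂
  generalize Gamma (-xvar (z 1) + xvar w) = g₃
  generalize Gamma (xvar (z 1) - 1 / 4 - xvar w) = g₄
  generalize hp : xvar (z 0) - 1 / 4 - xvar w = p at *
  generalize hq : xvar (z 1) - 1 / 4 - xvar w = q at *
  rw [show xvar (z 0) = p + 1 / 4 + xvar w by linear_combination hp,
    show xvar (z 1) = q + 1 / 4 + xvar w by linear_combination hq]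
  field_simp
  ring

/-- The value of the second level integral. -/
def K1Value (z₀ z₁ : ℂ) : ℂ :=
  (2 * Real.pi) ^ 2 * Gamma (3 / 4) ^ 2 / (2 * Gamma (3 / 2)) *
    (Gamma (3 / 4 - xvar (z₀ - z₁)) * Gamma (3 / 4 + xvar (z₀ - z₁)) / (xvar (z₀ - z₁) - 1 / 4))

/-- The configurations of `z` for which the contour of the second level is not pinched. -/
structure SecondLevelRegular (ℓ : ℝ) (z : Fin 2 → ℂ) : Prop where
  ne : z 0 ≠ z 1
  ne_pole : z 0 - z 1 ≠ Real.pi * I / 2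
  ne_pole' : z 1 - z 0 ≠ Real.pi * I / 2
  strip : ∀ i, ℓ + Real.pi / 2 < (z i).im ∧ (z i).im < ℓ + 2 * Real.pi

namespace SecondLevelRegular

theorem xvar_sub_ne (h : SecondLevelRegular ℓ z) : xvar (z 0 - z 1) - 1 / 4 ≠ 0 := fun h0 =>
  h.ne_pole (xvar_injective (by rw [xvar_pi_I_div_two]; linear_combination h0))

theorem xvar_sub_ne' (h : SecondLevelRegular ℓ z) : xvar (z 0 - z 1) + 1 / 4 ≠ 0 := fun h0 =>
  h.ne_pole' (xvar_injective (by
    rw [xvar_pi_I_div_two]; rw [xvar_sub] at *; linear_combination -h0))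

/-- The identities between integrands fail at most at four points. The strip condition keeps these
off the line of integration; the other conditions keep them away from the punctured neighbourhoods
of the encircled points. -/
theorem line_ae (h : SecondLevelRegular ℓ z) {f g : ℂ → ℂ}
    (hfg : ∀ w, w ≠ z 0 → w ≠ z 1 → z 0 - w ≠ Real.pi * I / 2 → z 1 - w ≠ Real.pi * I / 2 → g w = f w) : ∀ᵐ x : ℝ, g (x + ℓ * I) = f (x + ℓ * I) := by
  refine Eventually.of_forall fun x => hfg _ ?_ ?_ ?_ ?_
  · intro h0
    have := h.strip 0
    rw [← h0] at this; simp at this; linarith [Real.pi_pos]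
  · intro h0
    have := h.strip 1
    rw [← h0] at this; simp at this; linarith [Real.pi_pos]
  · intro h0
    have := h.strip 0
    have h1 := congrArg Complex.im h0
    simp at h1; linarith
  · intro h0
    have := h.strip 1
    have h1 := congrArg Complex.im h0
    simp at h1; linarith

theorem eventually_near (h : SecondLevelRegular ℓ z) {f g : ℂ → ℂ} (hfg : ∀ w, w ≠ z 0 → w ≠ z 1 →
    z 0 - w ≠ Real.pi * I / 2 → z 1 - w ≠ Real.pi * I / 2 → g w = f w) (i : Fin 2) :
    ∀ᶠ w in 𝓝[≠] z i, g w = f w := by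
  have hp : (Real.pi * I / 2 : ℂ) ≠ 0 := by simp [Real.pi_ne_zero]
  have key : ∀ j, ∀ᶠ w in 𝓝[≠] z i, w ≠ z j ∧ z j - w ≠ Real.pi * I / 2 := by
    intro j
    have h1 : ∀ᶠ w in 𝓝[≠] z i, w ≠ z j := by
      by_cases hij : z i = z j
      · rw [← hij]; exact self_mem_nhdsWithin
      · exact nhdsWithin_le_nhds (isOpen_compl_singleton.mem_nhds hij)
    have h2 : ∀ᶠ w in 𝓝 (z i), z j - w ≠ Real.pi * I / 2 := by
      have hc : ContinuousAt (fun w => z j - w) (z i) := by fun_prop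
      refine hc.eventually_ne ?_
      fin_cases i <;> fin_cases j
      · simpa using hp.symm
      · exact h.ne_pole'
      · exact h.ne_pole
      · simpa using hp.symm
    filter_upwards [h1, nhdsWithin_le_nhds h2] with w a b using ⟨a, b⟩
  filter_upwards [key 0, key 1] with w a b using hfg w a.1 b.1 a.2 b.2

/-- After the decomposition, the first piece is evaluated on the line at ℓ and the second on the
line at ℓ + 2π. Both are instances of the Barnes lemma, and the results combine with the functional
equation of Γ. -/
theorem K1_one_zero (h : SecondLevelRegular ℓ z) {B : Fin 2 → Fin 3} (h0 : B 0 = 1) (h1 : B 1 = 0) :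
    ContourConverges ℓ z (K1Integrand B z) ∧ K1 ℓ B z = K1Value (z 0) (z 1) := by
  have hb := xvar_re_bounds h.strip
  have b0 := hb 0
  have b1 := hb 1
  have hl' : (ℓ + 2 * Real.pi) / (2 * Real.pi) = ℓ / (2 * Real.pi) + 1 := by
    have := Real.pi_pos
    field_simp
  have hζ := h.xvar_sub_ne
  obtain ⟨cA, vA⟩ := contourIntegral_barnesIntegrand (ℓ := ℓ) (z := z) (a := 1 - xvar (z 0))
    (b := 1 - xvar (z 1)) (c := xvar (z 0) - 1 / 4) (d := xvar (z 1) + 3 / 4)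
    (by simp; linarith) (by simp; linarith) (by rw [sub_re]; norm_num; linarith)
    (by rw [add_re]; norm_num; linarith) (fun i => by
      have bi := hb i
      refine analyticAt_barnesIntegrand (ne_neg_nat_of_re ?_ ?_) (ne_neg_nat_of_re ?_ ?_)
        (ne_neg_nat_of_re ?_ ?_) (ne_neg_nat_of_re ?_ ?_)
      · simp; linarith
      · intro h0; have := congrArg Complex.re h0; simp at this; linarith
      · simp; linarith
      · intro h0; have := congrArg Complex.re h0; simp at this; linarith
      · simp only [sub_re]; norm_num; linarith
      · fin_cases i
        · intro h0; simp at h0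
        · intro h0; apply hζ; rw [xvar_sub]; simp only [Fin.mk_one] at h0; linear_combination h0
      · simp only [sub_re, add_re]; norm_num; linarith
      · intro h0; have := congrArg Complex.re h0; simp only [sub_re, add_re] at this
        norm_num at this; linarith)
  obtain ⟨cW, vW⟩ := contourIntegral_phiT_mul_affine h.ne h.strip (-xvar (z 1) - 1 / 4) 1
  have hfg := fun w w0 w1 v0 v1 => K1Integrand_one_zero (z := z) h0 h1 (w := w) w0 w1 v0 v1 hζ
  have hae := h.line_ae hfg
  have hev := h.eventually_near hfg
  have hc := (cA.add cW).const_mul (xvar (z 0 - z 1) - 1 / 4)⁻¹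
  refine ⟨hc.congr hae hev, ?_⟩
  rw [K1, contourIntegral_congr hae hev, contourIntegral_const_mul _ (cA.add cW),
    contourIntegral_add cA cW, vA, vW]
  have i1 := integral_barnesIntegrand (a := 1 - xvar (z 0)) (b := -xvar (z 1))
    (c := xvar (z 0) + 3 / 4) (d := xvar (z 1) + 3 / 4) (ℓ := ℓ + 2 * Real.pi)
    (by rw [hl']; simp; linarith) (by rw [hl']; simp; linarith)
    (by rw [hl', add_re]; norm_num; linarith) (by rw [hl', add_re]; norm_num; linarith)
  have j1 := integrable_barnesIntegrand (a := 1 - xvar (z 0)) (b := -xvar (z 1))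
    (c := xvar (z 0) + 3 / 4) (d := xvar (z 1) + 3 / 4) (ℓ := ℓ + 2 * Real.pi)
    (by rw [hl']; simp; linarith) (by rw [hl']; simp; linarith)
    (by rw [hl', add_re]; norm_num; linarith) (by rw [hl', add_re]; norm_num; linarith) 1 0
  have i2 := integral_barnesIntegrand (a := -xvar (z 0)) (b := -xvar (z 1))
    (c := xvar (z 0) + 3 / 4) (d := xvar (z 1) + 3 / 4) (ℓ := ℓ + 2 * Real.pi)
    (by rw [hl']; simp; linarith) (by rw [hl']; simp; linarith)
    (by rw [hl', add_re]; norm_num; linarith) (by rw [hl', add_re]; norm_num; linarith)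
  have j2 := integrable_barnesIntegrand (a := -xvar (z 0)) (b := -xvar (z 1))
    (c := xvar (z 0) + 3 / 4) (d := xvar (z 1) + 3 / 4) (ℓ := ℓ + 2 * Real.pi)
    (by rw [hl']; simp; linarith) (by rw [hl']; simp; linarith)
    (by rw [hl', add_re]; norm_num; linarith) (by rw [hl', add_re]; norm_num; linarith) 1 0
  simp only [zero_mul, add_zero, mul_one] at j1 j2
  -- The affine factor is rewritten as (x_w - x₀) + (x₀ - x₁ - 1/4); its first part raises a
  -- parameter of the Barnes integrand by one, its second is constant.
  have e : ∀ x : ℝ, phiT (z 0 - (x + (ℓ + 2 * Real.pi : ℝ) * I)) *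
        phiT (z 1 - (x + (ℓ + 2 * Real.pi : ℝ) * I)) *
          (-xvar (z 1) - 1 / 4 + 1 * xvar (x + (ℓ + 2 * Real.pi : ℝ) * I)) =
      barnesIntegrand (1 - xvar (z 0)) (-xvar (z 1)) (xvar (z 0) + 3 / 4) (xvar (z 1) + 3 / 4)
        (x + (ℓ + 2 * Real.pi : ℝ) * I) + (xvar (z 0 - z 1) - 1 / 4) *
      barnesIntegrand (-xvar (z 0)) (-xvar (z 1)) (xvar (z 0) + 3 / 4) (xvar (z 1) + 3 / 4)
        (x + (ℓ + 2 * Real.pi : ℝ) * I) := fun x => by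
    have hu : -xvar (z 0) + xvar (x + (ℓ + 2 * Real.pi : ℝ) * I) ≠ 0 := fun h0 => by
      have := congrArg Complex.re h0
      rw [add_re, xvar_re, add_im, ofReal_im, im_ofReal_mul, I_im, mul_one, zero_add, hl'] at this
      simp at this; linarith
    rw [phiT_mul_phiT_eq, xvar_sub]
    simp only [barnesIntegrand]
    rw [show 1 - xvar (z 0) + xvar (x + (ℓ + 2 * Real.pi : ℝ) * I) =
      1 + (-xvar (z 0) + xvar (x + (ℓ + 2 * Real.pi : ℝ) * I)) by ring, Gamma_one_add hu]
    ring
  simp only [e]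
  rw [integral_add j1 (j2.const_mul _), integral_const_mul, i1, i2]
  have hr := (abs_lt.2 ⟨by linarith, by linarith⟩ :
    |(xvar (z 0)).re - (xvar (z 1)).re| < 3 / 4)
  have g1 : Gamma (7 / 4 - xvar (z 0 - z 1)) =
      (3 / 4 - xvar (z 0 - z 1)) * Gamma (3 / 4 - xvar (z 0 - z 1)) := by
    rw [show 7 / 4 - xvar (z 0 - z 1) = (3 / 4 - xvar (z 0 - z 1)) + 1 by ring,
      Complex.Gamma_add_one]
    intro h0
    have := congrArg Complex.re h0
    rw [xvar_sub, sub_re, sub_re] at this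
    norm_num at this
    linarith [(abs_lt.1 hr).2]
  have g2 : Gamma (7 / 4) = 3 / 4 * Gamma (3 / 4) := by
    rw [← Complex.Gamma_add_one _ (by norm_num)]; norm_num
  have g3 : Gamma (5 / 2) = 3 / 2 * Gamma (3 / 2) := by
    rw [← Complex.Gamma_add_one _ (by norm_num)]; norm_num
  have g4 : Gamma (3 / 2 : ℂ) ≠ 0 := Complex.Gamma_ne_zero_of_re_pos (by norm_num)
  rw [K1Value]
  have s1 : 1 - xvar (z 0) + (xvar (z 0) - 1 / 4) = 3 / 4 := by ring
  have s2 : 1 - xvar (z 0) + (xvar (z 1) + 3 / 4) = 7 / 4 - xvar (z 0 - z 1) := by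
    rw [xvar_sub]; ring
  have s3 : 1 - xvar (z 1) + (xvar (z 0) - 1 / 4) = 3 / 4 + xvar (z 0 - z 1) := by
    rw [xvar_sub]; ring
  have s4 : 1 - xvar (z 1) + (xvar (z 1) + 3 / 4) = 7 / 4 := by ring
  have s5 : 1 - xvar (z 0) + (1 - xvar (z 1)) + (xvar (z 0) - 1 / 4) + (xvar (z 1) + 3 / 4) =
    5 / 2 := by ring
  have s6 : 1 - xvar (z 0) + (xvar (z 0) + 3 / 4) = 7 / 4 := by ring
  have s7 : -xvar (z 1) + (xvar (z 0) + 3 / 4) = 3 / 4 + xvar (z 0 - z 1) := by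
    rw [xvar_sub]; ring
  have s8 : -xvar (z 1) + (xvar (z 1) + 3 / 4) = 3 / 4 := by ring
  have s9 : 1 - xvar (z 0) + -xvar (z 1) + (xvar (z 0) + 3 / 4) + (xvar (z 1) + 3 / 4) =
    5 / 2 := by ring
  have s10 : -xvar (z 0) + (xvar (z 0) + 3 / 4) = 3 / 4 := by ring
  have s11 : -xvar (z 0) + (xvar (z 1) + 3 / 4) = 3 / 4 - xvar (z 0 - z 1) := by
    rw [xvar_sub]; ring
  have s12 : -xvar (z 0) + -xvar (z 1) + (xvar (z 0) + 3 / 4) + (xvar (z 1) + 3 / 4) =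
    3 / 2 := by ring
  rw [s1, s2, s3, s4, s5, s6, s7, s8, s9, s10, s11, s12, g1, g2, g3]
  field_simp
  ring

/-- The integrals of φ̃φ̃ and of b b' φ̃φ̃ coincide: in both, the four pairwise parameter sums in
the Barnes lemma agree up to order. They cancel, and only minus the other component remains. -/
theorem K1_zero_one (h : SecondLevelRegular ℓ z) {B : Fin 2 → Fin 3} (h0 : B 0 = 0) (h1 : B 1 = 1) :
    ContourConverges ℓ z (K1Integrand B z) ∧ K1 ℓ B z = -K1Value (z 0) (z 1) := by
  have hb := xvar_re_bounds h.strip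
  have b0 := hb 0
  have b1 := hb 1
  have hl' : (ℓ + 2 * Real.pi) / (2 * Real.pi) = ℓ / (2 * Real.pi) + 1 := by
    have := Real.pi_pos
    field_simp
  have hζ := h.xvar_sub_ne
  have hζ' := h.xvar_sub_ne'
  obtain ⟨cA, vA⟩ := contourIntegral_barnesIntegrand (ℓ := ℓ) (z := z) (a := 1 - xvar (z 0))
    (b := 1 - xvar (z 1)) (c := xvar (z 0) - 1 / 4) (d := xvar (z 1) - 1 / 4)
    (by simp; linarith) (by simp; linarith) (by rw [sub_re]; norm_num; linarith)
    (by rw [sub_re]; norm_num; linarith) (fun i => by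
      have bi := hb i
      refine analyticAt_barnesIntegrand (ne_neg_nat_of_re ?_ ?_) (ne_neg_nat_of_re ?_ ?_)
        (ne_neg_nat_of_re ?_ ?_) (ne_neg_nat_of_re ?_ ?_)
      · simp; linarith
      · intro h0; have := congrArg Complex.re h0; simp at this; linarith
      · simp; linarith
      · intro h0; have := congrArg Complex.re h0; simp at this; linarith
      · simp only [sub_re]; norm_num; linarith
      · fin_cases i
        · intro h0; simp at h0
        · intro h0; apply hζ; rw [xvar_sub]; simp only [Fin.mk_one] at h0; linear_combination h0
      · simp only [sub_re]; norm_num; linarith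
      · fin_cases i
        · intro h0; apply hζ'; rw [xvar_sub]; simp only [Fin.zero_eta] at h0
          linear_combination -h0
        · intro h0; simp at h0)
  obtain ⟨cW, vW⟩ := contourIntegral_phiT_mul_affine h.ne h.strip 1 0
  obtain ⟨cK, vK⟩ := h.K1_one_zero (B := ![1, 0]) rfl rfl
  have hfg := fun w w0 w1 v0 v1 => K1Integrand_zero_one (z := z) (B' := ![1, 0]) h0 h1 rfl rfl
    (w := w) w0 w1 v0 v1
  have hae := h.line_ae hfg
  have hev := h.eventually_near hfg
  have hc := cW.add ((cA.const_mul (-1)).add (cK.const_mul (-1)))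
  refine ⟨hc.congr hae hev, ?_⟩
  rw [K1] at vK
  rw [K1, contourIntegral_congr hae hev, contourIntegral_add cW ((cA.const_mul (-1)).add
    (cK.const_mul (-1))), contourIntegral_add (cA.const_mul (-1)) (cK.const_mul (-1)),
    contourIntegral_const_mul _ cA, contourIntegral_const_mul _ cK, vA, vW, vK]
  have i2 := integral_barnesIntegrand (a := -xvar (z 0)) (b := -xvar (z 1))
    (c := xvar (z 0) + 3 / 4) (d := xvar (z 1) + 3 / 4) (ℓ := ℓ + 2 * Real.pi)
    (by rw [hl']; simp; linarith) (by rw [hl']; simp; linarith)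
    (by rw [hl', add_re]; norm_num; linarith) (by rw [hl', add_re]; norm_num; linarith)
  simp only [zero_mul, add_zero, mul_one, phiT_mul_phiT_eq]
  rw [i2]
  ring_nf

theorem K1_contourConverges (h : SecondLevelRegular ℓ z) (B : Fin 2 → Fin 3) : ContourConverges ℓ z (K1Integrand B z) := by
  by_cases h1 : B 0 = 1 ∧ B 1 = 0
  · exact (h.K1_one_zero h1.1 h1.2).1
  by_cases h2 : B 0 = 0 ∧ B 1 = 1
  · exact (h.K1_zero_one h2.1 h2.2).1
  have hfg : ∀ w, w ≠ z 0 → w ≠ z 1 → z 0 - w ≠ Real.pi * I / 2 → z 1 - w ≠ Real.pi * I / 2 →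
      K1Integrand B z w = 0 := fun w _ _ _ v1 => by
    rw [K1Integrand_eq B z v1, if_neg h1, if_neg h2, mul_zero]
  refine ContourConverges.congr (f := fun _ => 0) ⟨integrable_zero _ _ _, fun i => ⟨0, ?_⟩⟩
    (h.line_ae hfg) (h.eventually_near hfg)
  exact HasResidueAt.of_analyticAt (g := fun _ => 0) analyticAt_const
    (Eventually.of_forall fun _ => rfl)

theorem K1_eq (h : SecondLevelRegular ℓ z) (B : Fin 2 → Fin 3) : K1 ℓ B z = K1Value (z 0) (z 1) *
    ((if B = ![1, 0] then 1 else 0) - if B = ![0, 1] then 1 else 0) := by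
  have hB : ∀ a b, B = ![a, b] ↔ B 0 = a ∧ B 1 = b := fun a b => by
    constructor
    · rintro rfl; simp
    · rintro ⟨rfl, rfl⟩; ext i; fin_cases i <;> rfl
  by_cases h1 : B 0 = 1 ∧ B 1 = 0
  · rw [(h.K1_one_zero h1.1 h1.2).2, if_pos ((hB _ _).2 h1), if_neg]
    · ring
    · rw [hB, h1.1]; simp
  by_cases h2 : B 0 = 0 ∧ B 1 = 1
  · rw [(h.K1_zero_one h2.1 h2.2).2, if_pos ((hB _ _).2 h2), if_neg]
    · ring
    · rw [hB, h2.1]; simp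
  have hfg : ∀ w, w ≠ z 0 → w ≠ z 1 → z 0 - w ≠ Real.pi * I / 2 → z 1 - w ≠ Real.pi * I / 2 →
      K1Integrand B z w = 0 := fun w _ _ _ v1 => by
    rw [K1Integrand_eq B z v1, if_neg h1, if_neg h2, mul_zero]
  rw [K1, contourIntegral_congr (f := fun _ => 0) (h.line_ae hfg) (h.eventually_near hfg),
    if_neg (by rwa [hB]), if_neg (by rwa [hB]), contourIntegral_eq (ρ := fun _ => 0)]
  · simp
  · exact fun i => HasResidueAt.of_analyticAt (g := fun _ => 0) analyticAt_const
      (Eventually.of_forall fun _ => rfl)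

end SecondLevelRegular

end SecondLevel

/-! ### The Bethe ansatz co-vectors with one and two magnons -/

/-- The wave function of one magnon at site `p`. -/
def magnon {n : ℕ} (θ : Fin n → ℂ) (z : ℂ) (p : Fin n) : ℂ :=
  (∏ i, if i < p then bT (θ i - z) else 1) * cT (θ p - z)

theorem magnon_zero {n : ℕ} (θ : Fin (n + 1) → ℂ) (z : ℂ) : magnon θ z 0 = cT (θ 0 - z) := by
  simp [magnon]

theorem magnon_succ {n : ℕ} (θ : Fin (n + 1) → ℂ) (z : ℂ) (p : Fin n) :
    magnon θ z p.succ = bT (θ 0 - z) * magnon (Fin.tail θ) z p := by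
  simp [magnon, Fin.prod_univ_succ, Fin.tail, mul_assoc]

section Covector

variable {q : ℕ} [NeZero q]

/-- The configuration with colour `l` at the site `p` and `0` at all other sites. -/
def IsSingle {n : ℕ} (A : Fin n → Fin q) (l : Fin q) (p : Fin n) : Prop :=
  A p = l ∧ ∀ i, i ≠ p → A i = 0

/-- The configuration with colours `a`, `b` at the sites `p`, `p'` and `0` at all other sites. -/
def IsPair {n : ℕ} (A : Fin n → Fin q) (a b : Fin q) (p p' : Fin n) : Prop :=
  A p = a ∧ A p' = b ∧ ∀ i, i ≠ p → i ≠ p' → A i = 0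

instance {n : ℕ} (A : Fin n → Fin q) (l : Fin q) (p : Fin n) : Decidable (IsSingle A l p) :=
  inferInstanceAs (Decidable (_ ∧ _))

instance {n : ℕ} (A : Fin n → Fin q) (a b : Fin q) (p p' : Fin n) :
    Decidable (IsPair A a b p p') := inferInstanceAs (Decidable (_ ∧ _))

/-- The one-magnon co-vector. -/
def oneMagnon {n : ℕ} (θ : Fin n → ℂ) (z : ℂ) (l : Fin q) (A : Fin n → Fin q) : ℂ :=
  ∑ p, if IsSingle A l p then magnon θ z p else 0

/-- The antisymmetric two-magnon co-vector. -/
def twoMagnon {n : ℕ} (θ : Fin n → ℂ) (z z' : ℂ) (a b : Fin q) (A : Fin n → Fin q) : ℂ :=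
  ∑ p, ∑ p', if IsPair A a b p p' then
    magnon θ z p * magnon θ z' p' - magnon θ z p' * magnon θ z' p else 0

theorem isSingle_zero_iff {n : ℕ} (A : Fin (n + 1) → Fin q) (l : Fin q) :
    IsSingle A l 0 ↔ A 0 = l ∧ Fin.tail A = 0 := by
  simp [IsSingle, Fin.forall_fin_succ, funext_iff, Fin.tail]

theorem isSingle_succ_iff {n : ℕ} (A : Fin (n + 1) → Fin q) (l : Fin q) (p : Fin n) :
    IsSingle A l p.succ ↔ A 0 = 0 ∧ IsSingle (Fin.tail A) l p := by
  simp [IsSingle, Fin.forall_fin_succ, Fin.tail, (Fin.succ_ne_zero _).symm]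
  tauto

theorem isPair_zero_succ_iff {n : ℕ} (A : Fin (n + 1) → Fin q) (a b : Fin q) (p : Fin n) :
    IsPair A a b 0 p.succ ↔ A 0 = a ∧ IsSingle (Fin.tail A) b p := by
  simp [IsPair, IsSingle, Fin.forall_fin_succ, Fin.tail]

theorem isPair_succ_zero_iff {n : ℕ} (A : Fin (n + 1) → Fin q) (a b : Fin q) (p : Fin n) :
    IsPair A a b p.succ 0 ↔ A 0 = b ∧ IsSingle (Fin.tail A) a p := by
  simp [IsPair, IsSingle, Fin.forall_fin_succ, Fin.tail]
  tauto

theorem isPair_succ_succ_iff {n : ℕ} (A : Fin (n + 1) → Fin q) (a b : Fin q) (p p' : Fin n) :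
    IsPair A a b p.succ p'.succ ↔ A 0 = 0 ∧ IsPair (Fin.tail A) a b p p' := by
  simp [IsPair, Fin.forall_fin_succ, Fin.tail, (Fin.succ_ne_zero _).symm]
  tauto

theorem oneMagnon_succ {n : ℕ} (θ : Fin (n + 1) → ℂ) (z : ℂ) (l : Fin q)
    (A : Fin (n + 1) → Fin q) : oneMagnon θ z l A =
      (if A 0 = l ∧ Fin.tail A = 0 then cT (θ 0 - z) else 0) +
        if A 0 = 0 then bT (θ 0 - z) * oneMagnon (Fin.tail θ) z l (Fin.tail A) else 0 := by
  rw [oneMagnon, Fin.sum_univ_succ]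
  simp only [isSingle_zero_iff, isSingle_succ_iff, magnon_zero, magnon_succ, oneMagnon,
    Finset.mul_sum]
  congr 1
  by_cases h : A 0 = 0 <;> simp [h]

theorem twoMagnon_succ {n : ℕ} (θ : Fin (n + 1) → ℂ) (z z' : ℂ) {a b : Fin q} (hab : a ≠ b)
    (A : Fin (n + 1) → Fin q) : twoMagnon θ z z' a b A =
      (if A 0 = a then cT (θ 0 - z) * bT (θ 0 - z') * oneMagnon (Fin.tail θ) z' b (Fin.tail A) -
        bT (θ 0 - z) * cT (θ 0 - z') * oneMagnon (Fin.tail θ) z b (Fin.tail A) else 0) +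
      (if A 0 = b then bT (θ 0 - z) * cT (θ 0 - z') * oneMagnon (Fin.tail θ) z a (Fin.tail A) -
        cT (θ 0 - z) * bT (θ 0 - z') * oneMagnon (Fin.tail θ) z' a (Fin.tail A) else 0) +
      (if A 0 = 0 then bT (θ 0 - z) * bT (θ 0 - z') *
        twoMagnon (Fin.tail θ) z z' a b (Fin.tail A) else 0) := by
  have h00 : ¬IsPair A a b 0 0 := fun h => hab (h.1.symm.trans h.2.1)
  rw [twoMagnon, Fin.sum_univ_succ]
  simp only [Fin.sum_univ_succ, if_neg h00, isPair_zero_succ_iff, isPair_succ_zero_iff,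
    isPair_succ_succ_iff, magnon_zero, magnon_succ, oneMagnon, twoMagnon, Finset.mul_sum,
    zero_add, Finset.sum_add_distrib, ← Finset.sum_sub_distrib]
  rw [add_assoc]
  refine congrArg₂ _ ?_ (congrArg₂ _ ?_ ?_)
  · by_cases h : A 0 = a
    · simp only [h, true_and, if_true]
      exact Finset.sum_congr rfl fun p _ => by split_ifs <;> ring
    · simp [h]
  · by_cases h : A 0 = b
    · simp only [h, true_and, if_true]
      exact Finset.sum_congr rfl fun p _ => by split_ifs <;> ring
    · simp [h]
  · by_cases h : A 0 = 0
    · simp only [h, true_and, if_true]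
      exact Finset.sum_congr rfl fun p _ => Finset.sum_congr rfl fun p' _ => by
        split_ifs <;> ring
    · simp [h]

theorem bT_add_cT {w : ℂ} (hw : w ≠ Real.pi * I / 2) : bT w + cT w = 1 := by
  rw [bT, cT, ← add_div, ← sub_eq_add_neg, div_self (sub_ne_zero.2 hw)]

theorem sum_STilde_mul (w : ℂ) (A l c : Fin q) (f : Fin q → ℂ) :
    ∑ k, STilde w A k l c * f k =
      (if A = c then bT w * f l else 0) + if A = l then cT w * f c else 0 := by
  simp only [STilde, add_mul, Finset.sum_add_distrib, ite_mul, zero_mul]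
  congr 1
  · by_cases h : A = c <;> simp [h]
  · by_cases h : A = l <;> simp [h]

theorem monodromy_zero_zero {n : ℕ} (θ : Fin n → ℂ) (z : ℂ)
    (hz : ∀ i, θ i - z ≠ Real.pi * I / 2) (A : Fin n → Fin q) :
    monodromy θ z A 0 0 0 = if A = 0 then 1 else 0 := by
  induction n with
  | zero => simp [monodromy, Subsingleton.elim A 0]
  | succ n ih =>
    rw [monodromy, sum_STilde_mul]
    have ht : Fin.tail (0 : Fin (n + 1) → Fin q) = 0 := rfl
    rw [ht, Pi.zero_apply, ih (Fin.tail θ) (fun i => hz i.succ) (Fin.tail A)]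
    have hA : A = 0 ↔ A 0 = 0 ∧ Fin.tail A = 0 := by
      simp [funext_iff, Fin.forall_fin_succ, Fin.tail]
    by_cases h0 : A 0 = 0
    · rw [if_pos h0, if_pos h0, ← add_mul, bT_add_cT (hz 0), one_mul]
      simp [hA, h0]
    · simp [hA, h0]

/-- Following the horizontal line from the left, the colour l passes sites with weight b̃ until it
is deposited with weight c̃. From there on the line carries the reference colour and contributes 1.
-/
theorem monodromy_oneMagnon {n : ℕ} (θ : Fin n → ℂ) (z : ℂ)
    (hz : ∀ i, θ i - z ≠ Real.pi * I / 2) {l : Fin q} (hl : l ≠ 0) (A : Fin n → Fin q) :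
    monodromy θ z A 0 l 0 = oneMagnon θ z l A := by
  induction n with
  | zero => simp [monodromy, oneMagnon, hl]
  | succ n ih =>
    have ht : Fin.tail (0 : Fin (n + 1) → Fin q) = 0 := rfl
    rw [monodromy, sum_STilde_mul, ht, Pi.zero_apply, oneMagnon_succ,
      ih (Fin.tail θ) (fun i => hz i.succ) (Fin.tail A),
      monodromy_zero_zero (Fin.tail θ) z (fun i => hz i.succ), add_comm]
    congr 1
    by_cases h : A 0 = l <;> simp [h]

/-- The product of two elements of the monodromy matrix, applied to the reference co-vector. -/
def doubleMonodromy {n : ℕ} (θ : Fin n → ℂ) (z z' : ℂ) (l l' : Fin q) (A : Fin n → Fin q) : ℂ :=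
  ∑ A', monodromy θ z A A' l 0 * monodromy θ z' A' 0 l' 0

theorem bethe_two {n : ℕ} (θ : Fin n → ℂ) (z : Fin 2 → ℂ) (B : Fin 2 → Fin q)
    (A : Fin n → Fin q) : bethe θ z B A = doubleMonodromy θ (z 0) (z 1) (B 0) (B 1) A := by
  simp [bethe, doubleMonodromy, Fin.tail]

theorem sum_ite_add_mul {A l l' : Fin q} (x c u v : ℂ) (P : Fin q → ℂ) :
    ∑ a, ((if A = a then x else 0) + if A = l then c * P a else 0) *
        ((if a = 0 then u else 0) + if a = l' then v else 0) =
      (if A = 0 then x * u else 0) + (if A = l' then x * v else 0) +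
        if A = l then c * (P 0 * u + P l' * v) else 0 := by
  by_cases h : A = l <;>
    simp [h, mul_add, add_mul, Finset.sum_add_distrib, ite_mul, mul_ite, mul_assoc]
  all_goals grind

/-- The first vertical line is split off and the sum over its intermediate colour is carried out,
giving a recursion in the number of sites. -/
theorem doubleMonodromy_succ {n : ℕ} (θ : Fin (n + 1) → ℂ) (z z' : ℂ) (l l' : Fin q)
    (A : Fin (n + 1) → Fin q) : doubleMonodromy θ z z' l l' A =
      bT (θ 0 - z) * ((if A 0 = 0 then bT (θ 0 - z') *
          doubleMonodromy (Fin.tail θ) z z' l l' (Fin.tail A) else 0) +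
        if A 0 = l' then cT (θ 0 - z') *
          doubleMonodromy (Fin.tail θ) z z' l 0 (Fin.tail A) else 0) +
      if A 0 = l then cT (θ 0 - z) * (bT (θ 0 - z') *
          doubleMonodromy (Fin.tail θ) z z' 0 l' (Fin.tail A) +
        cT (θ 0 - z') * doubleMonodromy (Fin.tail θ) z z' l' 0 (Fin.tail A)) else 0 := by
  have ht : Fin.tail (0 : Fin (n + 1) → Fin q) = 0 := rfl
  have hc (a : Fin q) (x : Fin n → Fin q) :
      Fin.tail ((Fin.consEquiv fun _ => Fin q) (a, x)) = x := rfl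
  rw [doubleMonodromy, ← (Fin.consEquiv fun _ => Fin q).sum_comp, Fintype.sum_prod_type,
    Finset.sum_comm]
  simp only [monodromy, Fin.consEquiv_apply, Fin.cons_zero, hc, sum_STilde_mul, ht,
    Pi.zero_apply, doubleMonodromy, sum_ite_add_mul]
  split_ifs <;>
    simp only [Finset.mul_sum, ← Finset.sum_add_distrib, add_zero, zero_add, mul_zero,
      Finset.sum_const_zero] <;>
    exact Finset.sum_congr rfl fun x _ => by ring

theorem doubleMonodromy_zero_right {n : ℕ} (θ : Fin n → ℂ) (z z' : ℂ)
    (hz : ∀ i, θ i - z ≠ Real.pi * I / 2) (hz' : ∀ i, θ i - z' ≠ Real.pi * I / 2) {l : Fin q}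
    (hl : l ≠ 0) (A : Fin n → Fin q) : doubleMonodromy θ z z' l 0 A = oneMagnon θ z l A := by
  simp only [doubleMonodromy, monodromy_zero_zero θ z' hz', mul_ite, mul_one, mul_zero]
  simp [monodromy_oneMagnon θ z hz hl]

theorem doubleMonodromy_zero_zero {n : ℕ} (θ : Fin n → ℂ) (z z' : ℂ)
    (hz : ∀ i, θ i - z ≠ Real.pi * I / 2) (hz' : ∀ i, θ i - z' ≠ Real.pi * I / 2)
    (A : Fin n → Fin q) : doubleMonodromy θ z z' 0 0 A = if A = 0 then 1 else 0 := by
  simp only [doubleMonodromy, monodromy_zero_zero θ z' hz', mul_ite, mul_one, mul_zero]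
  simp [monodromy_zero_zero θ z hz]

theorem xvar_sub_ne_quarter {w : ℂ} (hw : w ≠ Real.pi * I / 2) : xvar w - 1 / 4 ≠ 0 := by
  rw [sub_ne_zero, ← xvar_pi_I_div_two]
  exact fun h => hw (xvar_injective h)

/-- This is the exchange of a diagonal with a creation element of the monodromy matrix on the
reference co-vector, with the wanted term at z' and the unwanted term at z. The recursion in the
number of sites closes on the combination, so induction replaces the Yang-Baxter equation. -/
theorem doubleMonodromy_zero_left {n : ℕ} (θ : Fin n → ℂ) {z z' : ℂ} (hzz : z ≠ z')
    (hz : ∀ i, θ i - z ≠ Real.pi * I / 2) (hz' : ∀ i, θ i - z' ≠ Real.pi * I / 2) {l : Fin q}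
    (hl : l ≠ 0) (A : Fin n → Fin q) : doubleMonodromy θ z z' 0 l A =
      (1 - 1 / (4 * xvar (z - z'))) * oneMagnon θ z' l A +
        1 / (4 * xvar (z - z')) * oneMagnon θ z l A := by
  have hζ : xvar (z - z') ≠ 0 := by
    rw [xvar_sub, sub_ne_zero]; exact fun h => hzz (xvar_injective h)
  induction n with
  | zero => simp [doubleMonodromy, monodromy, oneMagnon, hl]
  | succ n ih =>
    have h1 := xvar_sub_ne_quarter (hz 0)
    have h2 := xvar_sub_ne_quarter (hz' 0)
    have h3 : xvar (z - z') = xvar (θ 0 - z') - xvar (θ 0 - z) := by simp only [xvar_sub]; ring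
    rw [doubleMonodromy_succ, oneMagnon_succ, oneMagnon_succ,
      ih (Fin.tail θ) (fun i => hz i.succ) (fun i => hz' i.succ),
      doubleMonodromy_zero_right (Fin.tail θ) z z' (fun i => hz i.succ) (fun i => hz' i.succ) hl,
      doubleMonodromy_zero_zero (Fin.tail θ) z z' (fun i => hz i.succ) (fun i => hz' i.succ)]
    simp only [bT_eq, cT_eq]
    generalize oneMagnon (Fin.tail θ) z l (Fin.tail A) = o
    generalize oneMagnon (Fin.tail θ) z' l (Fin.tail A) = o'
    rw [h3] at hζ ⊢
    clear h3
    generalize xvar (θ 0 - z') = d' at *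
    generalize xvar (θ 0 - z) = d at *
    -- In the variable x - 1/4 the denominators of b̃ and c̃ are monomials, which keeps the field
    -- identity small.
    obtain ⟨u, rfl⟩ : ∃ u, d = u + 1 / 4 := ⟨d - 1 / 4, by ring⟩
    obtain ⟨u', rfl⟩ : ∃ u, d' = u + 1 / 4 := ⟨d' - 1 / 4, by ring⟩
    simp only [add_sub_add_right_eq_sub, add_sub_cancel_right] at *
    by_cases hA : A 0 = 0
    · simp only [hA, hl.symm, if_true, if_false, false_and, zero_add, add_zero]
      field_simp
      ring
    · by_cases hA' : A 0 = l
      · by_cases ht : Fin.tail A = 0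
        · simp only [hA', hl, ht, if_true, if_false, and_self, zero_add, add_zero]
          field_simp
          ring
        · simp [hA', hl, ht]
      · simp [hA, hA']

/-- Antisymmetry in the colours makes the two magnons behave like free fermions: apart from one
scalar factor, the co-vector is a Slater determinant of one-magnon wave functions. The induction on
the sites uses the exchange relation wherever the first site carries a or b. -/
theorem doubleMonodromy_sub {n : ℕ} (θ : Fin n → ℂ) {z z' : ℂ} (hzz : z ≠ z')
    (hz : ∀ i, θ i - z ≠ Real.pi * I / 2) (hz' : ∀ i, θ i - z' ≠ Real.pi * I / 2) {a b : Fin q}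
    (ha : a ≠ 0) (hb : b ≠ 0) (hab : a ≠ b) (A : Fin n → Fin q) :
    doubleMonodromy θ z z' a b A - doubleMonodromy θ z z' b a A =
      (xvar (z - z') - 1 / 4) / xvar (z - z') * twoMagnon θ z z' a b A := by
  have hζ : xvar (z - z') ≠ 0 := by
    rw [xvar_sub, sub_ne_zero]; exact fun h => hzz (xvar_injective h)
  induction n with
  | zero => simp [doubleMonodromy, monodromy, twoMagnon, ha, hb]
  | succ n ih =>
    have h1 := xvar_sub_ne_quarter (hz 0)
    have h2 := xvar_sub_ne_quarter (hz' 0)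
    have h3 : xvar (z - z') = xvar (θ 0 - z') - xvar (θ 0 - z) := by simp only [xvar_sub]; ring
    have hih := ih (Fin.tail θ) (fun i => hz i.succ) (fun i => hz' i.succ) (Fin.tail A)
    have hzr : ∀ {l : Fin q}, l ≠ 0 → _ := fun {l} hl =>
      doubleMonodromy_zero_right (Fin.tail θ) z z' (fun i => hz i.succ) (fun i => hz' i.succ) hl
        (Fin.tail A)
    have hzl : ∀ {l : Fin q}, l ≠ 0 → _ := fun {l} hl =>
      doubleMonodromy_zero_left (Fin.tail θ) hzz (fun i => hz i.succ) (fun i => hz' i.succ) hl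
        (Fin.tail A)
    rw [doubleMonodromy_succ, doubleMonodromy_succ, twoMagnon_succ θ z z' hab, hzr ha, hzr hb,
      hzl ha, hzl hb]
    simp only [bT_eq, cT_eq]
    rw [h3] at hih hζ ⊢
    generalize oneMagnon (Fin.tail θ) z a (Fin.tail A) = oa
    generalize oneMagnon (Fin.tail θ) z' a (Fin.tail A) = oa'
    generalize oneMagnon (Fin.tail θ) z b (Fin.tail A) = ob
    generalize oneMagnon (Fin.tail θ) z' b (Fin.tail A) = ob'
    clear h3
    generalize xvar (θ 0 - z') = d' at *
    generalize xvar (θ 0 - z) = d at *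
    obtain ⟨u, rfl⟩ : ∃ u, d = u + 1 / 4 := ⟨d - 1 / 4, by ring⟩
    obtain ⟨u', rfl⟩ : ∃ u, d' = u + 1 / 4 := ⟨d' - 1 / 4, by ring⟩
    simp only [add_sub_add_right_eq_sub, add_sub_cancel_right] at *
    by_cases hA : A 0 = 0
    · simp only [hA, ha.symm, hb.symm, if_true, if_false, zero_add, add_zero]
      linear_combination ((u + 1 / 4) / u) * ((u' + 1 / 4) / u') * hih
    · by_cases hA' : A 0 = a
      · simp only [hA', ha, hab, if_true, if_false, zero_add, add_zero, mul_zero]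
        field_simp
        ring
      · by_cases hA'' : A 0 = b
        · simp only [hA'', hb, hab.symm, if_true, if_false, zero_add, add_zero, mul_zero]
          field_simp
          ring
        · simp [hA, hA', hA'']

end Covector

/-! ### Bounds for `φ̃` -/

/-- On (0,1) the modulus of x^{u-1} depends only on Re u and decreases in it, so the integral at the
smallest real part dominates. -/
theorem norm_betaIntegral_le {u : ℂ} {v : ℝ} {c : ℝ} (hc : 0 < c) (hu : c ≤ u.re) (hv : 0 < v) :
    ‖betaIntegral u v‖ ≤ ∫ x in (0 : ℝ)..1, ‖(x : ℂ) ^ ((c : ℂ) - 1) * (1 - x : ℂ) ^ ((v : ℂ) - 1)‖ := by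
  have h0 := betaIntegral_convergent (u := c) (v := v) (by simpa using hc) (by simpa using hv)
  rw [betaIntegral]
  refine intervalIntegral.norm_integral_le_of_norm_le zero_le_one ?_ h0.norm
  refine Eventually.of_forall fun x hx => ?_
  rw [norm_mul, norm_mul]
  refine mul_le_mul_of_nonneg_right ?_ (norm_nonneg _)
  rw [norm_cpow_eq_rpow_re_of_pos hx.1, norm_cpow_eq_rpow_re_of_pos hx.1]
  refine Real.rpow_le_rpow_of_exponent_ge hx.1 hx.2 ?_
  simp
  linarith

/-- Up to the constant Γ(1/4), the ratio is the beta function B(3/4 + x, 1/4), which is uniformly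
bounded for Re x ≥ 0. -/
theorem exists_Gamma_ratio_bound :
    ∃ C, 0 ≤ C ∧ ∀ x : ℂ, 0 ≤ x.re → ‖Gamma (3 / 4 + x) / Gamma (1 + x)‖ ≤ C := by
  refine ⟨‖Gamma (1 / 4)‖⁻¹ * ∫ x in (0 : ℝ)..1,
    ‖(x : ℂ) ^ (((3 / 4 : ℝ) : ℂ) - 1) * (1 - x : ℂ) ^ (((1 / 4 : ℝ) : ℂ) - 1)‖, ?_, ?_⟩
  · exact mul_nonneg (by positivity)
      (intervalIntegral.integral_nonneg zero_le_one fun _ _ => norm_nonneg _)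
  · intro x hx
    have h := norm_betaIntegral_le (u := 3 / 4 + x) (v := 1 / 4) (c := 3 / 4) (by norm_num)
      (by simpa using hx) (by norm_num)
    have h1 := betaIntegral_eq_Gamma_mul_div (3 / 4 + x) ((1 / 4 : ℝ) : ℂ)
      (by simp; norm_num; linarith) (by simp)
    have h2 : Gamma (1 / 4) ≠ 0 := Gamma_ne_zero_of_re_pos (by norm_num)
    have h3 : (3 / 4 + x + ((1 / 4 : ℝ) : ℂ)) = 1 + x := by push_cast; ring
    rw [h3] at h1
    have h4 : Gamma (3 / 4 + x) / Gamma (1 + x) =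
        (Gamma (1 / 4))⁻¹ * betaIntegral (3 / 4 + x) ((1 / 4 : ℝ) : ℂ) := by
      rw [h1]; push_cast; field_simp
    rw [h4, norm_mul, norm_inv]
    exact mul_le_mul_of_nonneg_left h (by positivity)

/-- The reflection formula isolates the exponential decay of φ̃ in 1/sin and leaves a bounded ratio
of Gamma functions. -/
theorem phiT_eq {w : ℂ} (h : ∀ m : ℕ, 1 + xvar w ≠ -m) : phiT w =
    -(Real.pi / sin (Real.pi * xvar w)) * (Gamma (3 / 4 + xvar w) / Gamma (1 + xvar w)) := by
  have h1 := Complex.Gamma_mul_Gamma_one_sub (-xvar w)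
  rw [sub_neg_eq_add, mul_neg, Complex.sin_neg, div_neg] at h1
  have h2 := Gamma_ne_zero h
  rw [phiT, ← h1]
  field_simp

theorem mul_exp_le_norm_sin (x : ℂ) {s : ℝ} (hs : 0 ≤ s) (h : s ≤ Real.sin x.re) :
    s * Real.exp |x.im| / 2 ≤ ‖sin x‖ := by
  have h1 : s * Real.cosh x.im ≤ ‖sin x‖ := by
    have h2 : ‖sin x‖ ^ 2 = Real.sin x.re ^ 2 * Real.cosh x.im ^ 2 +
        Real.cos x.re ^ 2 * Real.sinh x.im ^ 2 := by
      have h3 : sin x = (Real.sin x.re * Real.cosh x.im : ℝ) +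
          (Real.cos x.re * Real.sinh x.im : ℝ) * I := by
        rw [Complex.sin_eq]; push_cast; ring
      rw [h3, Complex.sq_norm, Complex.normSq_add_mul_I]
      ring
    refine le_of_sq_le_sq ?_ (norm_nonneg _)
    rw [h2, mul_pow]
    have h3 : s ^ 2 ≤ Real.sin x.re ^ 2 := by gcongr
    have h4 := mul_le_mul_of_nonneg_right h3 (sq_nonneg (Real.cosh x.im))
    have h5 : 0 ≤ Real.cos x.re ^ 2 * Real.sinh x.im ^ 2 := by positivity
    linarith
  refine le_trans ?_ h1
  rw [mul_div_assoc]
  refine mul_le_mul_of_nonneg_left ?_ hs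
  rw [← Real.cosh_abs, Real.cosh_eq]
  have := Real.exp_pos (-|x.im|)
  linarith

theorem sin_pi_mul_ge {α β x : ℝ} (hα : 0 < α) (hβ : β < 1) (h1 : α ≤ x) (h2 : x ≤ β) :
    min (Real.sin (Real.pi * α)) (Real.sin (Real.pi * β)) ≤ Real.sin (Real.pi * x) := by
  have hpi := Real.pi_pos
  rcases le_total x (1 / 2) with h | h
  · refine (min_le_left _ _).trans (Real.sin_le_sin_of_le_of_le_pi_div_two ?_ ?_ ?_) <;> nlinarith
  · refine (min_le_right _ _).trans ?_
    rw [← Real.sin_pi_sub, ← Real.sin_pi_sub (Real.pi * x)]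
    refine Real.sin_le_sin_of_le_of_le_pi_div_two ?_ ?_ ?_ <;> nlinarith

/-- The decay comes from |sin(πx)| ≥ (s/2) e^{π|Im x|} with π|Im x| = |Re w|/2. Away from the
integers in Re x, the constant s is positive. -/
theorem exists_phiT_bound {α β : ℝ} (hα : 0 < α) (hαβ : α ≤ β) (hβ : β < 1) :
    ∃ C, 0 ≤ C ∧ ∀ w : ℂ, α ≤ (xvar w).re → (xvar w).re ≤ β →
      ‖phiT w‖ ≤ C * Real.exp (-|w.re| / 2) := by
  obtain ⟨C, hC0, hC⟩ := exists_Gamma_ratio_bound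
  have hpi := Real.pi_pos
  set s := min (Real.sin (Real.pi * α)) (Real.sin (Real.pi * β)) with hs
  have hs0 : 0 < s := lt_min (Real.sin_pos_of_pos_of_lt_pi (by positivity) (by nlinarith))
    (Real.sin_pos_of_pos_of_lt_pi (mul_pos hpi (by linarith)) (by nlinarith))
  refine ⟨2 * Real.pi / s * C, by positivity, fun w h1 h2 => ?_⟩
  have h3 : ∀ m : ℕ, 1 + xvar w ≠ -m := fun m h => by
    have := congrArg re h
    have hm : (0 : ℝ) ≤ m := m.cast_nonneg
    simp at this; linarith
  rw [phiT_eq h3, norm_mul, norm_neg, norm_div, Complex.norm_real, Real.norm_eq_abs, abs_of_pos hpi]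
  have h4 := mul_exp_le_norm_sin (Real.pi * xvar w) hs0.le (by
    rw [re_ofReal_mul]; exact sin_pi_mul_ge hα hβ h1 h2)
  have h5 : |((Real.pi : ℂ) * xvar w).im| = |w.re| / 2 := by
    rw [im_ofReal_mul, xvar_im, abs_mul, abs_div, abs_neg, abs_of_pos hpi,
      abs_of_pos (by positivity : 0 < 2 * Real.pi)]
    field_simp
  rw [h5] at h4
  have h6 := Real.exp_pos (|w.re| / 2)
  calc Real.pi / ‖sin (Real.pi * xvar w)‖ * ‖Gamma (3 / 4 + xvar w) / Gamma (1 + xvar w)‖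
      ≤ Real.pi / (s * Real.exp (|w.re| / 2) / 2) * C := by
        have := hC (xvar w) (by linarith)
        gcongr
    _ = _ := by
        rw [neg_div, Real.exp_neg]; field_simp

/-- The analyticity of `φ̃`. -/
theorem analyticAt_phiT {w : ℂ} (h0 : w ≠ 0) (h1 : -3 / 4 < (xvar w).re) (h2 : (xvar w).re < 1) :
    AnalyticAt ℂ phiT w := by
  have hx := differentiable_xvar.analyticAt w
  have hw : xvar w ≠ 0 := fun h => h0 (xvar_injective (h.trans (by simp [xvar])))
  have e1 : AnalyticAt ℂ Gamma (3 / 4 + xvar w) := analyticAt_Gamma fun m h => by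
    have := congrArg re h
    have hm : (0 : ℝ) ≤ m := m.cast_nonneg
    simp at this
    norm_num at this
    linarith
  have e2 : AnalyticAt ℂ Gamma (-xvar w) := analyticAt_Gamma
    (ne_neg_nat_of_re (by simpa using h2) (neg_ne_zero.2 hw))
  exact (e1.comp_of_eq (analyticAt_const.add hx) rfl).mul (e2.comp_of_eq hx.neg rfl)

theorem analyticAt_bT {w : ℂ} (h : w ≠ Real.pi * I / 2) : AnalyticAt ℂ bT w :=
  analyticAt_id.div (by fun_prop) (sub_ne_zero.2 h)

theorem analyticAt_cT {w : ℂ} (h : w ≠ Real.pi * I / 2) : AnalyticAt ℂ cT w :=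
  analyticAt_const.div (by fun_prop) (sub_ne_zero.2 h)

theorem integrable_exp_neg_abs : Integrable fun x : ℝ => Real.exp (-|x|) := by
  refine (integrable_inv_one_add_sq.const_mul 2).mono' (by fun_prop)
    (Eventually.of_forall fun x => ?_)
  have h := Real.quadratic_le_exp_of_nonneg (abs_nonneg x)
  have h0 := abs_nonneg x
  rw [sq_abs] at h
  rw [Real.norm_eq_abs, Real.abs_exp, Real.exp_neg, ← div_eq_mul_inv, inv_eq_one_div,
    div_le_div_iff₀ (Real.exp_pos _) (by positivity)]
  linarith

/-! ### Holomorphic dependence of integrals on parameters -/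

/-- A single integrable majorant for the integrand suffices: Cauchy's estimate on circles of radius
r/8 turns it into a majorant for the parameter derivative. -/
theorem analyticAt_integral {F : ℂ → ℝ → ℂ} {u₀ : ℂ} {g : ℝ → ℝ} (hg : Integrable g)
    (hF : ∀ᶠ u in 𝓝 u₀, Continuous (F u) ∧
      ∀ x, DifferentiableAt ℂ (fun u => F u x) u ∧ ‖F u x‖ ≤ g x) :
    AnalyticAt ℂ (fun u => ∫ x, F u x) u₀ := by
  obtain ⟨r, hr, h⟩ := Metric.eventually_nhds_iff_ball.1 hF
  refine DifferentiableOn.analyticAt (s := Metric.ball u₀ (r / 2)) (fun u hu => ?_)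
    (Metric.ball_mem_nhds _ (half_pos hr))
  have hsub : ∀ v ∈ Metric.ball u (r / 4), Metric.closedBall v (r / 8) ⊆ Metric.ball u₀ r := by
    intro v hv w hw
    rw [Metric.mem_ball] at *
    rw [Metric.mem_closedBall] at hw
    have := dist_triangle4 w v u u₀
    linarith
  have hmem : ∀ v ∈ Metric.ball u (r / 4), v ∈ Metric.ball u₀ r := fun v hv =>
    hsub v hv (Metric.mem_closedBall_self (by positivity))
  have hu0 : u ∈ Metric.ball u (r / 4) := Metric.mem_ball_self (by positivity)
  -- The derivative is measurable in x as a pointwise limit of difference quotients along a sequence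
  -- of parameters; the index is offset by n₀ so that all parameters lie in the ball.
  have hmeas : AEStronglyMeasurable (fun x => deriv (fun v => F v x) u) := by
    have hlim : Tendsto (fun n : ℕ => u + ((1 / ((n : ℝ) + 1) : ℝ) : ℂ)) atTop (𝓝[≠] u) := by
      refine tendsto_nhdsWithin_iff.2 ⟨?_, Eventually.of_forall fun n => ?_⟩
      · have := ((Complex.continuous_ofReal.tendsto 0).comp
          tendsto_one_div_add_atTop_nhds_zero_nat).const_add u
        simpa [Function.comp_def] using this
      · have : (0 : ℝ) < 1 / ((n : ℝ) + 1) := by positivity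
        simpa using (show ((n : ℂ) + 1) ≠ 0 by exact_mod_cast n.succ_ne_zero)
    have hev : ∀ᶠ n : ℕ in atTop, u + ((1 / ((n : ℝ) + 1) : ℝ) : ℂ) ∈ Metric.ball u₀ r :=
      (tendsto_nhds_of_tendsto_nhdsWithin hlim).eventually
        (Metric.isOpen_ball.mem_nhds (hmem u hu0))
    obtain ⟨n₀, hn₀⟩ := eventually_atTop.1 hev
    refine aestronglyMeasurable_of_tendsto_ae atTop
      (f := fun (n : ℕ) x => slope (fun v => F v x) u
        (u + ((1 / (((n + n₀ : ℕ) : ℝ) + 1) : ℝ) : ℂ))) (fun n => ?_)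
      (Eventually.of_forall fun x => ?_)
    · simp only [slope_def_field]
      exact (((h _ (hn₀ _ (Nat.le_add_left _ _))).1.sub (h _ (hmem u hu0)).1).div_const
        _).aestronglyMeasurable
    · exact (hasDerivAt_iff_tendsto_slope.1 ((h u (hmem u hu0)).2 x).1.hasDerivAt).comp
        (hlim.comp (tendsto_add_atTop_nat n₀))
  refine (hasDerivAt_integral_of_dominated_loc_of_deriv_le (bound := fun x => g x / (r / 8))
    (F' := fun v x => deriv (fun v => F v x) v) (Metric.ball_mem_nhds u (by positivity : 0 < r / 4))
    ?_ ?_ hmeas ?_ (hg.div_const _) ?_).2.differentiableAt.differentiableWithinAt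
  · filter_upwards [Metric.ball_mem_nhds u (by positivity : 0 < r / 4)] with v hv
    exact (h v (hmem v hv)).1.aestronglyMeasurable
  · exact hg.mono' (h u (hmem u hu0)).1.aestronglyMeasurable
      (Eventually.of_forall fun x => ((h u (hmem u hu0)).2 x).2)
  · refine Eventually.of_forall fun x v hv => ?_
    refine norm_deriv_le_of_forall_mem_sphere_norm_le (by positivity) ?_ fun w hw =>
      ((h w (hsub v hv (Metric.sphere_subset_closedBall hw))).2 x).2
    refine DifferentiableOn.diffContOnCl fun w hw => ?_
    rw [closure_ball _ (by positivity)] at hw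
    exact ((h w (hsub v hv hw)).2 x).1.differentiableWithinAt
  · exact Eventually.of_forall fun x v hv => ((h v (hmem v hv)).2 x).1.hasDerivAt

/-! ### The orbitals -/

/-- The integrand of the single integrals that make up the K-function. -/
def orbital (θ : Fin 4 → ℂ) (p : Fin 4) (k : ℕ) (z : ℂ) : ℂ :=
  (∏ i, phiT (θ i - z)) * magnon θ z p * exp (-(k * z))

theorem norm_bT_cT_le {δ : ℝ} (hδ : 0 < δ) {w : ℂ} (h : 1 / 4 + δ ≤ (xvar w).re) :
    ‖bT w‖ ≤ 1 + 1 / (4 * δ) ∧ ‖cT w‖ ≤ 1 + 1 / (4 * δ) := by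
  have h1 : δ ≤ ‖xvar w - 1 / 4‖ := by
    refine le_trans ?_ (Complex.re_le_norm _)
    simp
    linarith
  have h2 : xvar w - 1 / 4 ≠ 0 := norm_ne_zero_iff.1 (by linarith)
  have hc : ‖cT w‖ ≤ 1 / (4 * δ) := by
    rw [cT_eq, norm_div, norm_neg, ← div_div]
    have h4 : ‖(1 / 4 : ℂ)‖ = 1 / 4 := by norm_num
    rw [h4]
    gcongr
  refine ⟨?_, by linarith⟩
  have h3 : bT w = 1 - cT w := by
    rw [bT_eq, cT_eq, eq_sub_iff_add_eq, ← add_div, ← sub_eq_add_neg, div_self h2]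
  rw [h3]
  refine (norm_sub_le _ _).trans ?_
  rw [norm_one]
  linarith

theorem xvar_sub_line_re (θ : ℂ) (x ℓ : ℝ) :
    (xvar (θ - (x + ℓ * I))).re = (θ.im - ℓ) / (2 * Real.pi) := by
  rw [xvar_re]; simp

/-- Four factors φ̃ decay together like e^{-2|x|}, and the exponential weight with k ≤ 1 grows at
most like e^{|x|}. The magnon factors are bounded because the line stays a fixed distance from their
poles. -/
theorem exists_orbital_bound {α β : ℝ} (M : ℝ) (hα : 1 / 4 < α) (hαβ : α ≤ β) (hβ : β < 1) :
    ∃ C, ∀ (θ : Fin 4 → ℂ) (ℓ : ℝ), (∀ i, α ≤ ((θ i).im - ℓ) / (2 * Real.pi) ∧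
      ((θ i).im - ℓ) / (2 * Real.pi) ≤ β ∧ |(θ i).re| ≤ M) → ∀ (p : Fin 4) (k : ℕ), k ≤ 1 →
      ∀ x : ℝ, ‖orbital θ p k (x + ℓ * I)‖ ≤ C * Real.exp (-|x|) := by
  obtain ⟨C, hC0, hC⟩ := exists_phiT_bound (by linarith) hαβ hβ
  set B := 1 + 1 / (4 * (α - 1 / 4)) with hB
  have hδ : 0 < α - 1 / 4 := by linarith
  have hB1 : 1 ≤ B := by
    have : 0 < 1 / (4 * (α - 1 / 4)) := by positivity
    linarith
  refine ⟨(C * Real.exp (M / 2)) ^ 4 * (B ^ 4 * B), fun θ ℓ hθ p k hk x => ?_⟩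
  have h1 : ∀ i, ‖phiT (θ i - (x + ℓ * I))‖ ≤ C * Real.exp (M / 2) * Real.exp (-|x| / 2) := by
    intro i
    obtain ⟨a, b, c⟩ := hθ i
    refine (hC _ (by rwa [xvar_sub_line_re]) (by rwa [xvar_sub_line_re])).trans ?_
    rw [mul_assoc, ← Real.exp_add]
    refine mul_le_mul_of_nonneg_left (Real.exp_le_exp.2 ?_) hC0
    have h2 : (θ i - (x + ℓ * I)).re = (θ i).re - x := by simp
    rw [h2]
    have h3 := abs_sub_abs_le_abs_sub x (θ i).re
    rw [abs_sub_comm] at h3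
    linarith
  have hbc : ∀ i, ‖bT (θ i - (x + ℓ * I))‖ ≤ B ∧ ‖cT (θ i - (x + ℓ * I))‖ ≤ B := fun i =>
    norm_bT_cT_le hδ (by rw [xvar_sub_line_re]; linarith [(hθ i).1])
  have h2 : ‖∏ i, phiT (θ i - (x + ℓ * I))‖ ≤
      (C * Real.exp (M / 2) * Real.exp (-|x| / 2)) ^ 4 := by
    rw [norm_prod]
    refine (Finset.prod_le_prod (fun _ _ => norm_nonneg _) fun i _ => h1 i).trans_eq ?_
    simp
  have h3 : ‖magnon θ (x + ℓ * I) p‖ ≤ B ^ 4 * B := by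
    rw [magnon, norm_mul, norm_prod]
    refine mul_le_mul ?_ (hbc p).2 (norm_nonneg _) (by positivity)
    refine (Finset.prod_le_prod (fun _ _ => norm_nonneg _) (g := fun _ => B)
      fun i _ => ?_).trans_eq (by simp)
    split_ifs
    · exact (hbc i).1
    · simpa using hB1
  have h4 : ‖exp (-(k * (x + ℓ * I) : ℂ))‖ ≤ Real.exp |x| := by
    rw [Complex.norm_exp]
    refine Real.exp_le_exp.2 ?_
    have : (-(k * (x + ℓ * I) : ℂ)).re = -(k * x) := by simp
    rw [this]
    have h5 := neg_abs_le x
    have h6 := abs_nonneg x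
    interval_cases k <;> simp
    linarith
  rw [orbital, norm_mul, norm_mul]
  calc _ ≤ (C * Real.exp (M / 2) * Real.exp (-|x| / 2)) ^ 4 * (B ^ 4 * B) * Real.exp |x| := by
        gcongr
    _ = (C * Real.exp (M / 2)) ^ 4 * (B ^ 4 * B) *
          (Real.exp (-|x| / 2) ^ 4 * Real.exp |x|) := by ring
    _ = _ := by
        rw [← Real.exp_nat_mul, ← Real.exp_add]
        congr 2
        push_cast; ring

/-- The rapidities lie between the lines `Im θ = ℓ + π/2` and `Im θ = ℓ + 3π/2`. -/
def InStrip (ℓ : ℝ) (θ : Fin 4 → ℂ) : Prop :=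
  ∀ i, ℓ + Real.pi / 2 < (θ i).im ∧ (θ i).im < ℓ + 3 * Real.pi / 2

theorem InStrip.re_bounds {ℓ : ℝ} {θ : Fin 4 → ℂ} (h : InStrip ℓ θ) (i : Fin 4) :
    1 / 4 < ((θ i).im - ℓ) / (2 * Real.pi) ∧ ((θ i).im - ℓ) / (2 * Real.pi) < 3 / 4 := by
  have hpi := Real.pi_pos
  rw [lt_div_iff₀ (by positivity), div_lt_iff₀ (by positivity)]
  constructor <;> linarith [(h i).1, (h i).2]

/-- The bounds are chosen with room to spare, so that one majorant serves for all nearby rapidities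
when the integrals are differentiated. -/
theorem InStrip.exists_uniform {ℓ : ℝ} {θ : Fin 4 → ℂ} (h : InStrip ℓ θ) :
    ∃ α β M : ℝ, 1 / 4 < α ∧ α ≤ β ∧ β < 1 ∧ ∀ᶠ θ' in 𝓝 θ,
      ∀ i, α ≤ ((θ' i).im - ℓ) / (2 * Real.pi) ∧
        ((θ' i).im - ℓ) / (2 * Real.pi) ≤ β ∧ |(θ' i).re| ≤ M := by
  have h1 : ∀ i, ∃ a b, (1 / 4 < a ∧ a < ((θ i).im - ℓ) / (2 * Real.pi)) ∧
      (((θ i).im - ℓ) / (2 * Real.pi) < b ∧ b < 3 / 4) := fun i => by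
    obtain ⟨a, ha⟩ := exists_between (h.re_bounds i).1
    obtain ⟨b, hb⟩ := exists_between (h.re_bounds i).2
    exact ⟨a, b, ha, hb⟩
  choose a b ha hb using h1
  obtain ⟨i₀, hi₀⟩ := Finite.exists_min a
  obtain ⟨i₁, hi₁⟩ := Finite.exists_max b
  refine ⟨a i₀, b i₁, (∑ i, |(θ i).re|) + 1, (ha i₀).1, ?_, by linarith [(hb i₁).2], ?_⟩
  · linarith [hi₀ i₁, (ha i₁).2, (hb i₁).1]
  · refine eventually_all.2 fun i => ?_
    have hc : ContinuousAt (fun θ' : Fin 4 → ℂ => ((θ' i).im - ℓ) / (2 * Real.pi)) θ :=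
      (((Complex.continuous_im.comp (continuous_apply i)).sub continuous_const).div_const
        _).continuousAt
    have hc' : ContinuousAt (fun θ' : Fin 4 → ℂ => |(θ' i).re|) θ :=
      (Complex.continuous_re.comp (continuous_apply i)).abs.continuousAt
    have hs : |(θ i).re| < (∑ i, |(θ i).re|) + 1 := by
      have := Finset.single_le_sum (f := fun i => |(θ i).re|) (fun _ _ => abs_nonneg _)
        (Finset.mem_univ i)
      linarith
    filter_upwards [hc.eventually (lt_mem_nhds (ha i).2), hc.eventually (gt_mem_nhds (hb i).1),
      hc'.eventually (gt_mem_nhds hs)] with θ' h1 h2 h3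
    exact ⟨(hi₀ i).trans h1.le, h2.le.trans (hi₁ i), h3.le⟩

theorem InStrip.ne_line {ℓ : ℝ} {θ : Fin 4 → ℂ} (h : InStrip ℓ θ) (i : Fin 4) (x : ℝ) :
    θ i - (x + ℓ * I) ≠ 0 ∧ θ i - (x + ℓ * I) ≠ Real.pi * I / 2 ∧
      -3 / 4 < (xvar (θ i - (x + ℓ * I))).re ∧ (xvar (θ i - (x + ℓ * I))).re < 1 := by
  have hb := h.re_bounds i
  rw [← xvar_sub_line_re _ x] at hb
  refine ⟨fun h0 => ?_, fun h0 => ?_, by linarith, by linarith⟩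
  · rw [h0] at hb; simp [xvar] at hb; linarith
  · rw [h0, xvar_pi_I_div_two] at hb; norm_num at hb

theorem analyticAt_magnon {θ : ℂ → Fin 4 → ℂ} {z : ℂ → ℂ} {u : ℂ}
    (hθ : ∀ i, AnalyticAt ℂ (fun u => θ u i) u) (hz : AnalyticAt ℂ z u) {p : Fin 4}
    (h : ∀ i ≤ p, θ u i - z u ≠ Real.pi * I / 2) :
    AnalyticAt ℂ (fun u => magnon (θ u) (z u) p) u := by
  refine AnalyticAt.mul (Finset.analyticAt_fun_prod _ fun i _ => ?_)
    ((analyticAt_cT (h p le_rfl)).comp_of_eq ((hθ p).sub hz) rfl)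
  split_ifs with hi
  · exact (analyticAt_bT (h i hi.le)).comp_of_eq ((hθ i).sub hz) rfl
  · exact analyticAt_const

theorem analyticAt_orbital {θ : ℂ → Fin 4 → ℂ} {z : ℂ → ℂ} {u : ℂ}
    (hθ : ∀ i, AnalyticAt ℂ (fun u => θ u i) u) (hz : AnalyticAt ℂ z u) (p : Fin 4) (k : ℕ)
    (h : ∀ i, θ u i - z u ≠ 0 ∧ θ u i - z u ≠ Real.pi * I / 2 ∧
      -3 / 4 < (xvar (θ u i - z u)).re ∧ (xvar (θ u i - z u)).re < 1) :
    AnalyticAt ℂ (fun u => orbital (θ u) p k (z u)) u := by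
  refine AnalyticAt.mul (AnalyticAt.mul (Finset.analyticAt_fun_prod _ fun i _ => ?_)
    (analyticAt_magnon hθ hz fun i _ => (h i).2.1)) (by fun_prop)
  exact (analyticAt_phiT (h i).1 (h i).2.2.1 (h i).2.2.2).comp_of_eq ((hθ i).sub hz) rfl

theorem InStrip.continuous_orbital {ℓ : ℝ} {θ : Fin 4 → ℂ} (h : InStrip ℓ θ) (p : Fin 4) (k : ℕ) :
    Continuous fun x : ℝ => orbital θ p k (x + ℓ * I) := by
  refine continuous_iff_continuousAt.2 fun x => ?_
  have h1 : AnalyticAt ℂ (fun z => orbital θ p k z) (x + ℓ * I) :=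
    analyticAt_orbital (θ := fun _ => θ) (fun _ => analyticAt_const) analyticAt_id p k
      fun i => h.ne_line i x
  exact ContinuousAt.comp (g := fun z => orbital θ p k z) (f := fun x : ℝ => (x + ℓ * I : ℂ))
    h1.continuousAt (by fun_prop)

theorem InStrip.integrable_orbital {ℓ : ℝ} {θ : Fin 4 → ℂ} (h : InStrip ℓ θ) (p : Fin 4) {k : ℕ}
    (hk : k ≤ 1) : Integrable fun x : ℝ => orbital θ p k (x + ℓ * I) := by
  obtain ⟨α, β, M, h1, h2, h3, h4⟩ := h.exists_uniform
  obtain ⟨C, hC⟩ := exists_orbital_bound M h1 h2 h3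
  exact (integrable_exp_neg_abs.const_mul C).mono' (h.continuous_orbital p k).aestronglyMeasurable
    (Eventually.of_forall (hC θ ℓ h4.self_of_nhds p k hk))

theorem InStrip.eventually {ℓ : ℝ} {θ : Fin 4 → ℂ} (h : InStrip ℓ θ) :
    ∀ᶠ θ' in 𝓝 θ, InStrip ℓ θ' := by
  refine eventually_all.2 fun i => ?_
  have hc : ContinuousAt (fun θ' : Fin 4 → ℂ => (θ' i).im) θ :=
    (Complex.continuous_im.comp (continuous_apply i)).continuousAt
  exact (hc.eventually (lt_mem_nhds (h i).1)).and (hc.eventually (gt_mem_nhds (h i).2))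

theorem InStrip.analyticAt_integral_orbital {ℓ : ℝ} {θ : ℂ → Fin 4 → ℂ} {u : ℂ}
    (hθ : ∀ i, AnalyticAt ℂ (fun u => θ u i) u) (h : InStrip ℓ (θ u)) (p : Fin 4) {k : ℕ}
    (hk : k ≤ 1) : AnalyticAt ℂ (fun u => ∫ x : ℝ, orbital (θ u) p k (x + ℓ * I)) u := by
  obtain ⟨α, β, M, h1, h2, h3, h4⟩ := h.exists_uniform
  obtain ⟨C, hC⟩ := exists_orbital_bound M h1 h2 h3
  have hc : ContinuousAt θ u := continuousAt_pi.2 fun i => (hθ i).continuousAt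
  refine GrossNeveu.analyticAt_integral (integrable_exp_neg_abs.const_mul C) ?_
  filter_upwards [hc.eventually h4, hc.eventually h.eventually,
    eventually_all.2 fun i => (hθ i).eventually_analyticAt] with v hv1 hv2 hv3
  exact ⟨hv2.continuous_orbital p k, fun x =>
    ⟨(analyticAt_orbital hv3 analyticAt_const p k fun i => hv2.ne_line i x).differentiableAt,
      hC _ ℓ hv1 p k hk x⟩⟩

/-! ### Contour integrals of the orbitals -/

theorem ContourConverges.sum {ι : Type*} {n : ℕ} {ℓ : ℝ} {a : Fin n → ℂ} {f : ι → ℂ → ℂ}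
    (s : Finset ι) (h : ∀ i ∈ s, ContourConverges ℓ a (f i)) :
    ContourConverges ℓ a (fun z => ∑ i ∈ s, f i z) ∧
      contourIntegral ℓ a (fun z => ∑ i ∈ s, f i z) = ∑ i ∈ s, contourIntegral ℓ a (f i) := by
  classical
  induction s using Finset.induction_on with
  | empty =>
    have h0 : ∀ i, HasResidueAt (fun _ : ℂ => (0 : ℂ)) (a i) 0 := fun i =>
      HasResidueAt.of_analyticAt (g := fun _ => 0) analyticAt_const (Eventually.of_forall fun _ => rfl)
    refine ⟨⟨by simp, fun i => ⟨0, by simpa using h0 i⟩⟩, ?_⟩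
    simp only [Finset.sum_empty]
    rw [contourIntegral_eq h0]
    simp
  | insert i s hi ih =>
    obtain ⟨h1, h2⟩ := ih fun j hj => h j (Finset.mem_insert_of_mem hj)
    have h3 := h i (Finset.mem_insert_self i s)
    simp only [Finset.sum_insert hi]
    exact ⟨h3.add h1, by rw [contourIntegral_add h3 h1, h2]⟩

theorem InStrip.xvar_sub_re {ℓ : ℝ} {θ : Fin 4 → ℂ} (h : InStrip ℓ θ) (i j : Fin 4) :
    -1 / 2 < (xvar (θ i - θ j)).re ∧ (xvar (θ i - θ j)).re < 1 / 2 := by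
  have hi := h.re_bounds i
  have hj := h.re_bounds j
  have e : (xvar (θ i - θ j)).re =
      ((θ i).im - ℓ) / (2 * Real.pi) - ((θ j).im - ℓ) / (2 * Real.pi) := by
    rw [xvar_re, sub_im]; ring
  rw [e]
  constructor <;> linarith

/-- The residue of the orbital at `θ j`. -/
def orbitalRes (θ : Fin 4 → ℂ) (p : Fin 4) (k : ℕ) (j : Fin 4) : ℂ :=
  2 * Real.pi * I * Gamma (3 / 4) * (∏ i ∈ Finset.univ.erase j, phiT (θ i - θ j)) *
    magnon θ (θ j) p * exp (-(k * θ j))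

theorem phiT_neg_eq {w : ℂ} (hw : w ≠ 0) :
    phiT (-w) = 2 * Real.pi * I * Gamma (3 / 4 - xvar w) * Gamma (1 + xvar w) / w := by
  have hx : xvar w ≠ 0 := fun h => hw (xvar_injective (h.trans (by simp [xvar])))
  have h2 := mul_xvar w
  rw [phiT, xvar_neg, neg_neg, Gamma_one_add hx, eq_div_iff hw]
  nth_rewrite 3 [← h2]
  ring_nf

/-- Only φ̃(θ j - z) is singular at z = θ j. The other φ̃ factors are regular by distinctness and
the strip condition, and the magnon factors are regular because no difference θ i - θ j equals iπ/2.
-/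
theorem hasResidueAt_orbital {ℓ : ℝ} {θ : Fin 4 → ℂ} (h : InStrip ℓ θ) {j : Fin 4}
    (hj : ∀ i, i ≠ j → θ i ≠ θ j ∧ θ i - θ j ≠ Real.pi * I / 2) (p : Fin 4) (k : ℕ) :
    HasResidueAt (orbital θ p k) (θ j) (orbitalRes θ p k j) := by
  have hpi : (Real.pi * I / 2 : ℂ) ≠ 0 := by simp [Real.pi_ne_zero]
  let g : ℂ → ℂ := fun z => 2 * Real.pi * I * Gamma (3 / 4 - xvar (z - θ j)) *
    Gamma (1 + xvar (z - θ j)) * (∏ i ∈ Finset.univ.erase j, phiT (θ i - z)) *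
    magnon θ z p * exp (-(k * z))
  have hx : AnalyticAt ℂ (fun z => xvar (z - θ j)) (θ j) :=
    (differentiable_xvar.comp (differentiable_id.sub_const (θ j))).analyticAt _
  have h0 : xvar (θ j - θ j) = 0 := by simp [xvar]
  have hg : AnalyticAt ℂ g (θ j) := by
    refine AnalyticAt.mul (AnalyticAt.mul (AnalyticAt.mul (AnalyticAt.mul (analyticAt_const.mul ?_)
      ?_) ?_) ?_) (by fun_prop)
    · refine (analyticAt_Gamma (w := 3 / 4) fun m => ?_).comp_of_eq (analyticAt_const.sub hx)
        (by rw [h0]; ring)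
      exact ne_neg_nat_of_re (by norm_num) (by norm_num) m
    · refine (analyticAt_Gamma (w := 1) fun m => ?_).comp_of_eq (analyticAt_const.add hx)
        (by rw [h0]; ring)
      exact ne_neg_nat_of_re (by norm_num) (by norm_num) m
    · refine Finset.analyticAt_fun_prod _ fun i hi => ?_
      have hij := hj i (Finset.ne_of_mem_erase hi)
      have hb := h.xvar_sub_re i j
      exact (analyticAt_phiT (sub_ne_zero.2 hij.1) (by linarith) (by linarith)).comp_of_eq
        (f := fun z => θ i - z) (by fun_prop) rfl
    · refine analyticAt_magnon (θ := fun _ => θ) (z := fun z => z) (fun _ => analyticAt_const)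
        analyticAt_id fun i _ => ?_
      by_cases hij : i = j
      · rw [hij, sub_self]; exact hpi.symm
      · exact (hj i hij).2
  have e : g (θ j) = orbitalRes θ p k j := by
    simp only [g, orbitalRes, h0, sub_zero, add_zero, Gamma_one, mul_one]
  rw [← e]
  refine HasResidueAt.of_simplePole hg ?_
  filter_upwards [self_mem_nhdsWithin] with z hz
  have hz' : z - θ j ≠ 0 := sub_ne_zero.2 hz
  have h1 := phiT_neg_eq hz'
  rw [neg_sub] at h1
  rw [orbital, ← Finset.mul_prod_erase _ _ (Finset.mem_univ j), h1]
  simp only [g]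
  ring

/-- The rapidities are such that the contour of the first level is not pinched. -/
def Unpinched (θ : Fin 4 → ℂ) : Prop :=
  ∀ i j, i ≠ j → θ i ≠ θ j ∧ θ i - θ j ≠ Real.pi * I / 2

theorem InStrip.contourConverges_orbital {ℓ : ℝ} {θ : Fin 4 → ℂ} (h : InStrip ℓ θ)
    (hθ : Unpinched θ) (p : Fin 4) {k : ℕ} (hk : k ≤ 1) :
    ContourConverges ℓ θ (orbital θ p k) :=
  ⟨h.integrable_orbital p hk, fun j => ⟨_, hasResidueAt_orbital h (fun i hi => hθ i j hi) p k⟩⟩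

theorem InStrip.contourIntegral_orbital {ℓ : ℝ} {θ : Fin 4 → ℂ} (h : InStrip ℓ θ)
    (hθ : Unpinched θ) (p : Fin 4) (k : ℕ) : contourIntegral ℓ θ (orbital θ p k) =
      (∫ x : ℝ, orbital θ p k (x + ℓ * I)) - 2 * Real.pi * I * ∑ j, orbitalRes θ p k j :=
  contourIntegral_eq fun j => hasResidueAt_orbital h (fun i hi => hθ i j hi) p k

theorem InStrip.orbital_combination {ℓ : ℝ} {θ : Fin 4 → ℂ} (h : InStrip ℓ θ)
    (hθ : Unpinched θ) (p q : Fin 4) (a b c d : ℂ) :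
    ContourConverges ℓ θ (fun z => (a * orbital θ p 0 z + b * orbital θ p 1 z) +
      (c * orbital θ q 0 z + d * orbital θ q 1 z)) ∧
    contourIntegral ℓ θ (fun z => (a * orbital θ p 0 z + b * orbital θ p 1 z) +
      (c * orbital θ q 0 z + d * orbital θ q 1 z)) =
      (a * contourIntegral ℓ θ (orbital θ p 0) + b * contourIntegral ℓ θ (orbital θ p 1)) +
      (c * contourIntegral ℓ θ (orbital θ q 0) + d * contourIntegral ℓ θ (orbital θ q 1)) := by
  have hp0 := h.contourConverges_orbital hθ p zero_le_one
  have hp1 := h.contourConverges_orbital hθ p (le_refl 1)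
  have hq0 := h.contourConverges_orbital hθ q zero_le_one
  have hq1 := h.contourConverges_orbital hθ q (le_refl 1)
  refine ⟨((hp0.const_mul a).add (hp1.const_mul b)).add ((hq0.const_mul c).add (hq1.const_mul d)),
    ?_⟩
  rw [contourIntegral_add ((hp0.const_mul a).add (hp1.const_mul b))
    ((hq0.const_mul c).add (hq1.const_mul d)),
    contourIntegral_add (hp0.const_mul a) (hp1.const_mul b),
    contourIntegral_add (hq0.const_mul c) (hq1.const_mul d), contourIntegral_const_mul a hp0,
    contourIntegral_const_mul b hp1, contourIntegral_const_mul c hq0,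
    contourIntegral_const_mul d hq1]

/-! ### The integrand of the first level -/

def kConst : ℂ := (2 * Real.pi) ^ 2 * Gamma (3 / 4) ^ 2 / (2 * Gamma (3 / 2)) / (2 * Real.pi * I)

/-- The part of the p-function that depends on the rapidities only. -/
def kPrefactor (θ : Fin 4 → ℂ) : ℂ := exp ((∑ i, θ i) / 2) / ∑ i, exp (θ i)

/-- The shifted Gamma functions of `K1Value` and τ cancel, and the rational factor of the two-magnon
co-vector removes the pole at 1/4. What is left, 1/(Γ(-ζ)Γ(1+ζ)), is a multiple of sin(πζ) by the
reflection formula. The exponential turns this sine into a difference of functions of a single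
variable each. -/
theorem tau_mul_K1Value {z₀ z₁ : ℂ} (h0 : z₀ ≠ z₁) (h1 : xvar (z₀ - z₁) - 1 / 4 ≠ 0)
    (h2 : |(xvar (z₀ - z₁)).re| < 3 / 4) :
    tau (z₀ - z₁) * (K1Value z₀ z₁ * ((xvar (z₀ - z₁) - 1 / 4) / xvar (z₀ - z₁))) *
      exp (-(z₀ + z₁) / 2) = -kConst * (exp (-z₁) - exp (-z₀)) := by
  have hζ : xvar (z₀ - z₁) ≠ 0 := by
    rw [xvar_sub, sub_ne_zero]; exact fun h => h0 (xvar_injective h)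
  have hm := mul_xvar (z₀ - z₁)
  obtain ⟨h3, h4⟩ := abs_lt.1 h2
  have hs : sin (Real.pi * xvar (z₀ - z₁)) * exp (-(z₀ + z₁) / 2) =
      (exp (-z₁) - exp (-z₀)) / (2 * I) := by
    have e1 : Real.pi * xvar (z₀ - z₁) * I = (z₀ - z₁) / 2 := by linear_combination hm / 2
    have e2 : -(Real.pi * xvar (z₀ - z₁)) * I = (z₁ - z₀) / 2 := by linear_combination -hm / 2
    have e3 : exp ((z₁ - z₀) / 2) * exp (-(z₀ + z₁) / 2) = exp (-z₀) := by
      rw [← Complex.exp_add]; ring_nf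
    have e4 : exp ((z₀ - z₁) / 2) * exp (-(z₀ + z₁) / 2) = exp (-z₁) := by
      rw [← Complex.exp_add]; ring_nf
    rw [Complex.sin, e1, e2, eq_div_iff (by simp)]
    linear_combination (exp ((z₁ - z₀) / 2) - exp ((z₀ - z₁) / 2)) * exp (-(z₀ + z₁) / 2) * I_mul_I -
      e3 + e4
  have hr := Complex.Gamma_mul_Gamma_one_sub (-xvar (z₀ - z₁))
  rw [sub_neg_eq_add, mul_neg, Complex.sin_neg, Gamma_one_add hζ] at hr
  have g1 : Gamma (3 / 4 + xvar (z₀ - z₁)) ≠ 0 :=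
    Gamma_ne_zero_of_re_pos (by simp; norm_num; linarith)
  have g2 : Gamma (3 / 4 - xvar (z₀ - z₁)) ≠ 0 :=
    Gamma_ne_zero_of_re_pos (by simp; norm_num; linarith)
  have g3 : Gamma (-xvar (z₀ - z₁)) ≠ 0 :=
    Gamma_ne_zero (ne_neg_nat_of_re (by simp; linarith) (neg_ne_zero.2 hζ))
  have g4 : Gamma (xvar (z₀ - z₁)) ≠ 0 :=
    Gamma_ne_zero (ne_neg_nat_of_re (by linarith) hζ)
  have hpi : (Real.pi : ℂ) ≠ 0 := by exact_mod_cast Real.pi_ne_zero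
  have hsin : sin (Real.pi * xvar (z₀ - z₁)) ≠ 0 := by
    intro h
    rw [h, neg_zero, div_zero] at hr
    exact mul_ne_zero g3 (mul_ne_zero hζ g4) hr
  have h5 : tau (z₀ - z₁) * (K1Value z₀ z₁ * ((xvar (z₀ - z₁) - 1 / 4) / xvar (z₀ - z₁))) =
      -(kConst * (2 * I)) * sin (Real.pi * xvar (z₀ - z₁)) := by
    have h6 : 1 / (Gamma (-xvar (z₀ - z₁)) * (xvar (z₀ - z₁) * Gamma (xvar (z₀ - z₁)))) =
        -sin (Real.pi * xvar (z₀ - z₁)) / Real.pi := by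
      rw [hr, one_div_div]
    have h7 : tau (z₀ - z₁) * (K1Value z₀ z₁ * ((xvar (z₀ - z₁) - 1 / 4) / xvar (z₀ - z₁))) =
        (2 * Real.pi) ^ 2 * Gamma (3 / 4) ^ 2 / (2 * Gamma (3 / 2)) *
          (1 / (Gamma (-xvar (z₀ - z₁)) * (xvar (z₀ - z₁) * Gamma (xvar (z₀ - z₁))))) := by
      rw [tau, phiT, phiT, xvar_neg, K1Value, neg_neg, ← sub_eq_add_neg]
      generalize (2 * Real.pi : ℂ) ^ 2 * Gamma (3 / 4) ^ 2 / (2 * Gamma (3 / 2)) = c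
      generalize xvar (z₀ - z₁) = ζ at *
      generalize Gamma (3 / 4 + ζ) = G1 at *
      generalize Gamma (3 / 4 - ζ) = G2 at *
      generalize ζ - 1 / 4 = d at *
      field_simp
    rw [h7, h6, kConst]
    field_simp
  rw [h5, mul_assoc, hs]
  field_simp

theorem betheState_eq {ℓ₂ : ℝ} {θ : Fin 4 → ℂ} {z₀ z₁ : ℂ} (h : SecondLevelRegular ℓ₂ ![z₀, z₁])
    (h0 : ∀ i, θ i - z₀ ≠ Real.pi * I / 2) (h1 : ∀ i, θ i - z₁ ≠ Real.pi * I / 2)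
    (A : Fin 4 → Fin 4) : betheState ℓ₂ A θ ![z₀, z₁] =
      -(K1Value z₀ z₁ * ((xvar (z₀ - z₁) - 1 / 4) / xvar (z₀ - z₁))) * twoMagnon θ z₀ z₁ 1 2 A := by
  have hne : z₀ ≠ z₁ := h.ne
  have hd := doubleMonodromy_sub θ hne h0 h1 (a := (1 : Fin 4)) (b := 2) (by decide) (by decide)
    (by decide) A
  rw [neg_mul, mul_assoc, ← hd]
  simp only [betheState, h.K1_eq, mul_sub, sub_mul, Finset.sum_sub_distrib, mul_ite, mul_one,
    mul_zero, ite_mul, zero_mul, Finset.sum_ite_eq', Finset.mem_univ, if_true, bethe_two]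
  simp

/-- The antisymmetrised products of two orbitals. -/
def orbitalDet (θ : Fin 4 → ℂ) (p q : Fin 4) (z₀ z₁ : ℂ) : ℂ :=
  orbital θ p 0 z₀ * orbital θ q 1 z₁ - orbital θ p 1 z₀ * orbital θ q 0 z₁ -
    orbital θ q 0 z₀ * orbital θ p 1 z₁ + orbital θ q 1 z₀ * orbital θ p 0 z₁

/-- This is the separation of variables. The difference e^{-z₁} - e^{-z₀} and the antisymmetrised
wave functions expand into four products, each with one orbital in z₀ and one in z₁. -/
theorem KIntegrand_eq {ℓ₂ : ℝ} {θ : Fin 4 → ℂ} {z₀ z₁ : ℂ} (h : SecondLevelRegular ℓ₂ ![z₀, z₁])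
    (h0 : ∀ i, θ i - z₀ ≠ Real.pi * I / 2) (h1 : ∀ i, θ i - z₁ ≠ Real.pi * I / 2)
    (A : Fin 4 → Fin 4) : KIntegrand ℓ₂ A θ ![z₀, z₁] =
      ∑ p, ∑ q, (if IsPair A 1 2 p q then kConst * kPrefactor θ else 0) *
        orbitalDet θ p q z₀ z₁ := by
  have hpi := Real.pi_pos
  have hstrip : |(xvar (z₀ - z₁)).re| < 3 / 4 := by
    have s0 := h.strip 0
    have s1 := h.strip 1
    simp only [Matrix.cons_val_zero, Matrix.cons_val_one] at s0 s1
    rw [xvar_re, abs_lt, lt_div_iff₀ (by positivity), div_lt_iff₀ (by positivity), sub_im]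
    constructor <;> linarith
  have ht := tau_mul_K1Value (z₀ := z₀) (z₁ := z₁) h.ne (by simpa using h.xvar_sub_ne) hstrip
  have hh : hfun θ ![z₀, z₁] = (∏ i, phiT (θ i - z₀)) * (∏ i, phiT (θ i - z₁)) * tau (z₀ - z₁) := by
    simp [hfun, Fin.prod_univ_two, Finset.prod_mul_distrib, Finset.prod_filter]
  have hp : pJ θ ![z₀, z₁] (Fin.elim0 : Fin 0 → ℂ) = kPrefactor θ * exp (-(z₀ + z₁) / 2) := by
    rw [pJ, kPrefactor, div_mul_eq_mul_div, ← Complex.exp_add]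
    congr 2
    simp [Fin.sum_univ_two]
    ring
  have hsum : (exp (-z₁) - exp (-z₀)) * ((∏ i, phiT (θ i - z₀)) * (∏ i, phiT (θ i - z₁))) *
      twoMagnon θ z₀ z₁ 1 2 A =
      ∑ p, ∑ q, (if IsPair A 1 2 p q then 1 else 0) * orbitalDet θ p q z₀ z₁ := by
    simp only [twoMagnon, Finset.mul_sum]
    refine Finset.sum_congr rfl fun p _ => Finset.sum_congr rfl fun q _ => ?_
    split_ifs
    · simp only [orbitalDet, orbital, Nat.cast_zero, Nat.cast_one, zero_mul, neg_zero, one_mul,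
        Complex.exp_zero]
      ring
    · ring
  rw [KIntegrand, hh, hp, betheState_eq h h0 h1]
  have e : ∀ p q, (if IsPair A 1 2 p q then kConst * kPrefactor θ else 0) =
      kConst * kPrefactor θ * (if IsPair A 1 2 p q then 1 else 0) := fun p q => by split_ifs <;> simp
  simp only [e, mul_assoc, ← Finset.mul_sum]
  rw [← hsum]
  linear_combination (-(kPrefactor θ) * ((∏ i, phiT (θ i - z₀)) * (∏ i, phiT (θ i - z₁))) *
      twoMagnon θ z₀ z₁ 1 2 A) * ht

/-- The points `z` for which the inner integration of the first level has no singularities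
except those encircled by the contour. -/
structure FirstLevelRegular (ℓ₁ ℓ₂ : ℝ) (θ : Fin 4 → ℂ) (z : ℂ) : Prop where
  strip : ℓ₂ + Real.pi / 2 < z.im ∧ z.im < ℓ₂ + 2 * Real.pi
  line : z.im - ℓ₁ ≠ Real.pi / 2 ∧ z.im - ℓ₁ ≠ -(Real.pi / 2)
  ne : ∀ i, z ≠ θ i
  ne_pole : ∀ i, z - θ i ≠ Real.pi * I / 2 ∧ θ i - z ≠ Real.pi * I / 2

/-- The lower line enters only through ℓ₂ + 2π < ℓ₁ + 3π/2, which bounds the rapidities from above.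
-/
theorem AdmissibleLines.inStrip {ℓ₁ ℓ₂ : ℝ} {θ : Fin 4 → ℂ} (h : AdmissibleLines ℓ₁ ℓ₂ θ) :
    InStrip ℓ₁ θ := fun i => ⟨h.1 i, by linarith [h.2.2 i, h.2.1]⟩

/-! ### Evaluation of the two integrations of the first level. -/

namespace FirstLevelRegular

variable {ℓ₁ ℓ₂ : ℝ} {θ : Fin 4 → ℂ}

theorem of_line (h : AdmissibleLines ℓ₁ ℓ₂ θ) (x : ℝ) :
    FirstLevelRegular ℓ₁ ℓ₂ θ (x + ℓ₁ * I) := by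
  have hpi := Real.pi_pos
  have him : ((x : ℂ) + ℓ₁ * I).im = ℓ₁ := by simp
  have hp : (Real.pi * I / 2 : ℂ).im = Real.pi / 2 := by simp
  refine ⟨?_, ?_, fun i hi => ?_, fun i => ⟨fun hi => ?_, fun hi => ?_⟩⟩
  · rw [him]; exact ⟨h.2.1, by linarith [h.1 0, h.2.2 0]⟩
  · rw [him, sub_self]; constructor <;> linarith
  all_goals
    have h1 := h.1 i
    have h2 := congrArg im hi
    simp only [sub_im, hp, him] at h2
    linarith

theorem eventually (h : AdmissibleLines ℓ₁ ℓ₂ θ) (hθ : Unpinched θ) (j : Fin 4) :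
    ∀ᶠ z in 𝓝[≠] θ j, FirstLevelRegular ℓ₁ ℓ₂ θ z := by
  have hpi := Real.pi_pos
  have hp : (Real.pi * I / 2 : ℂ) ≠ 0 := by simp [Real.pi_ne_zero]
  have hc : ContinuousAt im (θ j) := Complex.continuous_im.continuousAt
  have h1 : ∀ᶠ z in 𝓝 (θ j), ℓ₁ + Real.pi / 2 < z.im := hc.eventually (lt_mem_nhds (h.1 j))
  have h2 : ∀ᶠ z in 𝓝 (θ j), z.im < ℓ₂ + 2 * Real.pi := hc.eventually (gt_mem_nhds (h.2.2 j))
  have h3 : ∀ᶠ z in 𝓝 (θ j), ∀ i, i ≠ j → z ≠ θ i := eventually_all.2 fun i => by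
    by_cases hij : i = j
    · simp [hij]
    · filter_upwards [isOpen_ne.mem_nhds (hθ j i (Ne.symm hij)).1] with z hz _ using hz
  have h4 : ∀ i, θ j - θ i ≠ Real.pi * I / 2 ∧ θ i - θ j ≠ Real.pi * I / 2 := fun i => by
    by_cases hij : i = j
    · rw [hij, sub_self]; exact ⟨hp.symm, hp.symm⟩
    · exact ⟨(hθ j i (Ne.symm hij)).2, (hθ i j hij).2⟩
  have h5 : ∀ᶠ z in 𝓝 (θ j), ∀ i, z - θ i ≠ Real.pi * I / 2 ∧ θ i - z ≠ Real.pi * I / 2 :=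
    eventually_all.2 fun i =>
      (ContinuousAt.eventually_ne (g := fun z => z - θ i) (by fun_prop) (h4 i).1).and
        (ContinuousAt.eventually_ne (g := fun z => θ i - z) (by fun_prop) (h4 i).2)
  filter_upwards [nhdsWithin_le_nhds h1, nhdsWithin_le_nhds h2, nhdsWithin_le_nhds h3,
    nhdsWithin_le_nhds h5, self_mem_nhdsWithin] with z z1 z2 z3 z5 z6
  refine ⟨⟨by linarith [h.2.1], z2⟩, ⟨by linarith, by linarith⟩, fun i => ?_, z5⟩
  by_cases hij : i = j
  · rw [hij]; exact z6
  · exact z3 i hij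

theorem secondLevel {z w : ℂ} (hz : FirstLevelRegular ℓ₁ ℓ₂ θ z)
    (hw : FirstLevelRegular ℓ₁ ℓ₂ θ w) (h0 : z ≠ w) (h1 : z - w ≠ Real.pi * I / 2)
    (h2 : w - z ≠ Real.pi * I / 2) : SecondLevelRegular ℓ₂ ![z, w] :=
  ⟨h0, h1, h2, Fin.forall_fin_two.2 ⟨hz.strip, hw.strip⟩⟩

theorem KIntegrand_line (h : AdmissibleLines ℓ₁ ℓ₂ θ) {z : ℂ}
    (hz : FirstLevelRegular ℓ₁ ℓ₂ θ z) (A : Fin 4 → Fin 4) : ∀ᵐ x : ℝ, KIntegrand ℓ₂ A θ ![z, x + ℓ₁ * I] =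
    ∑ p, ∑ q, (if IsPair A 1 2 p q then kConst * kPrefactor θ else 0) *
      orbitalDet θ p q z (x + ℓ₁ * I) := by
  -- If z itself lies on the line of integration, the two arguments coincide at x = Re z. The second
  -- level is then degenerate, but only on a null set.
  have h0 : ∀ᵐ x : ℝ, x ≠ z.re := by
    rw [ae_iff]; simp
  filter_upwards [h0] with x hx
  have him : ((x : ℂ) + ℓ₁ * I).im = ℓ₁ := by simp
  have hp : (Real.pi * I / 2 : ℂ).im = Real.pi / 2 := by simp
  have hx' := of_line h x
  refine KIntegrand_eq (hz.secondLevel hx' (fun h1 => hx ?_) (fun h1 => hz.line.1 ?_)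
    fun h1 => hz.line.2 ?_) (fun i => (hz.ne_pole i).2) (fun i => (hx'.ne_pole i).2) A
  · rw [h1]; simp
  · have := congrArg im h1
    rwa [sub_im, him, hp] at this
  · have := congrArg im h1
    rw [sub_im, him, hp] at this
    linarith

theorem KIntegrand_near (h : AdmissibleLines ℓ₁ ℓ₂ θ) (hθ : Unpinched θ) {z : ℂ}
    (hz : FirstLevelRegular ℓ₁ ℓ₂ θ z) (A : Fin 4 → Fin 4) (j : Fin 4) : ∀ᶠ w in 𝓝[≠] θ j, KIntegrand ℓ₂ A θ ![z, w] =
    ∑ p, ∑ q, (if IsPair A 1 2 p q then kConst * kPrefactor θ else 0) *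
      orbitalDet θ p q z w := by
  have h1 : ∀ᶠ w in 𝓝 (θ j), z ≠ w :=
    (isOpen_ne.eventually_mem (hz.ne j).symm).mono fun _ => Ne.symm
  have h2 : ∀ᶠ w in 𝓝 (θ j), z - w ≠ Real.pi * I / 2 :=
    ContinuousAt.eventually_ne (g := fun w => z - w) (by fun_prop) (hz.ne_pole j).1
  have h3 : ∀ᶠ w in 𝓝 (θ j), w - z ≠ Real.pi * I / 2 :=
    ContinuousAt.eventually_ne (g := fun w => w - z) (by fun_prop) (hz.ne_pole j).2
  filter_upwards [nhdsWithin_le_nhds h1, nhdsWithin_le_nhds h2, nhdsWithin_le_nhds h3,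
    FirstLevelRegular.eventually h hθ j] with w w1 w2 w3 hw
  exact KIntegrand_eq (hz.secondLevel hw w1 w2 w3) (fun i => (hz.ne_pole i).2)
    (fun i => (hw.ne_pole i).2) A

/-- The inner integration of the first level. -/
theorem inner (h : AdmissibleLines ℓ₁ ℓ₂ θ) (hθ : Unpinched θ) {z : ℂ}
    (hz : FirstLevelRegular ℓ₁ ℓ₂ θ z) (A : Fin 4 → Fin 4) :
    ContourConverges ℓ₁ θ (fun w => KIntegrand ℓ₂ A θ ![z, w]) ∧
    contourIntegral ℓ₁ θ (fun w => KIntegrand ℓ₂ A θ ![z, w]) =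
      ∑ p, ∑ q, (if IsPair A 1 2 p q then kConst * kPrefactor θ else 0) *
        (contourIntegral ℓ₁ θ (orbital θ q 1) * orbital θ p 0 z -
          contourIntegral ℓ₁ θ (orbital θ q 0) * orbital θ p 1 z -
          contourIntegral ℓ₁ θ (orbital θ p 1) * orbital θ q 0 z +
          contourIntegral ℓ₁ θ (orbital θ p 0) * orbital θ q 1 z) := by
  have hd : ∀ p q, ContourConverges ℓ₁ θ (fun w => orbitalDet θ p q z w) ∧
      contourIntegral ℓ₁ θ (fun w => orbitalDet θ p q z w) =
        (contourIntegral ℓ₁ θ (orbital θ q 1) * orbital θ p 0 z -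
          contourIntegral ℓ₁ θ (orbital θ q 0) * orbital θ p 1 z -
          contourIntegral ℓ₁ θ (orbital θ p 1) * orbital θ q 0 z +
          contourIntegral ℓ₁ θ (orbital θ p 0) * orbital θ q 1 z) := fun p q => by
    have e : (fun w => orbitalDet θ p q z w) = fun w =>
        (-orbital θ p 1 z * orbital θ q 0 w + orbital θ p 0 z * orbital θ q 1 w) +
          (orbital θ q 1 z * orbital θ p 0 w + -orbital θ q 0 z * orbital θ p 1 w) := by
      funext w; rw [orbitalDet]; ring
    rw [e]
    obtain ⟨h1, h2⟩ := h.inStrip.orbital_combination hθ q p (-orbital θ p 1 z) (orbital θ p 0 z)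
      (orbital θ q 1 z) (-orbital θ q 0 z)
    exact ⟨h1, h2.trans (by ring)⟩
  have h1 := fun p => ContourConverges.sum Finset.univ fun q _ =>
    (hd p q).1.const_mul (if IsPair A 1 2 p q then kConst * kPrefactor θ else 0)
  have h2 := ContourConverges.sum Finset.univ fun p _ => (h1 p).1
  refine ⟨h2.1.congr (KIntegrand_line h hz A) (KIntegrand_near h hθ hz A), ?_⟩
  rw [contourIntegral_congr (KIntegrand_line h hz A) (KIntegrand_near h hθ hz A), h2.2]
  refine Finset.sum_congr rfl fun p _ => ?_
  rw [(h1 p).2]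
  refine Finset.sum_congr rfl fun q _ => ?_
  rw [contourIntegral_const_mul _ (hd p q).1, (hd p q).2]

end FirstLevelRegular

/-- The factorisation of the K-function into single integrals. -/
theorem KSU4_eq {ℓ₁ ℓ₂ : ℝ} {θ : Fin 4 → ℂ} (h : AdmissibleLines ℓ₁ ℓ₂ θ) (hθ : Unpinched θ)
    (A : Fin 4 → Fin 4) :
    ContourConverges ℓ₁ θ
      (fun z₁ => contourIntegral ℓ₁ θ fun z₂ => KIntegrand ℓ₂ A θ ![z₁, z₂]) ∧
    KSU4 ℓ₁ ℓ₂ A θ = ∑ p, ∑ q, (if IsPair A 1 2 p q then kConst * kPrefactor θ else 0) *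
      (2 * (contourIntegral ℓ₁ θ (orbital θ p 0) * contourIntegral ℓ₁ θ (orbital θ q 1) -
        contourIntegral ℓ₁ θ (orbital θ p 1) * contourIntegral ℓ₁ θ (orbital θ q 0))) := by
  have hd : ∀ p q, ContourConverges ℓ₁ θ (fun z =>
        contourIntegral ℓ₁ θ (orbital θ q 1) * orbital θ p 0 z -
          contourIntegral ℓ₁ θ (orbital θ q 0) * orbital θ p 1 z -
          contourIntegral ℓ₁ θ (orbital θ p 1) * orbital θ q 0 z +
          contourIntegral ℓ₁ θ (orbital θ p 0) * orbital θ q 1 z) ∧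
      contourIntegral ℓ₁ θ (fun z =>
        contourIntegral ℓ₁ θ (orbital θ q 1) * orbital θ p 0 z -
          contourIntegral ℓ₁ θ (orbital θ q 0) * orbital θ p 1 z -
          contourIntegral ℓ₁ θ (orbital θ p 1) * orbital θ q 0 z +
          contourIntegral ℓ₁ θ (orbital θ p 0) * orbital θ q 1 z) =
      2 * (contourIntegral ℓ₁ θ (orbital θ p 0) * contourIntegral ℓ₁ θ (orbital θ q 1) -
        contourIntegral ℓ₁ θ (orbital θ p 1) * contourIntegral ℓ₁ θ (orbital θ q 0)) := by
    intro p q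
    -- The coefficients are the inner integrals. After the outer integration the four terms agree in
    -- pairs, which produces the factor 2.
    obtain ⟨h1, h2⟩ := h.inStrip.orbital_combination hθ p q (contourIntegral ℓ₁ θ (orbital θ q 1))
      (-contourIntegral ℓ₁ θ (orbital θ q 0)) (-contourIntegral ℓ₁ θ (orbital θ p 1))
      (contourIntegral ℓ₁ θ (orbital θ p 0))
    have e : (fun z => contourIntegral ℓ₁ θ (orbital θ q 1) * orbital θ p 0 z -
          contourIntegral ℓ₁ θ (orbital θ q 0) * orbital θ p 1 z -
          contourIntegral ℓ₁ θ (orbital θ p 1) * orbital θ q 0 z +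
          contourIntegral ℓ₁ θ (orbital θ p 0) * orbital θ q 1 z) = fun z =>
        (contourIntegral ℓ₁ θ (orbital θ q 1) * orbital θ p 0 z +
          -contourIntegral ℓ₁ θ (orbital θ q 0) * orbital θ p 1 z) +
          (-contourIntegral ℓ₁ θ (orbital θ p 1) * orbital θ q 0 z +
          contourIntegral ℓ₁ θ (orbital θ p 0) * orbital θ q 1 z) := by
      funext z; ring
    rw [e]
    exact ⟨h1, h2.trans (by ring)⟩
  have h1 := fun p => ContourConverges.sum Finset.univ fun q _ =>
    (hd p q).1.const_mul (if IsPair A 1 2 p q then kConst * kPrefactor θ else 0)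
  have h2 := ContourConverges.sum Finset.univ fun p _ => (h1 p).1
  have e1 := Eventually.of_forall (f := ae (volume : Measure ℝ)) fun x : ℝ =>
    (FirstLevelRegular.inner h hθ (FirstLevelRegular.of_line h x) A).2
  have e2 := fun j => (FirstLevelRegular.eventually h hθ j).mono fun z hz =>
    (FirstLevelRegular.inner h hθ hz A).2
  refine ⟨h2.1.congr e1 e2, ?_⟩
  rw [KSU4, contourIntegral_congr e1 e2, h2.2]
  refine Finset.sum_congr rfl fun p _ => ?_
  rw [(h1 p).2]
  refine Finset.sum_congr rfl fun q _ => ?_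
  rw [contourIntegral_const_mul _ (hd p q).1, (hd p q).2]

/-- All integrations that define the K-function exist. -/
theorem kConverges {ℓ₁ ℓ₂ : ℝ} {θ : Fin 4 → ℂ} (h : AdmissibleLines ℓ₁ ℓ₂ θ) (hθ : Unpinched θ)
    (A : Fin 4 → Fin 4) : KConverges ℓ₁ ℓ₂ A θ :=
  ⟨fun B _ h0 h1 h2 h3 => (SecondLevelRegular.mk h0 h1 h2 h3).K1_contourConverges B,
    fun x => (FirstLevelRegular.inner h hθ (FirstLevelRegular.of_line h x) A).1,
    fun i => (FirstLevelRegular.eventually h hθ i).mono fun _ hz =>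
      (FirstLevelRegular.inner h hθ hz A).1,
    (KSU4_eq h hθ A).1⟩

/-! ### The singularities at the bound state -/

/-- The rapidities in a neighbourhood of which the only singularities of the form factor are the
bound state poles in `θ_12` and `θ_34`. -/
structure PairRegular (ℓ₁ ℓ₂ : ℝ) (θ : Fin 4 → ℂ) : Prop where
  lines : AdmissibleLines ℓ₁ ℓ₂ θ
  ne : ∀ i j, i ≠ j → θ i ≠ θ j
  ne_pole : ∀ i j, i ≠ j → ¬(i = 0 ∧ j = 1) → ¬(i = 2 ∧ j = 3) → θ i - θ j ≠ Real.pi * I / 2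
  sum_exp : ∑ i, exp (θ i) ≠ 0

namespace PairRegular

variable {ℓ₁ ℓ₂ : ℝ} {θ : Fin 4 → ℂ}

theorem ne_pole' (h : PairRegular ℓ₁ ℓ₂ θ) {i j : Fin 4} (h1 : ¬(i = 0 ∧ j = 1))
    (h2 : ¬(i = 2 ∧ j = 3)) : θ i - θ j ≠ Real.pi * I / 2 := by
  by_cases hij : i = j
  · rw [hij, sub_self]
    have : (Real.pi * I / 2 : ℂ) ≠ 0 := by simp [Real.pi_ne_zero]
    exact this.symm
  · exact h.ne_pole i j hij h1 h2

theorem unpinched (h : PairRegular ℓ₁ ℓ₂ θ) (h1 : θ 0 - θ 1 ≠ Real.pi * I / 2)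
    (h2 : θ 2 - θ 3 ≠ Real.pi * I / 2) : Unpinched θ := fun i j hij => by
  refine ⟨h.ne i j hij, ?_⟩
  by_cases c1 : i = 0 ∧ j = 1
  · rwa [c1.1, c1.2]
  by_cases c2 : i = 2 ∧ j = 3
  · rwa [c2.1, c2.2]
  exact h.ne_pole i j hij c1 c2

theorem eventually (h : PairRegular ℓ₁ ℓ₂ θ) : ∀ᶠ θ' in 𝓝 θ, PairRegular ℓ₁ ℓ₂ θ' := by
  have him : ∀ i, ContinuousAt (fun θ' : Fin 4 → ℂ => (θ' i).im) θ := fun i =>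
    (Complex.continuous_im.comp (continuous_apply i)).continuousAt
  have h1 : ∀ᶠ θ' in 𝓝 θ, ∀ i, ℓ₁ + Real.pi / 2 < (θ' i).im := eventually_all.2 fun i =>
    (him i).eventually (lt_mem_nhds (h.lines.1 i))
  have h2 : ∀ᶠ θ' in 𝓝 θ, ∀ i, (θ' i).im < ℓ₂ + 2 * Real.pi := eventually_all.2 fun i =>
    (him i).eventually (gt_mem_nhds (h.lines.2.2 i))
  have h3 : ∀ᶠ θ' in 𝓝 θ, ∀ i j, i ≠ j → θ' i ≠ θ' j := eventually_all.2 fun i =>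
    eventually_all.2 fun j => by
      by_cases hij : i = j
      · simp [hij]
      · filter_upwards [ContinuousAt.eventually_ne (g := fun θ' : Fin 4 → ℂ => θ' i - θ' j)
          (by fun_prop) (sub_ne_zero.2 (h.ne i j hij))] with θ' h' _ using sub_ne_zero.1 h'
  have h4 : ∀ᶠ θ' in 𝓝 θ, ∀ i j, i ≠ j → ¬(i = 0 ∧ j = 1) → ¬(i = 2 ∧ j = 3) →
      θ' i - θ' j ≠ Real.pi * I / 2 := eventually_all.2 fun i => eventually_all.2 fun j => by
    by_cases c1 : i = 0 ∧ j = 1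
    · simp [c1]
    by_cases c2 : i = 2 ∧ j = 3
    · simp [c2]
    filter_upwards [ContinuousAt.eventually_ne (g := fun θ' : Fin 4 → ℂ => θ' i - θ' j)
      (by fun_prop) (h.ne_pole' c1 c2)] with θ' h' _ _ _ using h'
  have h5 : ∀ᶠ θ' in 𝓝 θ, ∑ i, exp (θ' i) ≠ 0 :=
    ContinuousAt.eventually_ne (g := fun θ' : Fin 4 → ℂ => ∑ i, exp (θ' i))
      (continuous_finsetSum _ fun i _ =>
        Complex.continuous_exp.comp (continuous_apply i)).continuousAt h.sum_exp
  filter_upwards [h1, h2, h3, h4, h5] with θ' h1 h2 h3 h4 h5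
  exact ⟨⟨h1, h.lines.2.1, h2⟩, h3, h4, h5⟩

end PairRegular

/-- The wave function of a magnon at site p involves only the sites up to p, so only these
differences must avoid iπ/2. -/
theorem analyticAt_orbitalRes {ℓ : ℝ} {θ : ℂ → Fin 4 → ℂ} {u : ℂ}
    (hθ : ∀ i, AnalyticAt ℂ (fun u => θ u i) u) (hs : InStrip ℓ (θ u))
    (hne : ∀ i j, i ≠ j → θ u i ≠ θ u j) {p j : Fin 4} (k : ℕ)
    (h : ∀ i ≤ p, θ u i - θ u j ≠ Real.pi * I / 2) :
    AnalyticAt ℂ (fun u => orbitalRes (θ u) p k j) u := by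
  have hm := analyticAt_magnon hθ (hθ j) h
  have hj := hθ j
  have hp : AnalyticAt ℂ (fun u => ∏ i ∈ Finset.univ.erase j, phiT (θ u i - θ u j)) u := by
    refine Finset.analyticAt_fun_prod _ fun i hi => ?_
    have hb := hs.xvar_sub_re i j
    exact (analyticAt_phiT (sub_ne_zero.2 (hne i j (Finset.ne_of_mem_erase hi))) (by linarith)
      (by linarith)).comp_of_eq ((hθ i).sub (hθ j)) rfl
  unfold orbitalRes
  fun_prop

/-- The part of the contour integral of an orbital that is regular at the bound state. -/
def regularPart (ℓ : ℝ) (p : Fin 4) (k : ℕ) (θ : Fin 4 → ℂ) : ℂ :=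
  (∫ x : ℝ, orbital θ p k (x + ℓ * I)) - 2 * Real.pi * I *
    (orbitalRes θ p k 0 + orbitalRes θ p k 2 + if p ≤ 1 then orbitalRes θ p k 3 else 0)

/-- The coefficient of the pole in `θ_12`. -/
def leftPole (p : Fin 4) (k : ℕ) (θ : Fin 4 → ℂ) : ℂ :=
  -(2 * Real.pi * I) * (2 * Real.pi * I * Gamma (3 / 4) *
    (∏ i ∈ Finset.univ.erase 1, phiT (θ i - θ 1))) * exp (-(k * θ 1)) *
    ![-(Real.pi * I / 2), θ 0 - θ 1, 0, 0] p

/-- The coefficient of the pole in `θ_34`. -/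
def rightPole (p : Fin 4) (k : ℕ) (θ : Fin 4 → ℂ) : ℂ :=
  -(2 * Real.pi * I) * (2 * Real.pi * I * Gamma (3 / 4) *
    (∏ i ∈ Finset.univ.erase 3, phiT (θ i - θ 3))) * exp (-(k * θ 3)) *
    (bT (θ 0 - θ 3) * bT (θ 1 - θ 3) * ![0, 0, -(Real.pi * I / 2), θ 2 - θ 3] p)

theorem bT_zero : bT 0 = 0 := by simp [bT]

theorem cT_zero : cT 0 = 1 := by
  rw [cT, zero_sub, div_self]; simp [Real.pi_ne_zero]

/-- Among the line integral and the four residues, only the residues at θ 1 and θ 3 contain b̃ or c̃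
at θ₀₁ or θ₂₃. The values b̃(0) = 0 and c̃(0) = 1 make their dependence on p explicit. -/
theorem PairRegular.contourIntegral_orbital {ℓ₁ ℓ₂ : ℝ} {θ : Fin 4 → ℂ}
    (h : PairRegular ℓ₁ ℓ₂ θ) (h1 : θ 0 - θ 1 ≠ Real.pi * I / 2)
    (h2 : θ 2 - θ 3 ≠ Real.pi * I / 2) (p : Fin 4) (k : ℕ) :
    contourIntegral ℓ₁ θ (orbital θ p k) = regularPart ℓ₁ p k θ +
      leftPole p k θ / (θ 0 - θ 1 - Real.pi * I / 2) +
      rightPole p k θ / (θ 2 - θ 3 - Real.pi * I / 2) := by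
  have hl : -(2 * Real.pi * I) * orbitalRes θ p k 1 =
      leftPole p k θ / (θ 0 - θ 1 - Real.pi * I / 2) := by
    -- A magnon beyond site 1 must pass site 1 with weight b̃(0) = 0, so only p = 0 and p = 1
    -- contribute.
    have hm : magnon θ (θ 1) p = ![-(Real.pi * I / 2), θ 0 - θ 1, 0, 0] p /
        (θ 0 - θ 1 - Real.pi * I / 2) := by
      fin_cases p <;>
        simp [magnon, Fin.prod_univ_four, bT_zero, cT_zero]
      · rw [cT, neg_div]
      · rw [bT]
    rw [orbitalRes, leftPole, hm]
    ring
  have hr : -(2 * Real.pi * I) * (orbitalRes θ p k 3 - if p ≤ 1 then orbitalRes θ p k 3 else 0) =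
      rightPole p k θ / (θ 2 - θ 3 - Real.pi * I / 2) := by
    -- For p ≤ 1 the wave function never reaches the pair 2, 3, so the residue at θ 3 has no pole
    -- and is counted in the regular part.
    by_cases hp : p ≤ 1
    · have hm : ![0, 0, -(Real.pi * I / 2), θ 2 - θ 3] p = 0 := by
        fin_cases p <;> simp at hp ⊢
      rw [rightPole, hm, if_pos hp]
      ring
    · have hm : magnon θ (θ 3) p = bT (θ 0 - θ 3) * bT (θ 1 - θ 3) *
          ![0, 0, -(Real.pi * I / 2), θ 2 - θ 3] p / (θ 2 - θ 3 - Real.pi * I / 2) := by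
        fin_cases p <;> simp at hp <;>
          simp [magnon, Fin.prod_univ_four, cT_zero]
        · rw [cT]; ring
        · rw [bT.eq_1 (θ 2 - θ 3)]; ring
      rw [orbitalRes, rightPole, hm, if_neg hp]
      ring
  rw [h.lines.inStrip.contourIntegral_orbital (h.unpinched h1 h2), Fin.sum_univ_four, regularPart,
    ← hl, ← hr]
  ring

/-- The factor by which the determinants of the single integrals are multiplied. -/
def formFactorPrefactor (θ : Fin 4 → ℂ) : ℂ :=
  2 * kConst * kPrefactor θ * ∏ i, ∏ j ∈ Finset.univ.filter (fun j => i < j), FSU4 (θ i - θ j)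

/-! ### Analytic dependence of the regular parts, the pole coefficients and the prefactor on a
parameter. -/

section Analytic

variable {ℓ₁ ℓ₂ : ℝ} {θ : ℂ → Fin 4 → ℂ} {u : ℂ}

theorem analyticAt_regularPart (hθ : ∀ i, AnalyticAt ℂ (fun u => θ u i) u)
    (h : PairRegular ℓ₁ ℓ₂ (θ u)) (p : Fin 4) {k : ℕ} (hk : k ≤ 1) :
    AnalyticAt ℂ (fun u => regularPart ℓ₁ p k (θ u)) u := by
  have hs := h.lines.inStrip
  have hl := hs.analyticAt_integral_orbital hθ p hk
  have h0 : AnalyticAt ℂ (fun u => orbitalRes (θ u) p k 0) u :=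
    analyticAt_orbitalRes hθ hs h.ne k fun i _ => h.ne_pole' (by simp) (by simp)
  have h2 : AnalyticAt ℂ (fun u => orbitalRes (θ u) p k 2) u :=
    analyticAt_orbitalRes hθ hs h.ne k fun i _ => h.ne_pole' (by simp) (by simp)
  have h3 : AnalyticAt ℂ (fun u => if p ≤ 1 then orbitalRes (θ u) p k 3 else 0) u := by
    by_cases hp : p ≤ 1
    · simp only [hp, if_true]
      refine analyticAt_orbitalRes hθ hs h.ne k fun i hi => h.ne_pole' (by simp) fun h' => ?_
      rw [h'.1] at hi
      exact absurd (hi.trans hp) (by decide)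
    · simp only [hp, if_false]
      exact analyticAt_const
  exact hl.sub (analyticAt_const.mul ((h0.add h2).add h3))

theorem analyticAt_prod_phiT (hθ : ∀ i, AnalyticAt ℂ (fun u => θ u i) u)
    (h : PairRegular ℓ₁ ℓ₂ (θ u)) (j : Fin 4) :
    AnalyticAt ℂ (fun u => ∏ i ∈ Finset.univ.erase j, phiT (θ u i - θ u j)) u := by
  refine Finset.analyticAt_fun_prod _ fun i hi => ?_
  have hb := h.lines.inStrip.xvar_sub_re i j
  exact (analyticAt_phiT (sub_ne_zero.2 (h.ne i j (Finset.ne_of_mem_erase hi))) (by linarith)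
    (by linarith)).comp_of_eq ((hθ i).sub (hθ j)) rfl

theorem analyticAt_leftPole (hθ : ∀ i, AnalyticAt ℂ (fun u => θ u i) u)
    (h : PairRegular ℓ₁ ℓ₂ (θ u)) (p : Fin 4) (k : ℕ) :
    AnalyticAt ℂ (fun u => leftPole p k (θ u)) u := by
  have h1 := analyticAt_prod_phiT hθ h 1
  have h2 := hθ 1
  have h3 : AnalyticAt ℂ (fun u => ![-(Real.pi * I / 2), θ u 0 - θ u 1, 0, 0] p) u := by
    have := (hθ 0).sub (hθ 1)
    fin_cases p
    exacts [analyticAt_const, this, analyticAt_const, analyticAt_const]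
  unfold leftPole
  fun_prop

theorem analyticAt_rightPole (hθ : ∀ i, AnalyticAt ℂ (fun u => θ u i) u)
    (h : PairRegular ℓ₁ ℓ₂ (θ u)) (p : Fin 4) (k : ℕ) :
    AnalyticAt ℂ (fun u => rightPole p k (θ u)) u := by
  have h1 := analyticAt_prod_phiT hθ h 3
  have h2 := hθ 3
  have h3 : AnalyticAt ℂ (fun u => ![0, 0, -(Real.pi * I / 2), θ u 2 - θ u 3] p) u := by
    have := (hθ 2).sub (hθ 3)
    fin_cases p
    exacts [analyticAt_const, analyticAt_const, analyticAt_const, this]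
  have h4 : AnalyticAt ℂ (fun u => bT (θ u 0 - θ u 3)) u :=
    (analyticAt_bT (h.ne_pole' (by simp) (by simp))).comp_of_eq ((hθ 0).sub (hθ 3)) rfl
  have h5 : AnalyticAt ℂ (fun u => bT (θ u 1 - θ u 3)) u :=
    (analyticAt_bT (h.ne_pole' (by simp) (by simp))).comp_of_eq ((hθ 1).sub (hθ 3)) rfl
  unfold rightPole
  fun_prop

theorem analyticAt_FSU4 {w : ℂ} (h1 : -3 / 4 < (xvar w).re) (h2 : (xvar w).re < 7 / 4) :
    AnalyticAt ℂ FSU4 w := by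
  have hx := differentiable_xvar.analyticAt w
  have hG := fun z => differentiable_barnesG.analyticAt z
  have n1 : barnesG (3 / 4 + xvar w) ≠ 0 := barnesG_ne_zero fun k hk => by
    have := congrArg re hk
    have hm : (0 : ℝ) ≤ k := k.cast_nonneg
    simp at this; norm_num at this; linarith
  have n2 : barnesG (7 / 4 - xvar w) ≠ 0 := barnesG_ne_zero fun k hk => by
    have := congrArg re hk
    have hm : (0 : ℝ) ≤ k := k.cast_nonneg
    simp at this; norm_num at this; linarith
  unfold FSU4
  exact (((hG _).comp_of_eq hx rfl).mul ((hG _).comp_of_eq (analyticAt_const.sub hx) rfl)).div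
    (((hG _).comp_of_eq (analyticAt_const.add hx) rfl).mul
      ((hG _).comp_of_eq (analyticAt_const.sub hx) rfl)) (mul_ne_zero n1 n2)

theorem analyticAt_formFactorPrefactor (hθ : ∀ i, AnalyticAt ℂ (fun u => θ u i) u)
    (h : PairRegular ℓ₁ ℓ₂ (θ u)) : AnalyticAt ℂ (fun u => formFactorPrefactor (θ u)) u := by
  have h1 : AnalyticAt ℂ (fun u => kPrefactor (θ u)) u := by
    have hs : AnalyticAt ℂ (fun u => ∑ i, θ u i) u := Finset.analyticAt_fun_sum _ fun i _ => hθ i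
    have he : AnalyticAt ℂ (fun u => ∑ i, exp (θ u i)) u :=
      Finset.analyticAt_fun_sum _ fun i _ => (hθ i).cexp
    exact AnalyticAt.div (by fun_prop) he h.sum_exp
  refine (analyticAt_const.mul h1).mul (Finset.analyticAt_fun_prod _ fun i _ =>
    Finset.analyticAt_fun_prod _ fun j _ => ?_)
  have hb := h.lines.inStrip.xvar_sub_re i j
  exact (analyticAt_FSU4 (by linarith) (by linarith)).comp_of_eq ((hθ i).sub (hθ j)) rfl

end Analytic

/-- The coefficient is e^{-kθ₃} times a function of the site, so the matrix in (p, k) has rank one.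
This excludes a double pole in θ₂₃. -/
theorem pole_mul_comm (p q : Fin 4) (θ : Fin 4 → ℂ) :
    rightPole p 0 θ * rightPole q 1 θ - rightPole p 1 θ * rightPole q 0 θ = 0 := by
  unfold rightPole; ring

/-! ### The iterated residue -/

theorem analyticAt_pairRapidities_right (ω₁ ω₂ s t : ℂ) (i : Fin 4) :
    AnalyticAt ℂ (fun t => pairRapidities ω₁ ω₂ s t i) t := by
  fin_cases i <;> simp only [pairRapidities] <;> simp <;> fun_prop

theorem analyticAt_pairRapidities_left (ω₁ ω₂ s t : ℂ) (i : Fin 4) :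
    AnalyticAt ℂ (fun s => pairRapidities ω₁ ω₂ s t i) s := by
  fin_cases i <;> simp only [pairRapidities] <;> simp <;> fun_prop

theorem continuous_pairRapidities (ω₁ ω₂ : ℂ) :
    Continuous fun x : ℂ × ℂ => pairRapidities ω₁ ω₂ x.1 x.2 := by
  refine continuous_pi fun i => ?_
  fin_cases i <;> simp only [pairRapidities] <;> simp <;> fun_prop

theorem pairRapidities_sub_left (ω₁ ω₂ s t : ℂ) :
    pairRapidities ω₁ ω₂ s t 0 - pairRapidities ω₁ ω₂ s t 1 = s := by
  simp [pairRapidities]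

theorem pairRapidities_sub_right (ω₁ ω₂ s t : ℂ) :
    pairRapidities ω₁ ω₂ s t 2 - pairRapidities ω₁ ω₂ s t 3 = t := by
  simp [pairRapidities]

/-- `2 Σ ε_{pq} (X⁰_p Y¹_q + Y⁰_p X¹_q - X¹_p Y⁰_q - Y¹_p X⁰_q)` where `ε` selects the positions of
the flipped weights. -/
def pairForm (A : Fin 4 → Fin 4) (X Y : Fin 4 → ℕ → ℂ) : ℂ :=
  ∑ p, ∑ q, (if IsPair A 1 2 p q then 1 else 0) *
    (X p 0 * Y q 1 + Y p 0 * X q 1 - X p 1 * Y q 0 - Y p 1 * X q 0)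

theorem analyticAt_pairForm (A : Fin 4 → Fin 4) {X Y : ℂ → Fin 4 → ℕ → ℂ} {u : ℂ}
    (hX : ∀ p k, k ≤ 1 → AnalyticAt ℂ (fun u => X u p k) u)
    (hY : ∀ p k, k ≤ 1 → AnalyticAt ℂ (fun u => Y u p k) u) :
    AnalyticAt ℂ (fun u => pairForm A (X u) (Y u)) u := by
  refine Finset.analyticAt_fun_sum _ fun p _ => Finset.analyticAt_fun_sum _ fun q _ => ?_
  have x0 := fun p => hX p 0 zero_le_one
  have x1 := fun p => hX p 1 le_rfl
  have y0 := fun p => hY p 0 zero_le_one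
  have y1 := fun p => hY p 1 le_rfl
  exact analyticAt_const.mul (((((x0 p).mul (y1 q)).add ((y0 p).mul (x1 q))).sub
    ((x1 p).mul (y0 q))).sub ((y1 p).mul (x0 q)))

/-- The determinant is bilinear in the decomposition into a part regular in θ₂₃ and the pole. The
pole-pole term vanishes, so one power of the denominator remains and the numerator is regular at the
bound state. -/
theorem formFactorSU4_eq {ℓ₁ ℓ₂ : ℝ} {θ : Fin 4 → ℂ} (h : PairRegular ℓ₁ ℓ₂ θ)
    (h1 : θ 0 - θ 1 ≠ Real.pi * I / 2) (h2 : θ 2 - θ 3 ≠ Real.pi * I / 2) (A : Fin 4 → Fin 4) :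
    formFactorSU4 ℓ₁ ℓ₂ A θ = formFactorPrefactor θ *
      ((θ 2 - θ 3 - Real.pi * I / 2) / 2 * pairForm A
        (fun p k => regularPart ℓ₁ p k θ + leftPole p k θ / (θ 0 - θ 1 - Real.pi * I / 2))
        (fun p k => regularPart ℓ₁ p k θ + leftPole p k θ / (θ 0 - θ 1 - Real.pi * I / 2)) +
      pairForm A
        (fun p k => regularPart ℓ₁ p k θ + leftPole p k θ / (θ 0 - θ 1 - Real.pi * I / 2))
        (fun p k => rightPole p k θ)) / (θ 2 - θ 3 - Real.pi * I / 2) := by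
  have ht : θ 2 - θ 3 - Real.pi * I / 2 ≠ 0 := sub_ne_zero.2 h2
  rw [formFactorSU4, (KSU4_eq h.lines (h.unpinched h1 h2) A).2, formFactorPrefactor]
  simp only [h.contourIntegral_orbital h1 h2, pairForm]
  have hx : (θ 2 - θ 3 - Real.pi * I / 2) * (θ 2 - θ 3 - Real.pi * I / 2)⁻¹ = 1 :=
    mul_inv_cancel₀ ht
  rw [eq_div_iff ht]
  simp only [div_eq_mul_inv _ (θ 2 - θ 3 - Real.pi * I / 2)]
  generalize (θ 2 - θ 3 - Real.pi * I / 2)⁻¹ = x at *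
  generalize θ 2 - θ 3 - Real.pi * I / 2 = d at *
  simp only [Finset.sum_mul, Finset.mul_sum, ← Finset.sum_add_distrib]
  refine Finset.sum_congr rfl fun p _ => Finset.sum_congr rfl fun q _ => ?_
  have hc := pole_mul_comm p q θ
  generalize regularPart ℓ₁ p 0 θ + leftPole p 0 θ / (θ 0 - θ 1 - Real.pi * I / 2) = U0p
  generalize regularPart ℓ₁ p 1 θ + leftPole p 1 θ / (θ 0 - θ 1 - Real.pi * I / 2) = U1p
  generalize regularPart ℓ₁ q 0 θ + leftPole q 0 θ / (θ 0 - θ 1 - Real.pi * I / 2) = U0q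
  generalize regularPart ℓ₁ q 1 θ + leftPole q 1 θ / (θ 0 - θ 1 - Real.pi * I / 2) = U1q
  generalize rightPole p 0 θ = Y0p at *
  generalize rightPole p 1 θ = Y1p at *
  generalize rightPole q 0 θ = Y0q at *
  generalize rightPole q 1 θ = Y1q at *
  generalize (∏ i, ∏ j ∈ Finset.univ.filter (fun j => i < j), FSU4 (θ i - θ j)) = P
  split_ifs
  · linear_combination 2 * kConst * kPrefactor θ * P *
      ((U0p * Y1q + Y0p * U1q - U1p * Y0q - Y1p * U0q) * hx + d * x ^ 2 * hc)
  · ring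

/-- After the first residue the expression is linear in the part containing the pole in s, so that
pole is simple as well. Only the pairing of the two pole coefficients survives the second residue.
-/
theorem hasBoundStateResidue {ℓ₁ ℓ₂ : ℝ} {ω₁ ω₂ : ℂ}
    (h : PairRegular ℓ₁ ℓ₂ (pairRapidities ω₁ ω₂ (Real.pi * I / 2) (Real.pi * I / 2)))
    (A : Fin 4 → Fin 4) : HasBoundStateResidue (formFactorSU4 ℓ₁ ℓ₂ A) ω₁ ω₂
      (formFactorPrefactor (pairRapidities ω₁ ω₂ (Real.pi * I / 2) (Real.pi * I / 2)) *
        pairForm A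
          (fun p k => leftPole p k (pairRapidities ω₁ ω₂ (Real.pi * I / 2) (Real.pi * I / 2)))
          (fun p k => rightPole p k
            (pairRapidities ω₁ ω₂ (Real.pi * I / 2) (Real.pi * I / 2)))) := by
  set a : ℂ := Real.pi * I / 2 with ha
  have h' : ∀ᶠ x : ℂ × ℂ in 𝓝 (a, a), PairRegular ℓ₁ ℓ₂ (pairRapidities ω₁ ω₂ x.1 x.2) :=
    Tendsto.eventually ((continuous_pairRapidities ω₁ ω₂).tendsto (a, a)) h.eventually
  have hev : ∀ᶠ s in 𝓝 a, ∀ᶠ t in 𝓝 a, PairRegular ℓ₁ ℓ₂ (pairRapidities ω₁ ω₂ s t) :=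
    h'.curry_nhds
  rw [HasBoundStateResidue, ← ha]
  refine ⟨fun s => formFactorPrefactor (pairRapidities ω₁ ω₂ s a) * pairForm A
    (fun p k => regularPart ℓ₁ p k (pairRapidities ω₁ ω₂ s a) +
      leftPole p k (pairRapidities ω₁ ω₂ s a) / (s - a))
    (fun p k => rightPole p k (pairRapidities ω₁ ω₂ s a)), ?_, ?_⟩
  · filter_upwards [nhdsWithin_le_nhds hev, self_mem_nhdsWithin] with s hs hsa
    have hsa' : s ≠ a := hsa
    -- This is the form factor with the simple pole in t cleared; its value at t = a is the inner
    -- residue, because the regular-regular term carries the factor t - a.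
    let g : ℂ → ℂ := fun t => formFactorPrefactor (pairRapidities ω₁ ω₂ s t) *
      ((t - a) / 2 * pairForm A
        (fun p k => regularPart ℓ₁ p k (pairRapidities ω₁ ω₂ s t) +
          leftPole p k (pairRapidities ω₁ ω₂ s t) / (s - a))
        (fun p k => regularPart ℓ₁ p k (pairRapidities ω₁ ω₂ s t) +
          leftPole p k (pairRapidities ω₁ ω₂ s t) / (s - a)) +
      pairForm A
        (fun p k => regularPart ℓ₁ p k (pairRapidities ω₁ ω₂ s t) +
          leftPole p k (pairRapidities ω₁ ω₂ s t) / (s - a))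
        (fun p k => rightPole p k (pairRapidities ω₁ ω₂ s t)))
    have hθ := analyticAt_pairRapidities_right ω₁ ω₂ s a
    have hX : ∀ p k, k ≤ 1 → AnalyticAt ℂ (fun t =>
        regularPart ℓ₁ p k (pairRapidities ω₁ ω₂ s t) +
          leftPole p k (pairRapidities ω₁ ω₂ s t) / (s - a)) a := fun p k hk =>
      (analyticAt_regularPart hθ hs.self_of_nhds p hk).add
        ((analyticAt_leftPole hθ hs.self_of_nhds p k).div_const)
    have hg : AnalyticAt ℂ g a :=
      (analyticAt_formFactorPrefactor hθ hs.self_of_nhds).mul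
        ((AnalyticAt.mul (by fun_prop) (analyticAt_pairForm A hX hX)).add
          (analyticAt_pairForm A hX fun p k _ => analyticAt_rightPole hθ hs.self_of_nhds p k))
    have e : g a = formFactorPrefactor (pairRapidities ω₁ ω₂ s a) * pairForm A
        (fun p k => regularPart ℓ₁ p k (pairRapidities ω₁ ω₂ s a) +
          leftPole p k (pairRapidities ω₁ ω₂ s a) / (s - a))
        (fun p k => rightPole p k (pairRapidities ω₁ ω₂ s a)) := by
      simp [g]
    rw [← e]
    refine HasResidueAt.of_simplePole hg ?_
    filter_upwards [nhdsWithin_le_nhds hs, self_mem_nhdsWithin] with t ht hta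
    rw [formFactorSU4_eq ht (by rwa [pairRapidities_sub_left])
      (by rw [pairRapidities_sub_right]; exact hta), pairRapidities_sub_left,
      pairRapidities_sub_right]
  · clear_value a
    -- Here the factor s - a multiplies the regular part, which therefore drops out at s = a.
    let g : ℂ → ℂ := fun s => formFactorPrefactor (pairRapidities ω₁ ω₂ s a) * pairForm A
      (fun p k => (s - a) * regularPart ℓ₁ p k (pairRapidities ω₁ ω₂ s a) +
        leftPole p k (pairRapidities ω₁ ω₂ s a))
      (fun p k => rightPole p k (pairRapidities ω₁ ω₂ s a))
    have hθ := fun i => analyticAt_pairRapidities_left ω₁ ω₂ a a i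
    have hX : ∀ p k, k ≤ 1 → AnalyticAt ℂ (fun s =>
        (s - a) * regularPart ℓ₁ p k (pairRapidities ω₁ ω₂ s a) +
          leftPole p k (pairRapidities ω₁ ω₂ s a)) a := fun p k hk =>
      (AnalyticAt.mul (by fun_prop) (analyticAt_regularPart hθ h p hk)).add
        (analyticAt_leftPole hθ h p k)
    have hg : AnalyticAt ℂ g a :=
      (analyticAt_formFactorPrefactor hθ h).mul
        (analyticAt_pairForm A hX fun p k _ => analyticAt_rightPole hθ h p k)
    have e : g a = formFactorPrefactor (pairRapidities ω₁ ω₂ a a) * pairForm A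
        (fun p k => leftPole p k (pairRapidities ω₁ ω₂ a a))
        (fun p k => rightPole p k (pairRapidities ω₁ ω₂ a a)) := by
      simp [g]
    rw [← e]
    refine HasResidueAt.of_simplePole hg ?_
    filter_upwards [self_mem_nhdsWithin] with s hs
    have hsa : s - a ≠ 0 := sub_ne_zero.2 hs
    simp only [g, pairForm, mul_div_assoc, Finset.sum_div]
    congr 1
    refine Finset.sum_congr rfl fun p _ => Finset.sum_congr rfl fun q _ => ?_
    congr 1
    field_simp

/-! ### The two-particle form factor at the bound state -/

/-- The real part is cosh(Re δ/2) cos(Im δ/2), and the cosine is positive for |Im δ| < π/2. -/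
theorem cosh_half_ne_zero {δ : ℂ} (h : |δ.im| < Real.pi / 2) : cosh (δ / 2) ≠ 0 := by
  intro h0
  have h1 := congrArg re h0
  obtain ⟨h2, h3⟩ := abs_lt.1 h
  have e : δ / 2 = (δ.re / 2 : ℝ) + (δ.im / 2 : ℝ) * I := by
    nth_rewrite 1 [← re_add_im δ]; push_cast; ring
  rw [e, Complex.cosh_add, Complex.cosh_mul_I, Complex.sinh_mul_I, ← Complex.ofReal_cosh,
    ← Complex.ofReal_cos, ← Complex.ofReal_sinh, ← Complex.ofReal_sin] at h1
  simp [-Complex.ofReal_cosh, -Complex.ofReal_cos, -Complex.ofReal_sinh, -Complex.ofReal_sin,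
    -Complex.ofReal_div] at h1
  rcases h1 with h1 | h1
  · exact (Real.cosh_pos _).ne' h1
  · exact (Real.cos_pos_of_mem_Ioo ⟨by linarith, by linarith⟩).ne' h1

theorem cosh_quarter_ne_zero : cosh (Real.pi * I / 2 / 2) ≠ 0 := by
  have e : (Real.pi * I / 2 / 2 : ℂ) = (Real.pi / 4 : ℝ) * I := by push_cast; ring
  rw [e, Complex.cosh_mul_I, ← Complex.ofReal_cos, Real.cos_pi_div_four]
  simp

theorem sum_exp_pairRapidities (ω₁ ω₂ a : ℂ) : ∑ i, exp (pairRapidities ω₁ ω₂ a a i) =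
    4 * cosh (a / 2) * exp ((ω₁ + ω₂) / 2) * cosh ((ω₁ - ω₂) / 2) := by
  have e1 : exp ω₁ = exp ((ω₁ + ω₂) / 2) * exp ((ω₁ - ω₂) / 2) := by
    rw [← Complex.exp_add]; ring_nf
  have e2 : exp ω₂ = exp ((ω₁ + ω₂) / 2) * exp (-((ω₁ - ω₂) / 2)) := by
    rw [← Complex.exp_add]; ring_nf
  simp only [Fin.sum_univ_four, pairRapidities, Matrix.cons_val, Complex.exp_add, sub_eq_add_neg,
    Complex.cosh] at e1 e2 ⊢
  rw [e1, e2]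
  ring

/-- Most coincidences are excluded by imaginary parts, using |Im(ω₁ - ω₂)| < π/2. The exceptions,
such as θ 0 = θ 2 or θ 0 - θ 3 = iπ/2, would force ω₁ = ω₂. The sum of exponentials contains the
factor cosh((ω₁ - ω₂)/2). -/
theorem pairRegular_boundState {ℓ₁ ℓ₂ : ℝ} {ω₁ ω₂ : ℂ} (hω : (ω₁, ω₂) ∈ rapidityDomain)
    (h : AdmissibleLines ℓ₁ ℓ₂ (pairRapidities ω₁ ω₂ (Real.pi * I / 2) (Real.pi * I / 2))) :
    PairRegular ℓ₁ ℓ₂ (pairRapidities ω₁ ω₂ (Real.pi * I / 2) (Real.pi * I / 2)) := by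
  obtain ⟨hne, him⟩ := hω
  simp only at hne him
  have hpi := Real.pi_pos
  obtain ⟨h2, h3⟩ := abs_lt.1 him
  rw [sub_im] at h2 h3
  have hp : (Real.pi * I / 2 : ℂ).im = Real.pi / 2 := by simp
  have hp4 : (Real.pi * I / 2 / 2 : ℂ).im = Real.pi / 4 := by
    have : (Real.pi * I / 2 / 2 : ℂ) = (Real.pi / 4 : ℝ) * I := by push_cast; ring
    rw [this]; simp
  refine ⟨h, ?_, ?_, ?_⟩
  · intro i j hij h0
    have h1 := congrArg im h0
    fin_cases i <;> fin_cases j <;>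
      simp [pairRapidities, -Complex.div_ofNat_im, hp4] at hij h0 h1 <;>
      first | exact hne h0 | exact hne h0.symm | linarith
  · intro i j hij c1 c2 h0
    have h1 := congrArg im h0
    rw [hp] at h1
    fin_cases i <;> fin_cases j <;>
      simp [pairRapidities, -Complex.div_ofNat_im, hp4] at hij c1 c2 h1 <;>
      first
        | linarith
        | exact hne (by simp [pairRapidities] at h0; linear_combination h0)
        | exact hne (by simp [pairRapidities] at h0; linear_combination -h0)
  · have e : ∑ i, exp (pairRapidities ω₁ ω₂ (Real.pi * I / 2) (Real.pi * I / 2) i) =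
        4 * cosh (Real.pi * I / 2 / 2) * exp ((ω₁ + ω₂) / 2) * cosh ((ω₁ - ω₂) / 2) :=
      sum_exp_pairRapidities _ _ _
    rw [e]
    refine mul_ne_zero (mul_ne_zero (mul_ne_zero (by norm_num) ?_) (Complex.exp_ne_zero _))
      (cosh_half_ne_zero him)
    exact cosh_quarter_ne_zero

/-- The sign of the fusion intertwiner. -/
def fusionSign (A B : Fin 4) (α : Fin 6) : ℤ :=
  (if A = (boundPair α).1 ∧ B = (boundPair α).2 then 1 else 0) -
    (if A = (boundPair α).2 ∧ B = (boundPair α).1 then 1 else 0)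

def fusionConst : ℂ := I * Gamma (3 / 4) * (2 / Real.pi : ℂ) ^ (1 / 4 : ℂ)

theorem fusion_eq (A B : Fin 4) (α : Fin 6) : fusion A B α = fusionConst * fusionSign A B α := by
  simp [fusion, fusionConst, fusionSign]

/-- The dependence of the residue on the colours. -/
def pairSign (A : Fin 4 → Fin 4) : ℤ :=
  ∑ p, ∑ q, (if IsPair A 1 2 p q then 1 else 0) *
    ((![-1, 1, 0, 0] p : ℤ) * ![0, 0, -1, 1] q - ![0, 0, -1, 1] p * ![-1, 1, 0, 0] q)

/-- The identity is between integer functions of four colours and is checked on all 4⁴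
configurations. It shows that the residue has the fused form required by the bound state formula. -/
theorem pairSign_eq (A : Fin 4 → Fin 4) : pairSign A =
    fusionSign (A 0) (A 1) 0 * fusionSign (A 2) (A 3) 1 -
      fusionSign (A 0) (A 1) 1 * fusionSign (A 2) (A 3) 0 := by
  have h : ∀ a b c d : Fin 4, pairSign ![a, b, c, d] =
    fusionSign a b 0 * fusionSign c d 1 - fusionSign a b 1 * fusionSign c d 0 := by
    decide +kernel
  have := h (A 0) (A 1) (A 2) (A 3)
  have e : ![A 0, A 1, A 2, A 3] = A := by ext i; fin_cases i <;> rfl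
  rwa [e] at this

/-- All dependence on ω₁ + ω₂ cancels, so the form factor is Lorentz invariant. The hyperbolic sine
left here is used up in `crossed_product`, and the hyperbolic cosine is the one in the final
formula. -/
theorem kPrefactor_pairRapidities (ω₁ ω₂ : ℂ) {a : ℂ} (ha : cosh (a / 2) ≠ 0)
    (hω : cosh ((ω₁ - ω₂) / 2) ≠ 0) :
    kPrefactor (pairRapidities ω₁ ω₂ a a) *
      (exp (-pairRapidities ω₁ ω₂ a a 3) - exp (-pairRapidities ω₁ ω₂ a a 1)) =
      exp (a / 2) / (2 * cosh (a / 2)) * (sinh ((ω₁ - ω₂) / 2) / cosh ((ω₁ - ω₂) / 2)) := by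
  have e0 : (∑ i, pairRapidities ω₁ ω₂ a a i) / 2 = (ω₁ + ω₂) / 2 + (ω₁ + ω₂) / 2 := by
    simp [Fin.sum_univ_four, pairRapidities]; ring
  have e1 : exp (-pairRapidities ω₁ ω₂ a a 3) =
      exp (-((ω₁ + ω₂) / 2)) * exp ((ω₁ - ω₂) / 2) * exp (a / 2) := by
    rw [← Complex.exp_add, ← Complex.exp_add]
    simp only [pairRapidities, Matrix.cons_val]
    ring_nf
  have e2 : exp (-pairRapidities ω₁ ω₂ a a 1) =
      exp (-((ω₁ + ω₂) / 2)) * exp (-((ω₁ - ω₂) / 2)) * exp (a / 2) := by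
    rw [← Complex.exp_add, ← Complex.exp_add]
    simp only [pairRapidities, Matrix.cons_val]
    ring_nf
  have hs := Complex.exp_ne_zero ((ω₁ + ω₂) / 2)
  rw [kPrefactor, sum_exp_pairRapidities, e0, e1, e2, Complex.exp_add, Complex.exp_neg, Complex.sinh]
  field_simp
  ring

/-- Both pole coefficients are products of a site vector and e^{-kθ}. The form therefore separates
into the difference of the two exponentials and a signed sum over sites. -/
theorem pairForm_pole (A : Fin 4 → Fin 4) (θ : Fin 4 → ℂ) {a : ℂ} (ha : a = Real.pi * I / 2)
    (h1 : θ 0 - θ 1 = a) (h2 : θ 2 - θ 3 = a) :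
    pairForm A (fun p k => leftPole p k θ) (fun p k => rightPole p k θ) =
      ((2 * Real.pi * I) ^ 2 * Gamma (3 / 4)) ^ 2 * a ^ 2 *
      (∏ i ∈ Finset.univ.erase 1, phiT (θ i - θ 1)) *
      (∏ i ∈ Finset.univ.erase 3, phiT (θ i - θ 3)) * (bT (θ 0 - θ 3) * bT (θ 1 - θ 3)) *
      (exp (-θ 3) - exp (-θ 1)) * pairSign A := by
  have hl : ∀ p k, leftPole p k θ = -(2 * Real.pi * I) * (2 * Real.pi * I * Gamma (3 / 4) *
      (∏ i ∈ Finset.univ.erase 1, phiT (θ i - θ 1))) * exp (-(k * θ 1)) *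
      (a * (![-1, 1, 0, 0] p : ℤ)) := fun p k => by
    rw [leftPole, h1, ← ha]
    congr 1
    fin_cases p <;> simp
  have hr : ∀ p k, rightPole p k θ = -(2 * Real.pi * I) * (2 * Real.pi * I * Gamma (3 / 4) *
      (∏ i ∈ Finset.univ.erase 3, phiT (θ i - θ 3))) * exp (-(k * θ 3)) *
      (bT (θ 0 - θ 3) * bT (θ 1 - θ 3) * (a * (![0, 0, -1, 1] p : ℤ))) := fun p k => by
    rw [rightPole, h2, ← ha]
    congr 2
    fin_cases p <;> simp
  rw [pairForm, pairSign, Int.cast_sum, Finset.mul_sum]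
  refine Finset.sum_congr rfl fun p _ => ?_
  rw [Int.cast_sum, Finset.mul_sum]
  refine Finset.sum_congr rfl fun q _ => ?_
  simp only [hl, hr]
  split_ifs
  · push_cast
    simp only [zero_mul, neg_zero, Complex.exp_zero, one_mul]
    ring
  · simp

/-! ### The scalar functions -/

/-- The function to which both the residue and the form factor `F_-` are proportional. -/
def scalarFactor (w : ℂ) : ℂ :=
  FO6 w * Gamma (3 / 4 - xvar w) * Gamma (3 / 4 + xvar w) / (xvar w - 1 / 4)

theorem sinh_eq_sin_xvar (w : ℂ) : sinh (w / 2) = I * sin (Real.pi * xvar w) := by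
  have e : w / 2 = Real.pi * xvar w * I := by linear_combination -(mul_xvar w) / 2
  rw [e, Complex.sinh_mul_I, mul_comm]

theorem sin_pi_ne_zero {x : ℂ} (h0 : 0 < x.re) (h1 : x.re < 1) : sin (Real.pi * x) ≠ 0 := by
  intro h
  obtain ⟨k, hk⟩ := Complex.sin_eq_zero_iff.1 h
  have hpi : (Real.pi : ℂ) ≠ 0 := by exact_mod_cast Real.pi_ne_zero
  have hx : x = k := mul_left_cancel₀ hpi (by rw [hk]; ring)
  rw [hx, Complex.intCast_re] at h0 h1
  have h2 : (0 : ℤ) < k := by exact_mod_cast h0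
  have h3 : k < (1 : ℤ) := by exact_mod_cast h1
  omega

/-- The two hyperbolic sines are sines of π(1/4 ∓ x). The reflection formula trades them for Gamma
functions, which cancel those in the denominator of the minimal form factor. -/
theorem Fminus_eq {w : ℂ} (h0 : -1 / 4 < (xvar w).re) (h1 : (xvar w).re < 1 / 4) :
    Fminus w = -(Gamma (3 / 4) ^ 2 / (FO6 (Real.pi * I) * Real.pi ^ 2)) * scalarFactor w := by
  have hpi : (Real.pi : ℂ) ≠ 0 := by exact_mod_cast Real.pi_ne_zero
  have s1 : sinh ((w - Real.pi * I / 2) / 2) = -(I * sin (Real.pi * (1 / 4 - xvar w))) := by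
    rw [sinh_eq_sin_xvar, xvar_sub, xvar_pi_I_div_two, ← neg_sub, mul_neg, Complex.sin_neg]; ring
  have s2 : sinh ((w + Real.pi * I / 2) / 2) = I * sin (Real.pi * (1 / 4 + xvar w)) := by
    rw [sinh_eq_sin_xvar, xvar_add, xvar_pi_I_div_two, add_comm]
  have n1 : sin (Real.pi * (1 / 4 - xvar w)) ≠ 0 :=
    sin_pi_ne_zero (by simp; linarith) (by simp; linarith)
  have n2 : sin (Real.pi * (1 / 4 + xvar w)) ≠ 0 :=
    sin_pi_ne_zero (by simp; linarith) (by simp; linarith)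
  have r1 := Complex.Gamma_mul_Gamma_one_sub (1 / 4 - xvar w)
  have r2 := Complex.Gamma_mul_Gamma_one_sub (1 / 4 + xvar w)
  have e1 : 1 - (1 / 4 - xvar w) = 3 / 4 + xvar w := by ring
  have e2 : 1 - (1 / 4 + xvar w) = 3 / 4 - xvar w := by ring
  have hx : 1 / 4 - xvar w ≠ 0 := fun h => by
    have := congrArg re h
    simp at this; linarith
  have hx' : xvar w - 1 / 4 ≠ 0 := fun h => hx (by linear_combination -h)
  have e3 : Gamma (5 / 4 - xvar w) = (1 / 4 - xvar w) * Gamma (1 / 4 - xvar w) := by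
    rw [← Gamma_one_add hx]; ring_nf
  have g1 : Gamma (1 / 4 - xvar w) ≠ 0 := Gamma_ne_zero_of_re_pos (by simp; linarith)
  have g2 : Gamma (1 / 4 + xvar w) ≠ 0 := Gamma_ne_zero_of_re_pos (by simp; linarith)
  rw [e1, eq_div_iff n1] at r1
  rw [e2, eq_div_iff n2] at r2
  have e4 : -(1 / 4 - xvar w) = xvar w - 1 / 4 := by ring
  rw [Fminus, FminusMin, s1, s2, e3, scalarFactor]
  have k1 : sin (Real.pi * (1 / 4 - xvar w)) =
      Real.pi / (Gamma (1 / 4 - xvar w) * Gamma (3 / 4 + xvar w)) := by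
    rw [eq_div_iff (mul_ne_zero g1 (Gamma_ne_zero_of_re_pos (by simp; norm_num; linarith)))]
    linear_combination r1
  have k2 : sin (Real.pi * (1 / 4 + xvar w)) =
      Real.pi / (Gamma (1 / 4 + xvar w) * Gamma (3 / 4 - xvar w)) := by
    rw [eq_div_iff (mul_ne_zero g2 (Gamma_ne_zero_of_re_pos (by simp; norm_num; linarith)))]
    linear_combination r2
  have g3 : Gamma (3 / 4 + xvar w) ≠ 0 := Gamma_ne_zero_of_re_pos (by simp; norm_num; linarith)
  have g4 : Gamma (3 / 4 - xvar w) ≠ 0 := Gamma_ne_zero_of_re_pos (by simp; norm_num; linarith)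
  rw [k1, k2, ← e4]
  generalize Gamma (1 / 4 - xvar w) = G1 at *
  generalize Gamma (1 / 4 + xvar w) = G2 at *
  generalize Gamma (3 / 4 + xvar w) = G3 at *
  generalize Gamma (3 / 4 - xvar w) = G4 at *
  generalize 1 / 4 - xvar w = d at *
  generalize FO6 (Real.pi * I) = c
  have hI : I ^ 2 = -1 := I_sq
  -- With the convention 1/0 = 0 both sides vanish if the normalising value is zero, so its
  -- nonvanishing is not needed here.
  by_cases hc : c = 0
  · simp [hc]
  field_simp
  rw [hI]
  ring

theorem barnesG_ne_zero_of_re_pos {z : ℂ} (h : 0 < z.re) : barnesG z ≠ 0 := barnesG_ne_zero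
  fun k hk => by
    have := congrArg re hk
    have hm : (0 : ℝ) ≤ k := k.cast_nonneg
    simp at this; linarith

/-- The four crossed pairs have rapidity differences w, w, w + iπ/2 and w - iπ/2. Most Barnes
functions already match those of the O(6) function; the rest differ by unit shifts of the argument,
which produce the four Gamma factors. -/
theorem FSU4_product {w : ℂ} (hw : w ≠ 0) (h0 : -1 / 4 < (xvar w).re) (h1 : (xvar w).re < 1 / 4) :
    FSU4 w ^ 2 * FSU4 (w + Real.pi * I / 2) * FSU4 (w - Real.pi * I / 2) *
      (Gamma (xvar w) * Gamma (1 - xvar w) * Gamma (xvar w - 1 / 4) * Gamma (3 / 4 - xvar w)) =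
      FO6 w := by
  have hx : xvar w ≠ 0 := fun h => hw (xvar_injective (h.trans (by simp [xvar])))
  have a1 := barnesG_add_one (z := xvar w) (ne_neg_nat_of_re (by linarith) hx)
  have a2 := barnesG_add_one (z := 1 - xvar w) (ne_neg_nat_of_re (by simp; linarith) (fun h => by
    have := congrArg re h; simp at this; linarith))
  have a3 := barnesG_add_one (z := xvar w - 1 / 4) (ne_neg_nat_of_re (by simp; linarith)
    (fun h => by have := congrArg re h; simp at this; linarith))
  have a4 := barnesG_add_one (z := 3 / 4 - xvar w) (ne_neg_nat_of_re (by simp; norm_num; linarith)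
    (fun h => by have := congrArg re h; simp at this; norm_num at this; linarith))
  rw [add_comm] at a1
  have e2 : 1 - xvar w + 1 = 2 - xvar w := by ring
  have e3 : xvar w - 1 / 4 + 1 = 3 / 4 + xvar w := by ring
  have e4 : 3 / 4 - xvar w + 1 = 7 / 4 - xvar w := by ring
  rw [e2] at a2
  rw [e3] at a3
  rw [e4] at a4
  have n1 : barnesG (3 / 4 + xvar w) ≠ 0 :=
    barnesG_ne_zero_of_re_pos (by simp; norm_num; linarith)
  have n2 : barnesG (7 / 4 - xvar w) ≠ 0 :=
    barnesG_ne_zero_of_re_pos (by simp; norm_num; linarith)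
  have n3 : barnesG (1 + xvar w) ≠ 0 := barnesG_ne_zero_of_re_pos (by simp; linarith)
  have n4 : barnesG (3 / 2 - xvar w) ≠ 0 :=
    barnesG_ne_zero_of_re_pos (by simp; norm_num; linarith)
  have n5 : barnesG (1 / 2 + xvar w) ≠ 0 :=
    barnesG_ne_zero_of_re_pos (by simp; norm_num; linarith)
  have n6 : barnesG (2 - xvar w) ≠ 0 := barnesG_ne_zero_of_re_pos (by simp; linarith)
  have f1 : FSU4 (w + Real.pi * I / 2) = barnesG (1 / 4 + xvar w) * barnesG (3 / 4 - xvar w) /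
      (barnesG (1 + xvar w) * barnesG (3 / 2 - xvar w)) := by
    rw [FSU4, xvar_add, xvar_pi_I_div_two]; ring_nf
  have f2 : FSU4 (w - Real.pi * I / 2) = barnesG (xvar w - 1 / 4) * barnesG (5 / 4 - xvar w) /
      (barnesG (1 / 2 + xvar w) * barnesG (2 - xvar w)) := by
    rw [FSU4, xvar_sub, xvar_pi_I_div_two]; ring_nf
  rw [f1, f2, FSU4, FO6]
  generalize barnesG (3 / 4 + xvar w) = B1 at *
  generalize barnesG (7 / 4 - xvar w) = B2 at *
  generalize barnesG (1 + xvar w) = B3 at *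
  generalize barnesG (3 / 2 - xvar w) = B4 at *
  generalize barnesG (1 / 2 + xvar w) = B5 at *
  generalize barnesG (2 - xvar w) = B6 at *
  generalize barnesG (1 / 4 + xvar w) = B7 at *
  generalize barnesG (5 / 4 - xvar w) = B8 at *
  generalize barnesG (xvar w) = B9 at *
  generalize barnesG (1 - xvar w) = B10 at *
  generalize barnesG (xvar w - 1 / 4) = B11 at *
  generalize barnesG (3 / 4 - xvar w) = B12 at *
  generalize Gamma (xvar w) = g1 at *
  generalize Gamma (1 - xvar w) = g2 at *
  generalize Gamma (xvar w - 1 / 4) = g3 at *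
  generalize Gamma (3 / 4 - xvar w) = g4 at *
  have key : B9 * B10 * B11 * B12 * (g1 * g2 * g3 * g4) = B3 * B6 * B1 * B2 := by
    rw [a1, a2, a3, a4]; ring
  clear a1 a2 a3 a4 e2 e3 e4 f1 f2
  field_simp
  linear_combination B9 * B10 * B7 * B8 * key

/-- The factors φ̃ between different pairs, left over from the residues at θ 1 and θ 3, supply the
Gamma functions needed by `FSU4_product`. The hyperbolic sine is removed by reflection against
Γ(-x)Γ(1+x), and the b̃ factors by one functional equation. -/
theorem crossed_product {w : ℂ} (hw : w ≠ 0) (h0 : -1 / 4 < (xvar w).re)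
    (h1 : (xvar w).re < 1 / 4) :
    FSU4 w ^ 2 * FSU4 (w + Real.pi * I / 2) * FSU4 (w - Real.pi * I / 2) *
      (phiT (-(w - Real.pi * I / 2)) * phiT (-w) * phiT (w + Real.pi * I / 2) * phiT w) *
      (bT (w + Real.pi * I / 2) * bT w) * sinh (w / 2) = I * Real.pi * scalarFactor w := by
  have hx : xvar w ≠ 0 := fun h => hw (xvar_injective (h.trans (by simp [xvar])))
  have hx4 : xvar w - 1 / 4 ≠ 0 := fun h => by
    have := congrArg re h; simp at this; linarith
  have hx4' : -(xvar w) - 1 / 4 ≠ 0 := fun h => by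
    have := congrArg re h; simp at this; linarith
  have p1 : phiT (-(w - Real.pi * I / 2)) = Gamma (1 - xvar w) * Gamma (xvar w - 1 / 4) := by
    rw [phiT, xvar_neg, xvar_sub, xvar_pi_I_div_two]; ring_nf
  have p2 : phiT (-w) = Gamma (3 / 4 - xvar w) * Gamma (xvar w) := by
    rw [phiT, xvar_neg]; ring_nf
  have p3 : phiT (w + Real.pi * I / 2) = Gamma (1 + xvar w) * Gamma (-(xvar w) - 1 / 4) := by
    rw [phiT, xvar_add, xvar_pi_I_div_two]; ring_nf
  have p4 : phiT w = Gamma (3 / 4 + xvar w) * Gamma (-xvar w) := rfl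
  have hb : bT (w + Real.pi * I / 2) * bT w = (xvar w + 1 / 4) / (xvar w - 1 / 4) := by
    rw [bT_eq, bT_eq, xvar_add, xvar_pi_I_div_two, add_sub_cancel_right]
    field_simp
  have hs := Complex.Gamma_mul_Gamma_one_sub (-xvar w)
  rw [sub_neg_eq_add, mul_neg, Complex.sin_neg] at hs
  have g0 : Gamma (-xvar w) ≠ 0 :=
    Gamma_ne_zero (ne_neg_nat_of_re (by simp; linarith) (neg_ne_zero.2 hx))
  have g1 : Gamma (1 + xvar w) ≠ 0 := Gamma_ne_zero_of_re_pos (by simp; linarith)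
  have hsin : sin (Real.pi * xvar w) ≠ 0 := fun h => by
    rw [h, neg_zero, div_zero] at hs
    exact mul_ne_zero g0 g1 hs
  rw [eq_div_iff (neg_ne_zero.2 hsin)] at hs
  have h34 : Gamma (3 / 4 - xvar w) = (-(xvar w) - 1 / 4) * Gamma (-(xvar w) - 1 / 4) := by
    rw [← Gamma_one_add hx4']; ring_nf
  have hF := FSU4_product hw h0 h1
  have h34' : (xvar w + 1 / 4) * Gamma (-(xvar w) - 1 / 4) = -Gamma (3 / 4 - xvar w) := by
    rw [h34]; ring
  rw [p1, p2, p3, p4, hb, sinh_eq_sin_xvar, scalarFactor, ← hF]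
  generalize FSU4 w ^ 2 * FSU4 (w + Real.pi * I / 2) * FSU4 (w - Real.pi * I / 2) = F
  have e : (xvar w + 1 / 4) / (xvar w - 1 / 4) = (xvar w + 1 / 4) * (xvar w - 1 / 4)⁻¹ := rfl
  rw [e, div_eq_mul_inv _ (xvar w - 1 / 4)]
  clear h34 hF p1 p2 p3 p4 e hb
  generalize Gamma (1 - xvar w) = G1 at *
  generalize Gamma (xvar w - 1 / 4) = G2 at *
  generalize Gamma (3 / 4 - xvar w) = G3 at *
  generalize Gamma (-xvar w - 1 / 4) = G4 at *
  linear_combination F * (xvar w - 1 / 4)⁻¹ * I * G1 * G2 * G3 * Gamma (xvar w) *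
    Gamma (3 / 4 + xvar w) *
    (Gamma (1 + xvar w) * Gamma (-xvar w) * sin (Real.pi * xvar w) * h34' + G3 * hs)

/-- The constant of proportionality between the residue and the scalar factor. -/
def residueConst : ℂ :=
  2 * kConst * (((2 * Real.pi * I) ^ 2 * Gamma (3 / 4)) ^ 2 * (Real.pi * I / 2) ^ 2) *
    phiT (Real.pi * I / 2) ^ 2 * FSU4 (Real.pi * I / 2) ^ 2 *
    (exp (Real.pi * I / 2 / 2) / (2 * cosh (Real.pi * I / 2 / 2))) * (I * Real.pi)

/-- The differences within each pair equal iπ/2 and contribute constants. The four differences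
between the pairs give exactly `crossed_product`, with its hyperbolic sine supplied by the
p-function. -/
theorem residue_eq {ω₁ ω₂ : ℂ} (hω : (ω₁, ω₂) ∈ rapidityDomain) (A : Fin 4 → Fin 4) :
    formFactorPrefactor (pairRapidities ω₁ ω₂ (Real.pi * I / 2) (Real.pi * I / 2)) *
        pairForm A
          (fun p k => leftPole p k (pairRapidities ω₁ ω₂ (Real.pi * I / 2) (Real.pi * I / 2)))
          (fun p k => rightPole p k (pairRapidities ω₁ ω₂ (Real.pi * I / 2) (Real.pi * I / 2))) =
      residueConst * (scalarFactor (ω₁ - ω₂) / cosh ((ω₁ - ω₂) / 2)) * pairSign A := by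
  obtain ⟨hne, him⟩ := hω
  simp only at hne him
  have hpi := Real.pi_pos
  have hb : -1 / 4 < (xvar (ω₁ - ω₂)).re ∧ (xvar (ω₁ - ω₂)).re < 1 / 4 := by
    obtain ⟨h2, h3⟩ := abs_lt.1 him
    rw [xvar_re, lt_div_iff₀ (by positivity), div_lt_iff₀ (by positivity)]
    constructor <;> linarith
  have hX := crossed_product (sub_ne_zero.2 hne) hb.1 hb.2
  have hP := kPrefactor_pairRapidities ω₁ ω₂ cosh_quarter_ne_zero (cosh_half_ne_zero him)
  have hd1 := pairRapidities_sub_left ω₁ ω₂ (Real.pi * I / 2) (Real.pi * I / 2)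
  have hd2 := pairRapidities_sub_right ω₁ ω₂ (Real.pi * I / 2) (Real.pi * I / 2)
  have d02 : pairRapidities ω₁ ω₂ (Real.pi * I / 2) (Real.pi * I / 2) 0 -
      pairRapidities ω₁ ω₂ (Real.pi * I / 2) (Real.pi * I / 2) 2 = ω₁ - ω₂ := by
    simp [pairRapidities]
  generalize hθ : pairRapidities ω₁ ω₂ (Real.pi * I / 2) (Real.pi * I / 2) = θ at *
  rw [pairForm_pole A θ rfl hd1 hd2, formFactorPrefactor, residueConst]
  generalize ω₁ - ω₂ = w at *
  generalize Real.pi * I / 2 = a at *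
  have d03 : θ 0 - θ 3 = w + a := by linear_combination d02 + hd2
  have d12 : θ 1 - θ 2 = w - a := by linear_combination d02 - hd1
  have d13 : θ 1 - θ 3 = w := by linear_combination d02 - hd1 + hd2
  have d21 : θ 2 - θ 1 = -(w - a) := by linear_combination -d12
  have d31 : θ 3 - θ 1 = -w := by linear_combination -d13
  have hF : ∏ i, ∏ j ∈ Finset.univ.filter (fun j => i < j), FSU4 (θ i - θ j) =
      FSU4 a ^ 2 * (FSU4 w ^ 2 * FSU4 (w + a) * FSU4 (w - a)) := by
    simp only [Fin.prod_univ_four, Finset.prod_filter]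
    simp [hd1, hd2, d02, d03, d12, d13]
    ring
  have h1 : ∏ i ∈ Finset.univ.erase (1 : Fin 4), phiT (θ i - θ 1) =
      phiT a * phiT (-(w - a)) * phiT (-w) := by
    have : Finset.univ.erase (1 : Fin 4) = {0, 2, 3} := by decide
    rw [this, Finset.prod_insert (by decide), Finset.prod_insert (by decide),
      Finset.prod_singleton, hd1, d21, d31, mul_assoc]
  have h3 : ∏ i ∈ Finset.univ.erase (3 : Fin 4), phiT (θ i - θ 3) =
      phiT (w + a) * phiT w * phiT a := by
    have : Finset.univ.erase (3 : Fin 4) = {0, 1, 2} := by decide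
    rw [this, Finset.prod_insert (by decide), Finset.prod_insert (by decide),
      Finset.prod_singleton, hd2, d03, d13, mul_assoc]
  rw [hF, h1, h3, d03, d13]
  linear_combination 2 * kConst * (((2 * Real.pi * I) ^ 2 * Gamma (3 / 4)) ^ 2 * a ^ 2) *
    phiT a ^ 2 * FSU4 a ^ 2 * pairSign A *
    ((FSU4 w ^ 2 * FSU4 (w + a) * FSU4 (w - a) *
      (phiT (-(w - a)) * phiT (-w) * phiT (w + a) * phiT w) * (bT (w + a) * bT w)) * hP +
      (exp (a / 2) / (2 * cosh (a / 2))) / cosh (w / 2) * hX)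

theorem Gamma_three_quarters_ne_zero : Gamma (3 / 4) ≠ 0 := Gamma_ne_zero_of_re_pos (by norm_num)

theorem kConst_ne_zero : kConst ≠ 0 := by
  have h1 := Gamma_three_quarters_ne_zero
  have h2 : Gamma (3 / 2) ≠ 0 := Gamma_ne_zero_of_re_pos (by norm_num)
  have hpi : (Real.pi : ℂ) ≠ 0 := by exact_mod_cast Real.pi_ne_zero
  simp [kConst, h1, h2, hpi]

theorem residueConst_ne_zero : residueConst ≠ 0 := by
  have h1 := Gamma_three_quarters_ne_zero
  have h2 := kConst_ne_zero
  have h3 := cosh_quarter_ne_zero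
  have hpi : (Real.pi : ℂ) ≠ 0 := by exact_mod_cast Real.pi_ne_zero
  have h4 : phiT (Real.pi * I / 2) ≠ 0 := by
    rw [phiT, xvar_pi_I_div_two]
    refine mul_ne_zero (Gamma_ne_zero_of_re_pos (by norm_num))
      (Gamma_ne_zero (ne_neg_nat_of_re (by norm_num) (by norm_num)))
  have h5 : FSU4 (Real.pi * I / 2) ≠ 0 := by
    rw [FSU4, xvar_pi_I_div_two]
    refine div_ne_zero (mul_ne_zero ?_ ?_) (mul_ne_zero ?_ ?_) <;>
      exact barnesG_ne_zero_of_re_pos (by norm_num)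
  simp [residueConst, h1, h2, h3, h4, h5, hpi]

theorem FO6_pi_I_ne_zero : FO6 (Real.pi * I) ≠ 0 := by
  have hx : xvar (Real.pi * I) = 1 / 2 := by
    have hpi : (Real.pi : ℂ) ≠ 0 := by exact_mod_cast Real.pi_ne_zero
    rw [xvar]; field_simp
  rw [FO6, hx]
  refine mul_ne_zero (div_ne_zero (mul_ne_zero ?_ ?_) (mul_ne_zero ?_ ?_))
    (div_ne_zero (mul_ne_zero ?_ ?_) (mul_ne_zero ?_ ?_)) <;>
    exact barnesG_ne_zero_of_re_pos (by norm_num)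

theorem fusionConst_ne_zero : fusionConst ≠ 0 := by
  have hpi : (Real.pi : ℂ) ≠ 0 := by exact_mod_cast Real.pi_ne_zero
  simp [fusionConst, Gamma_three_quarters_ne_zero, Complex.cpow_eq_zero_iff, hpi]

/-- The normalisation constant of the p-function. -/
def normConst (m : ℝ) : ℂ :=
  -(2 * (I * m) * fusionConst ^ 2 * (Gamma (3 / 4) ^ 2 / (FO6 (Real.pi * I) * Real.pi ^ 2)) /
    residueConst)

theorem normConst_ne_zero {m : ℝ} (hm : 0 < m) : normConst m ≠ 0 := by
  have hpi : (Real.pi : ℂ) ≠ 0 := by exact_mod_cast Real.pi_ne_zero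
  simp [normConst, Gamma_three_quarters_ne_zero, hpi, hm.ne', fusionConst_ne_zero,
    FO6_pi_I_ne_zero, residueConst_ne_zero]

/-- The iterated residue of the normalised `SU(4)` form factor at the bound state. -/
theorem hasBoundStateResidue_formFactor (m : ℝ) {ω₁ ω₂ : ℂ} (hω : (ω₁, ω₂) ∈ rapidityDomain)
    {ℓ₁ ℓ₂ : ℝ}
    (h : AdmissibleLines ℓ₁ ℓ₂ (pairRapidities ω₁ ω₂ (Real.pi * I / 2) (Real.pi * I / 2)))
    (A : Fin 4 → Fin 4) :
    HasBoundStateResidue (fun θ => normConst m * formFactorSU4 ℓ₁ ℓ₂ A θ) ω₁ ω₂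
      (2 * (I * m * (1 / cosh ((ω₁ - ω₂) / 2)) * Fminus (ω₁ - ω₂)) * fusionConst ^ 2 *
        pairSign A) := by
  have hpi := Real.pi_pos
  have hb : -1 / 4 < (xvar (ω₁ - ω₂)).re ∧ (xvar (ω₁ - ω₂)).re < 1 / 4 := by
    obtain ⟨h2, h3⟩ := abs_lt.1 hω.2
    simp only at h2 h3
    rw [xvar_re, lt_div_iff₀ (by positivity), div_lt_iff₀ (by positivity)]
    constructor <;> linarith
  obtain ⟨R, h1, h2⟩ := hasBoundStateResidue (pairRegular_boundState hω h) A
  refine ⟨fun s => normConst m * R s, h1.mono fun s hs => hs.const_mul _, ?_⟩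
  rw [residue_eq hω A] at h2
  have h3 := h2.const_mul (normConst m)
  have e : normConst m *
      (residueConst * (scalarFactor (ω₁ - ω₂) / cosh ((ω₁ - ω₂) / 2)) * pairSign A) =
      2 * (I * m * (1 / cosh ((ω₁ - ω₂) / 2)) * Fminus (ω₁ - ω₂)) * fusionConst ^ 2 *
        pairSign A := by
    rw [Fminus_eq hb.1 hb.2, normConst]
    have := residueConst_ne_zero
    generalize Gamma (3 / 4) ^ 2 / (FO6 (Real.pi * I) * Real.pi ^ 2) = c
    field_simp
  rwa [e] at h3

/-- The solution of the bound state formula. -/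
theorem bound_state_sum (c : ℂ) (A : Fin 4 → Fin 4) :
    ∑ α₁, ∑ α₂, c * antisymDelta 0 1 α₁ α₂ * (fusion (A 0) (A 1) α₁ * fusion (A 2) (A 3) α₂) =
      2⁻¹ * (2 * c * fusionConst ^ 2 * pairSign A) := by
  rw [pairSign_eq]
  simp only [fusion_eq, antisymDelta]
  generalize fusionSign (A 0) (A 1) = f
  generalize fusionSign (A 2) (A 3) = g
  simp [Fin.sum_univ_six]
  ring

/-! ### Antisymmetric `O(6)` tensors -/

/-- The matrix of a permutation of the colours. -/
def permO6 (σ : Equiv.Perm (Fin 6)) : Matrix (Fin 6) (Fin 6) ℂ :=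
  Matrix.of fun α γ => if σ α = γ then 1 else 0

theorem isO6_permO6 {σ : Equiv.Perm (Fin 6)} (h : ∀ i, σ i.rev = (σ i).rev) : IsO6 (permO6 σ) := by
  constructor
  · rw [Matrix.mem_unitaryGroup_iff]
    ext i j
    simp [Matrix.mul_apply, permO6, Matrix.one_apply, eq_comm]
  · ext i j
    obtain ⟨i, rfl⟩ := σ.surjective i
    obtain ⟨j, rfl⟩ := σ.surjective j
    simp [Matrix.mul_apply, permO6, chargeConj, ← h]
    exact if_congr eq_comm rfl rfl

/-- A reflection that mixes the colours `0, 1, 4, 5`. -/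
def reflectionO6 : Matrix (Fin 6) (Fin 6) ℂ :=
  !![1 / 2, -(1 / 2), 0, 0, -(1 / 2), -(1 / 2);
    -(1 / 2), 1 / 2, 0, 0, -(1 / 2), -(1 / 2);
    0, 0, 1, 0, 0, 0;
    0, 0, 0, 1, 0, 0;
    -(1 / 2), -(1 / 2), 0, 0, 1 / 2, -(1 / 2);
    -(1 / 2), -(1 / 2), 0, 0, -(1 / 2), 1 / 2]

theorem isO6_reflectionO6 : IsO6 reflectionO6 := by
  have hr : reflectionO6ᵀ = reflectionO6 := by
    ext i j; fin_cases i <;> fin_cases j <;> rfl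
  have hs : star reflectionO6 = reflectionO6 := by
    ext i j
    fin_cases i <;> fin_cases j <;> simp [reflectionO6, Matrix.star_apply]
  have hm : reflectionO6 * reflectionO6 = 1 := by
    ext i j
    fin_cases i <;> fin_cases j <;>
      simp [reflectionO6, Matrix.mul_apply, Fin.sum_univ_six] <;> norm_num
  have hc : chargeConj * reflectionO6 = reflectionO6 * chargeConj := by
    ext i j
    have h1 : (chargeConj * reflectionO6) i j = reflectionO6 i.rev j := by
      simp [Matrix.mul_apply, chargeConj, ← Fin.rev_eq_iff]
    have h2 : (reflectionO6 * chargeConj) i j = reflectionO6 i j.rev := by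
      simp [Matrix.mul_apply, chargeConj]
    rw [h1, h2]
    fin_cases i <;> fin_cases j <;> rfl
  refine ⟨?_, ?_⟩
  · rw [Matrix.mem_unitaryGroup_iff, hs, hm]
  · rw [hr, mul_assoc, hc, ← mul_assoc, hm, one_mul]

theorem IsO6.mul {U V : Matrix (Fin 6) (Fin 6) ℂ} (hU : IsO6 U) (hV : IsO6 V) : IsO6 (U * V) := by
  refine ⟨Submonoid.mul_mem _ hU.1 hV.1, ?_⟩
  rw [Matrix.transpose_mul]
  calc Vᵀ * Uᵀ * chargeConj * (U * V) = Vᵀ * (Uᵀ * chargeConj * U) * V := by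
        simp only [Matrix.mul_assoc]
    _ = _ := by rw [hU.2, hV.2]

/-- Two colours that are neither equal nor conjugate leave a third conjugate pair, so 0, 1 ↦ γ, δ
extends to a permutation compatible with conjugation. -/
theorem exists_perm_rev (γ δ : Fin 6) (h1 : γ ≠ δ) (h2 : δ ≠ γ.rev) :
    ∃ σ : Equiv.Perm (Fin 6), (∀ i, σ i.rev = (σ i).rev) ∧ σ 0 = γ ∧ σ 1 = δ := by
  have h : ∀ γ δ : Fin 6, γ ≠ δ → δ ≠ γ.rev → ∃ ε : Fin 6,
      Function.Injective ![γ, δ, ε, ε.rev, δ.rev, γ.rev] := by decide +kernel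
  obtain ⟨ε, hε⟩ := h γ δ h1 h2
  refine ⟨Equiv.ofBijective _ (Finite.injective_iff_bijective.1 hε), fun i => ?_, rfl, rfl⟩
  fin_cases i <;> simp [Fin.rev_rev]

/-- This replaces irreducibility of the antisymmetric square. Permutations dispose of all components
except the conjugate ones D γ γ̄, and a single reflection, conjugated by permutations, handles
these. -/
theorem antisymmetric_eq_zero {D : Fin 6 → Fin 6 → ℂ} (hD : ∀ α β, D β α = -D α β)
    (h : ∀ U, IsO6 U → ∑ γ, ∑ δ, U 0 γ * U 1 δ * D γ δ = 0) (α β : Fin 6) : D α β = 0 := by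
  have h0 : ∀ α, D α α = 0 := fun α => self_eq_neg.1 (hD α α)
  have h1 : ∀ γ δ, γ ≠ δ → δ ≠ γ.rev → D γ δ = 0 := fun γ δ a b => by
    obtain ⟨σ, hσ, s0, s1⟩ := exists_perm_rev γ δ a b
    have := h _ (isO6_permO6 hσ)
    simpa [permO6, s0, s1] using this
  -- The reflection mixes the colours of two conjugate pairs. Once the non-conjugate components are
  -- known to vanish, its relation reads -½ D γ γ̄ + ½ D δ δ̄ = 0.
  have h2 : ∀ γ δ, γ ≠ δ → δ ≠ γ.rev → D γ γ.rev = D δ δ.rev := fun γ δ a b => by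
    obtain ⟨σ, hσ, s0, s1⟩ := exists_perm_rev γ δ a b
    have hs := h _ (isO6_reflectionO6.mul (isO6_permO6 hσ))
    have hrow : ∀ i γ, (reflectionO6 * permO6 σ) i (σ γ) = reflectionO6 i γ := fun i γ => by
      simp [Matrix.mul_apply, permO6]
    have hs' : ∑ γ, ∑ δ, reflectionO6 0 γ * reflectionO6 1 δ * D (σ γ) (σ δ) = 0 := by
      rw [← hs]
      refine Fintype.sum_equiv σ _ _ fun γ => Fintype.sum_equiv σ _ _ fun δ => ?_
      rw [hrow, hrow]
    have hz : ∀ i j, i ≠ j → j ≠ i.rev → D (σ i) (σ j) = 0 := fun i j hij hij' =>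
      h1 _ _ (fun e => hij (σ.injective e)) fun e => hij' (σ.injective (e.trans (hσ i).symm))
    have s5 : σ 5 = γ.rev := by rw [← s0, ← hσ]; rfl
    have s4 : σ 4 = δ.rev := by rw [← s1, ← hσ]; rfl
    have a1 := hD γ γ.rev
    have a2 := hD δ δ.rev
    rw [← s0, ← s1] at *
    rw [← s5, ← s4] at *
    simp [Fin.sum_univ_six, reflectionO6, h0, hz 0 1 (by decide) (by decide),
      hz 0 4 (by decide) (by decide), hz 1 0 (by decide) (by decide),
      hz 1 5 (by decide) (by decide), hz 4 0 (by decide) (by decide),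
      hz 4 5 (by decide) (by decide), hz 5 1 (by decide) (by decide),
      hz 5 4 (by decide) (by decide), a1, a2] at hs'
    linear_combination -2 * hs'
  by_cases c1 : α = β
  · rw [c1, h0]
  by_cases c2 : β = α.rev
  -- Comparison with both δ and its conjugate gives D α ᾱ = D δ δ̄ = -D δ δ̄, hence zero.
  · have hex : ∀ α : Fin 6, ∃ δ : Fin 6, α ≠ δ ∧ δ ≠ α.rev ∧ α ≠ δ.rev ∧ δ.rev ≠ α.rev := by decide
    obtain ⟨δ, d1, d2, d3, d4⟩ := hex α
    have e1 := h2 α δ d1 d2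
    have e2 := h2 α δ.rev d3 d4
    rw [Fin.rev_rev, hD δ δ.rev] at e2
    rw [c2]
    linear_combination (e1 + e2) / 2
  · exact h1 α β c1 c2

theorem sum_antisymDelta_mul (α β : Fin 6) (u v : Fin 6 → ℂ) :
    ∑ γ₁, ∑ γ₂, antisymDelta α β γ₁ γ₂ * (u γ₁ * v γ₂) = u α * v β - u β * v α := by
  have h : ∀ a b : Fin 6, ∑ γ₁, ∑ γ₂, (if γ₁ = a ∧ γ₂ = b then (1 : ℂ) else 0) * (u γ₁ * v γ₂) =
      u a * v b := fun a b => by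
    simp [ite_and]
  simp only [antisymDelta, sub_mul, Finset.sum_sub_distrib, h]

theorem sum_mul_antisymDelta (α₁ α₂ : Fin 6) (u v : Fin 6 → ℂ) :
    ∑ γ, ∑ δ, u γ * v δ * antisymDelta γ δ α₁ α₂ = u α₁ * v α₂ - u α₂ * v α₁ := by
  have h : ∀ a b : Fin 6, ∑ γ₁, ∑ γ₂, u γ₁ * v γ₂ * (if a = γ₁ ∧ b = γ₂ then (1 : ℂ) else 0) =
      u a * v b := fun a b => by
    simp [ite_and]
  have h' : ∀ a b : Fin 6, ∑ γ₁, ∑ γ₂, u γ₁ * v γ₂ * (if a = γ₂ ∧ b = γ₁ then (1 : ℂ) else 0) =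
      u b * v a := fun a b => by
    simp [ite_and]
  simp only [antisymDelta, mul_sub, Finset.sum_sub_distrib, h, h']

theorem isAntisymmetricTensor_antisymDelta (f : ℂ → ℂ → ℂ) :
    IsAntisymmetricTensor fun α β α₁ α₂ θ₁ θ₂ => f θ₁ θ₂ * antisymDelta α β α₁ α₂ := by
  intro θ₁ θ₂ _ α β α₁ α₂
  refine ⟨by simp only [antisymDelta]; ring, fun U _ => ?_⟩
  have h1 := sum_antisymDelta_mul α β (fun γ => U γ α₁) (fun γ => U γ α₂)
  have h2 := sum_mul_antisymDelta α₁ α₂ (fun γ => U α γ) (fun γ => U β γ)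
  simp only [mul_assoc, mul_left_comm _ (f θ₁ θ₂), ← Finset.mul_sum] at h1 h2 ⊢
  rw [h1, h2]
  ring

/-! ### Uniqueness of the form factors -/

theorem HasResidueAt.unique {f : ℂ → ℂ} {a ρ σ : ℂ} (h1 : HasResidueAt f a ρ)
    (h2 : HasResidueAt f a σ) : ρ = σ := by
  obtain ⟨r, hr1, hr2⟩ := (h1.2.and h2.2).exists
  exact mul_left_cancel₀ two_pi_I_ne_zero' (hr1.symm.trans hr2)

theorem HasBoundStateResidue.unique {f : (Fin 4 → ℂ) → ℂ} {ω₁ ω₂ ρ σ : ℂ}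
    (h1 : HasBoundStateResidue f ω₁ ω₂ ρ) (h2 : HasBoundStateResidue f ω₁ ω₂ σ) : ρ = σ := by
  obtain ⟨R, hR, hR'⟩ := h1
  obtain ⟨S, hS, hS'⟩ := h2
  exact (hR'.congr ((hR.and hS).mono fun s hs => hs.2.unique hs.1)).unique hS'

theorem exists_admissibleLines {ω₁ ω₂ : ℂ} (h : (ω₁, ω₂) ∈ rapidityDomain) : ∃ ℓ₁ ℓ₂,
    AdmissibleLines ℓ₁ ℓ₂ (pairRapidities ω₁ ω₂ (Real.pi * I / 2) (Real.pi * I / 2)) := by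
  have him : |(ω₁ - ω₂).im| < Real.pi / 2 := h.2
  obtain ⟨h2, h3⟩ := abs_lt.1 him
  rw [sub_im] at h2 h3 him
  have hp4 : (Real.pi * I / 2 / 2 : ℂ).im = Real.pi / 4 := by
    have : (Real.pi * I / 2 / 2 : ℂ) = (Real.pi / 4 : ℝ) * I := by push_cast; ring
    rw [this]; simp
  -- The admissibility conditions form a chain of three strict inequalities with total slack π/2 -
  -- |Im(ω₁ - ω₂)|; each of them receives one third.
  set d := (Real.pi / 2 - |ω₁.im - ω₂.im|) / 3 with hd
  have hd0 : 0 < d := by rw [hd]; linarith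
  have e1 := le_abs_self (ω₁.im - ω₂.im)
  have e2 := neg_abs_le (ω₁.im - ω₂.im)
  have m1 := min_le_left ω₁.im ω₂.im
  have m2 := min_le_right ω₁.im ω₂.im
  have m3 : ω₁.im ≤ min ω₁.im ω₂.im + |ω₁.im - ω₂.im| := by
    rcases min_cases ω₁.im ω₂.im with ⟨h, _⟩ | ⟨h, _⟩ <;> rw [h] <;> linarith [abs_nonneg (ω₁.im - ω₂.im)]
  have m4 : ω₂.im ≤ min ω₁.im ω₂.im + |ω₁.im - ω₂.im| := by
    rcases min_cases ω₁.im ω₂.im with ⟨h, _⟩ | ⟨h, _⟩ <;> rw [h] <;> linarith [abs_nonneg (ω₁.im - ω₂.im)]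
  refine ⟨min ω₁.im ω₂.im - 3 * Real.pi / 4 - d, min ω₁.im ω₂.im - 5 * Real.pi / 4 - 2 * d,
    fun i => ?_, by linarith, fun i => ?_⟩ <;>
  fin_cases i <;> simp [pairRapidities, -Complex.div_ofNat_im, hp4] <;> linarith [Real.pi_pos]

theorem fusionSign_boundPair (α β : Fin 6) :
    fusionSign (boundPair α).1 (boundPair α).2 β = if α = β then 1 else 0 := by
  revert α β; decide

/-- Evaluation at the ordered colour pairs of the bound states isolates a single component, since
each intertwiner is supported on its own pair. -/
theorem fusion_injective {F : Fin 6 → Fin 6 → ℂ}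
    (h : ∀ A : Fin 4 → Fin 4, ∑ α₁, ∑ α₂, F α₁ α₂ * (fusion (A 0) (A 1) α₁ * fusion (A 2) (A 3) α₂)
      = 0) (α₁ α₂ : Fin 6) : F α₁ α₂ = 0 := by
  have h' := h ![(boundPair α₁).1, (boundPair α₁).2, (boundPair α₂).1, (boundPair α₂).2]
  simp [fusion_eq, fusionSign_boundPair, fusionConst_ne_zero] at h'
  exact h'

/-- The scalar factor of the form factor of the pseudo-potential. -/
def pseudoPotential (m : ℝ) (θ₁ θ₂ : ℂ) : ℂ :=
  I * m * (1 / cosh ((θ₁ - θ₂) / 2)) * Fminus (θ₁ - θ₂)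

theorem isPseudoPotentialFormFactor_antisymDelta (m : ℝ) :
    IsPseudoPotentialFormFactor (normConst m)
      fun α β α₁ α₂ θ₁ θ₂ => pseudoPotential m θ₁ θ₂ * antisymDelta α β α₁ α₂ :=
  ⟨isAntisymmetricTensor_antisymDelta _, fun _ _ hω _ _ hℓ A =>
    ⟨_, hasBoundStateResidue_formFactor m hω hℓ A, bound_state_sum _ A⟩⟩

/-- The highest weight component is fixed by uniqueness of the residue and injectivity of the
fusion. Equivariance expresses all (0,1) row combinations of the difference through this component,
so `antisymmetric_eq_zero` applies. -/
theorem IsPseudoPotentialFormFactor.eq {m : ℝ}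
    {T : Fin 6 → Fin 6 → Fin 6 → Fin 6 → ℂ → ℂ → ℂ}
    (h : IsPseudoPotentialFormFactor (normConst m) T) {θ₁ θ₂ : ℂ}
    (hθ : (θ₁, θ₂) ∈ rapidityDomain) (α β α₁ α₂ : Fin 6) :
    T α β α₁ α₂ θ₁ θ₂ = pseudoPotential m θ₁ θ₂ * antisymDelta α β α₁ α₂ := by
  obtain ⟨ℓ₁, ℓ₂, hℓ⟩ := exists_admissibleLines hθ
  have h01 : ∀ α₁ α₂, T 0 1 α₁ α₂ θ₁ θ₂ - pseudoPotential m θ₁ θ₂ * antisymDelta 0 1 α₁ α₂ = 0 := by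
    refine fusion_injective fun A => ?_
    obtain ⟨ρ, hρ, hs⟩ := h.2 θ₁ θ₂ hθ ℓ₁ ℓ₂ hℓ A
    rw [hρ.unique (hasBoundStateResidue_formFactor m hθ hℓ A)] at hs
    simp only [sub_mul, Finset.sum_sub_distrib]
    rw [hs, bound_state_sum, pseudoPotential, sub_self]
  have hT := h.1 θ₁ θ₂ hθ
  have hΔ := isAntisymmetricTensor_antisymDelta (pseudoPotential m) θ₁ θ₂ hθ
  refine sub_eq_zero.1 (antisymmetric_eq_zero (D := fun α β => T α β α₁ α₂ θ₁ θ₂ -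
    pseudoPotential m θ₁ θ₂ * antisymDelta α β α₁ α₂) (fun α β => ?_) (fun U hU => ?_) α β)
  · have e1 := (hT α β α₁ α₂).1
    have e2 := (hΔ α β α₁ α₂).1
    simp only at e2
    rw [e1, e2]; ring
  · simp only [mul_sub, Finset.sum_sub_distrib]
    rw [← (hT 0 1 α₁ α₂).2 U hU, ← (hΔ 0 1 α₁ α₂).2 U hU]
    simp only [fun γ₁ γ₂ => sub_eq_zero.1 (h01 γ₁ γ₂), sub_self]

/-! ### The current -/

theorem epsGrad_matrixElement (m : ℝ) (θ₁ θ₂ F : ℂ) (μ : Fin 2) (x : Fin 2 → ℝ) :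
    epsGrad μ (matrixElement m θ₁ θ₂ F) x = matrixElement m θ₁ θ₂
      (-I * ∑ ν, epsLower μ ν * (momentum m θ₁ ν + momentum m θ₂ ν) * F) x := by
  have hd : ∀ ν, lineDeriv ℝ (matrixElement m θ₁ θ₂ F) x (Pi.single ν 1) =
      -I * (metric ν * (momentum m θ₁ ν + momentum m θ₂ ν)) * matrixElement m θ₁ θ₂ F x := by
    intro ν
    have hx : ∀ t : ℝ, matrixElement m θ₁ θ₂ F (x + t • Pi.single ν 1) =
        exp (-I * (∑ μ, metric μ * x μ * (momentum m θ₁ μ + momentum m θ₂ μ)) +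
          t * (-I * (metric ν * (momentum m θ₁ ν + momentum m θ₂ ν)))) * F := by
      intro t
      rw [matrixElement]
      congr 2
      fin_cases ν <;> simp [Fin.sum_univ_two] <;> ring
    have h1 : HasDerivAt (fun t : ℝ => matrixElement m θ₁ θ₂ F (x + t • Pi.single ν 1))
        (-I * (metric ν * (momentum m θ₁ ν + momentum m θ₂ ν)) * matrixElement m θ₁ θ₂ F x) 0 := by
      simp only [hx]
      have h2 : HasDerivAt (fun t : ℝ => -I * (∑ μ, (metric μ : ℂ) * x μ *
          (momentum m θ₁ μ + momentum m θ₂ μ)) +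
          t * (-I * (metric ν * (momentum m θ₁ ν + momentum m θ₂ ν))))
          (1 * (-I * (metric ν * (momentum m θ₁ ν + momentum m θ₂ ν)))) 0 :=
        ((Complex.ofRealCLM.hasDerivAt (x := (0 : ℝ))).mul_const _).const_add _
      have h3 := h2.cexp.mul_const F
      refine h3.congr_deriv ?_
      rw [matrixElement, Complex.ofReal_zero, zero_mul, add_zero]
      ring
    exact h1.deriv
  have hm : ∀ ν, (metric ν : ℂ) * metric ν = 1 := fun ν => by
    fin_cases ν <;> simp [metric]
  simp only [epsGrad, hd]
  simp only [matrixElement, Finset.mul_sum]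
  refine Finset.sum_congr rfl fun ν _ => ?_
  linear_combination epsLower μ ν * (-I) * (momentum m θ₁ ν + momentum m θ₂ ν) *
    (exp (∑ i, -I * (metric i * x i * (momentum m θ₁ i + momentum m θ₂ i))) * F) * hm ν

/-- In terms of a = e^{θ₁/2} and b = e^{θ₂/2} both sides are rational. The momentum sums contain the
factor a² + b², which is the numerator of the hyperbolic cosine and cancels. -/
theorem spinorCurrent_eq (m : ℝ) {θ₁ θ₂ : ℂ} (h : cosh ((θ₁ - θ₂) / 2) ≠ 0) (μ : Fin 2) :
    spinorCurrent m μ θ₁ θ₂ = -I * (∑ ν, epsLower μ ν * (momentum m θ₁ ν + momentum m θ₂ ν)) *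
      (m * (1 / cosh ((θ₁ - θ₂) / 2))) := by
  have e1 : exp θ₁ = exp (θ₁ / 2) ^ 2 := by rw [← Complex.exp_nat_mul]; ring_nf
  have e2 : exp θ₂ = exp (θ₂ / 2) ^ 2 := by rw [← Complex.exp_nat_mul]; ring_nf
  have conj_two : (starRingEnd ℂ) 2 = 2 := map_ofNat _ 2
  have hv : star (spinorV m (starRingEnd ℂ θ₁)) =
      ![-(m * I) * (exp (θ₁ / 2))⁻¹, m * I * exp (θ₁ / 2)] := by
    ext i
    fin_cases i <;> simp [spinorV, ← Complex.exp_conj, conj_two, neg_div, Complex.exp_neg]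
  have hc : cosh ((θ₁ - θ₂) / 2) =
      (exp (θ₁ / 2) * (exp (θ₂ / 2))⁻¹ + (exp (θ₁ / 2))⁻¹ * exp (θ₂ / 2)) / 2 := by
    rw [Complex.cosh, sub_div, neg_sub, Complex.exp_sub, Complex.exp_sub]
    ring
  have n1 := Complex.exp_ne_zero (θ₁ / 2)
  have n2 := Complex.exp_ne_zero (θ₂ / 2)
  have hvu : ∀ M : Matrix (Fin 2) (Fin 2) ℂ, (spinorVbar m θ₁ ᵥ* M) ⬝ᵥ spinorU m θ₂ = -(m ^ 2 * I) *
      ((-exp (θ₁ / 2) * M 0 0 + (exp (θ₁ / 2))⁻¹ * M 1 0) * (exp (θ₂ / 2))⁻¹ +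
        (-exp (θ₁ / 2) * M 0 1 + (exp (θ₁ / 2))⁻¹ * M 1 1) * exp (θ₂ / 2)) := fun M => by
    rw [spinorVbar, hv]
    simp [spinorU, gammaUpper, Matrix.vecMul, dotProduct, Fin.sum_univ_two, neg_div,
      Complex.exp_neg]
    ring
  have m0 : ∀ θ, momentum m θ 0 = m * ((exp θ + (exp θ)⁻¹) / 2) := fun θ => by
    simp [momentum, Complex.cosh, Complex.exp_neg]
  have m1 : ∀ θ, momentum m θ 1 = m * ((exp θ - (exp θ)⁻¹) / 2) := fun θ => by
    simp [momentum, Complex.sinh, Complex.exp_neg]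
  rw [spinorCurrent, hvu, Fin.sum_univ_two, m0, m0, m1, m1, e1, e2]
  rw [hc] at h ⊢
  clear hvu hv hc e1 e2 m0 m1
  generalize exp (θ₁ / 2) = a at *
  generalize exp (θ₂ / 2) = b at *
  have hab : a ^ 2 + b ^ 2 ≠ 0 := fun h0 => h (by
    field_simp
    linear_combination h0)
  fin_cases μ <;> simp [gammaLower, gammaUpper, metric, epsLower] <;> field_simp <;> ring

end GrossNeveu

end

theorem mainTheorem5 :
    (∀ (ℓ₁ ℓ₂ : ℝ) (θ : Fin 4 → ℂ), GrossNeveu.AdmissibleLines ℓ₁ ℓ₂ θ →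
      (∀ i j, i ≠ j → θ i ≠ θ j ∧ θ i - θ j ≠ Real.pi * Complex.I / 2) →
      ∀ A : Fin 4 → Fin 4, GrossNeveu.KConverges ℓ₁ ℓ₂ A θ) ∧
    ∀ m : ℝ, 0 < m → ∃ N : ℂ, N ≠ 0 ∧
      (∃ T, GrossNeveu.IsPseudoPotentialFormFactor N T) ∧
      ∀ T, GrossNeveu.IsPseudoPotentialFormFactor N T →
        ∀ θ₁ θ₂ : ℂ, (θ₁, θ₂) ∈ GrossNeveu.rapidityDomain → ∀ α β α₁ α₂ : Fin 6,
          T α β α₁ α₂ θ₁ θ₂ =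
              Complex.I * m * GrossNeveu.antisymDelta α β α₁ α₂ *
                (1 / Complex.cosh ((θ₁ - θ₂) / 2)) * GrossNeveu.Fminus (θ₁ - θ₂) ∧
          ∀ (μ : Fin 2) (x : Fin 2 → ℝ),
            GrossNeveu.epsGrad μ
                (GrossNeveu.matrixElement m θ₁ θ₂ (T α β α₁ α₂ θ₁ θ₂)) x =
              GrossNeveu.matrixElement m θ₁ θ₂
                (Complex.I * GrossNeveu.antisymDelta α β α₁ α₂ *
                  GrossNeveu.spinorCurrent m μ θ₁ θ₂ * GrossNeveu.Fminus (θ₁ - θ₂)) x := by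
  refine ⟨fun ℓ₁ ℓ₂ θ h hθ A => GrossNeveu.kConverges h hθ A, fun m hm =>
    ⟨GrossNeveu.normConst m, GrossNeveu.normConst_ne_zero hm,
      ⟨_, GrossNeveu.isPseudoPotentialFormFactor_antisymDelta m⟩,
      fun T hT θ₁ θ₂ hθ α β α₁ α₂ => ⟨?_, fun μ x => ?_⟩⟩⟩
  · rw [hT.eq hθ, GrossNeveu.pseudoPotential]
    ring
  · rw [GrossNeveu.epsGrad_matrixElement, hT.eq hθ, GrossNeveu.pseudoPotential,
      GrossNeveu.spinorCurrent_eq m (GrossNeveu.cosh_half_ne_zero hθ.2), ← Finset.sum_mul]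
    congr 1
    ring
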